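/- Let $m,n\ge 1$. Write points of $\mathbb R^{m}\times\mathbb R^{n}$ as $(t,x)$, let $g=-\sum_{i}dt_i^2+\sum_j dx_j^2$ and $\square=-\sum_{i=1}^m\partial_{t_i}^2+\sum_{j=1}^n\partial_{x_j}^2$. For $p=(t(p),x(p))$ put $$r_p=|x-x(p)|,\qquad f_p=\tfrac14\big(|x-x(p)|^2-|t-t(p)|^2\big),\qquad \mathfrak D_p=\{f_p>0\}.$$ For $T>0$ let $G=(-T,T)^m$. Let $\mathfrak U\subset G\times\mathbb R^n$ be of one of the following two kinds, where $\partial\mathfrak U$ always denotes the spatial part of the boundary, i.e. the set of boundary points $(t,x)$ with $t\in G$. * (Static.) $\mathfrak U=G\times\Omega$ with $\Omega\subset\mathbb R^n$ non-empty, open and bounded with smooth boundary; then $\partial\mathfrak U=G\times\partial\Omega$. * (Moving along one time coordinate $t_j$.) $\mathfrak U=\{(t,x): t\in G,\ x\in\Omega_{t_j}\}$ is open, each $\Omega_s$ ($-T<s<T$) is non-empty, open and bounded, $\partial\mathfrak U$ is smooth and timelike (its $g$-normals are spacelike), and there is a vector field $\mathcal Y$, smooth on $\overline{\mathfrak U}$,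 timelike, with positive $t_j$-component and tangent to $\partial\mathfrak U$. Let $\mathcal N$ be the outward pointing unit normal of $\mathfrak U$ on $\partial\mathfrak U$ with respect to $g$, and for $\varepsilon>0$ let $$\Gamma_p^\varepsilon=\partial\mathfrak U\cap\mathfrak D_p\cap\{(1-\varepsilon r_p)\,\mathcal N f_p+\varepsilon f_p\,\mathcal N r_p>0\}.$$ **Theorem.** There is a constant $c>0$ depending only on $m,n$ such that the following holds. Let $\mathfrak U$ and $p\in\mathbb R^{m+n}$ be as above, with $\mathfrak U\cap\mathfrak D_p\neq\emptyset$. Suppose $R_+:=\sup_{\mathfrak U\cap\mathfrak D_p}r_p$ satisfies $T>R_++\max_i|t_i(p)|$ (so $T>R_+$ if $t(p)=0$), and let $0<\varepsilon\le c/R_+$. Let $\mathcal X,V,F$ be smooth on $\overline{\mathfrak U}$ (with values in $\mathbb R^{m+n}$, $\mathbb R$, $\mathbb R$), with $\mathcal X=0$ on $\mathfrak U\cap\{f_p=0\}=\mathfrak U\cap\partial\mathfrak D_p$, and let $H$ be a real function on $\partial\mathfrak U$. Let $z_1,z_2\in C^2(\mathfrak U)\cap C^1(\mathfrak U\cup\partial\mathfrak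 U)$ both satisfy $$\square z+\nabla_{\mathcal X}z+Vz=F\ \text{ in }\mathfrak U,\qquad z=H\ \text{ on }\partial\mathfrak U .$$ If $\mathcal N z_1=\mathcal N z_2$ on $\Gamma_p^\varepsilon$, then $z_1=z_2$ on $\mathfrak U\cap\mathfrak D_p$. -/

import Mathlib

open Set Filter Topology
open scoped ContDiff

noncomputable section

/-- `ℝ^m × ℝ^n`; a point is `(t, x)` with `m` time and `n` space coordinates. -/
abbrev Spacetime (m n : ℕ) : Type :=
  EuclideanSpace ℝ (Fin m) × EuclideanSpace ℝ (Fin n)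

namespace Ultrahyperbolic

variable {m n : ℕ}

/-- The metric `g = -dt₁² - ⋯ - dt_m² + dx₁² + ⋯ + dx_n²`. -/
def metric (v w : Spacetime m n) : ℝ := inner ℝ v.2 w.2 - inner ℝ v.1 w.1

/-- The coordinate vector `∂_{t_i}`. -/
def dt (i : Fin m) : Spacetime m n := (EuclideanSpace.single i 1, 0)

/-- The coordinate vector `∂_{x_j}`. -/
def dx (j : Fin n) : Spacetime m n := (0, EuclideanSpace.single j 1)

/-- The ultrahyperbolic operator `□z = -∑ ∂²z/∂t_i² + ∑ ∂²z/∂x_j²`. -/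
def box (z : Spacetime m n → ℝ) (q : Spacetime m n) : ℝ :=
  -(∑ i : Fin m, fderiv ℝ (fderiv ℝ z) q (dt i) (dt i))
    + ∑ j : Fin n, fderiv ℝ (fderiv ℝ z) q (dx j) (dx j)

/-- `f_p = (|x - x(p)|² - |t - t(p)|²) / 4`. -/
def fFun (p q : Spacetime m n) : ℝ := (‖q.2 - p.2‖ ^ 2 - ‖q.1 - p.1‖ ^ 2) / 4

/-- `r_p = |x - x(p)|`. -/
def rFun (p q : Spacetime m n) : ℝ := ‖q.2 - p.2‖

/-- `𝔇_p = {f_p > 0}`, the exterior of the null cone at `p`. -/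
def nullExterior (p : Spacetime m n) : Set (Spacetime m n) := {q | 0 < fFun p q}

/-- The time cube `G = (-T, T)^m`. -/
def timeCube (m : ℕ) (T : ℝ) : Set (EuclideanSpace ℝ (Fin m)) :=
  {t | ∀ i, -T < t i ∧ t i < T}

/-- The spatial part of the boundary of `U`, i.e. the boundary points whose time lies in the open
cube `G`. For `U = G × Ω` this is `G × ∂Ω`. -/
def lateralBoundary (T : ℝ) (U : Set (Spacetime m n)) : Set (Spacetime m n) :=
  {q | q ∈ frontier U ∧ q.1 ∈ timeCube m T}

/-- `φ` is a smooth defining function of the set `S` near its boundary point `x`: it is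
negative exactly on `S` near `x`, and its differential at `x` does not vanish. -/
def IsDefiningFunctionAt {E : Type*} [NormedAddCommGroup E] [NormedSpace ℝ E]
    (S : Set E) (x : E) (φ : E → ℝ) : Prop :=
  ContDiff ℝ ∞ φ ∧ φ x = 0 ∧ fderiv ℝ φ x ≠ 0 ∧ ∀ᶠ y in 𝓝 x, (y ∈ S ↔ φ y < 0)

/-- `S` has smooth boundary at all the boundary points in `B`. -/
def SmoothBoundaryOn {E : Type*} [NormedAddCommGroup E] [NormedSpace ℝ E]
    (S B : Set E) : Prop :=
  ∀ x ∈ B, ∃ φ : E → ℝ, IsDefiningFunctionAt S x φ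

/-- `N` is a normal of `U` at the boundary point `q` with respect to the metric `g`: it is the
`g`-gradient of a defining function. If `g(N, N) > 0`, such an `N` points out of `U`. -/
def IsNormal (U : Set (Spacetime m n)) (q N : Spacetime m n) : Prop :=
  ∃ φ : Spacetime m n → ℝ, IsDefiningFunctionAt U q φ ∧ ∀ w, fderiv ℝ φ q w = metric N w

/-- `N` is the outward pointing unit normal of `U` at `q` with respect to `g`. -/
def IsOuterUnitNormal (U : Set (Spacetime m n)) (q N : Spacetime m n) : Prop :=
  IsNormal U q N ∧ metric N N = 1

/-- Time static domains `U = G × Ω`. -/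
def IsStaticDomain (T : ℝ) (U : Set (Spacetime m n)) : Prop :=
  ∃ Ω : Set (EuclideanSpace ℝ (Fin n)),
    Ω.Nonempty ∧ IsOpen Ω ∧ Bornology.IsBounded Ω ∧ SmoothBoundaryOn Ω (frontier Ω) ∧
      U = timeCube m T ×ˢ Ω

/-- Domains that move along one time coordinate `t_j`: the slice of `U` at the time `t ∈ G` is
`Ω_{t_j}`, the boundary is smooth and timelike (its normals are spacelike), and there is a
smooth timelike vector field `Y` with positive `t_j`-component which is tangent to the boundary. -/
def IsMovingDomain (T : ℝ) (U : Set (Spacetime m n)) : Prop :=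
  ∃ (j : Fin m) (Ω : ℝ → Set (EuclideanSpace ℝ (Fin n))),
    (∀ s ∈ Ioo (-T) T, (Ω s).Nonempty ∧ IsOpen (Ω s) ∧ Bornology.IsBounded (Ω s)) ∧
    U = {q | q.1 ∈ timeCube m T ∧ q.2 ∈ Ω (q.1 j)} ∧
    IsOpen U ∧
    SmoothBoundaryOn U (lateralBoundary T U) ∧
    (∀ q ∈ lateralBoundary T U, ∀ N, IsNormal U q N → 0 < metric N N) ∧
    ∃ Y : Spacetime m n → Spacetime m n,
      ContDiffOn ℝ ∞ Y (closure U) ∧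
      (∀ q ∈ closure U, metric (Y q) (Y q) < 0 ∧ 0 < (Y q).1 j) ∧
      ∀ q ∈ lateralBoundary T U, ∀ N, IsNormal U q N → metric (Y q) N = 0

/-- `z ∈ C²(U)`, `z` is `C¹` up to the spatial boundary, `□z + ∇_X z + V z = F` in `U`, and
`z = H` on the spatial boundary. -/
structure IsSolution (T : ℝ) (U : Set (Spacetime m n)) (X : Spacetime m n → Spacetime m n)
    (V F H z : Spacetime m n → ℝ) : Prop where
  contDiffOn_two : ContDiffOn ℝ 2 z U
  contDiffOn_one : ContDiffOn ℝ 1 z (U ∪ lateralBoundary T U)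
  equation : ∀ q ∈ U, box z q + fderiv ℝ z q (X q) + V q * z q = F q
  dirichlet : ∀ q ∈ lateralBoundary T U, z q = H q

/-- The derivative of `z` at a spatial boundary point `q` in the direction `N`, taken
from within `U` and its spatial boundary. -/
def boundaryDeriv (T : ℝ) (U : Set (Spacetime m n)) (z : Spacetime m n → ℝ)
    (q N : Spacetime m n) : ℝ :=
  fderivWithin ℝ z (U ∪ lateralBoundary T U) q N

/-- `Γ_p^ε = ∂U ∩ 𝔇_p ∩ {(1 - ε r_p) 𝒩 f_p + ε f_p 𝒩 r_p > 0}`, with `𝒩` the outward pointing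
unit normal. -/
def Gam (T : ℝ) (U : Set (Spacetime m n)) (p : Spacetime m n) (ε : ℝ) :
    Set (Spacetime m n) :=
  {q | q ∈ lateralBoundary T U ∧ q ∈ nullExterior p ∧ ∃ N, IsOuterUnitNormal U q N ∧
    0 < (1 - ε * rFun p q) * fderiv ℝ (fFun p) q N + ε * fFun p q * fderiv ℝ (rFun p) q N}

end Ultrahyperbolic

end

/-
The difference `z` of the two solutions solves the homogeneous equation and vanishes on `∂U`. Let
`weight = f_p / (1 - ε r_p)`, whose gradient is a positive multiple of
`Y = (1 - ε r_p) ∇f_p + ε f_p ∇r_p`, and put `w = weight ^ a * z`. The multiplier `Y w + γ w / 2`,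
applied to the conjugated equation for `w`, gives a current `P` with `div P ≥ (a² ε / (16 r_p)) w²`
for large `a`: the radial term `ε r_p` makes the deformation of `Y` coercive up to multiples of
`(Y w)²`, which the conjugation supplies with the factor `a`. Since `X` vanishes on the null cone,
which is reached from nearby points of `U` along timelike segments of comparable length,
`|X|² ≤ C f_p`, and the drift is absorbed as well.

On `∂U` the function `z` vanishes, so `dz` is a multiple of the conormal `dφ`, and the flux of `P`
is a nonnegative multiple of `g(∇φ, ∇φ) · Y φ`. The first factor is positive because the boundary
is timelike; the second is nonpositive off `Γ`, and on `Γ` the flux vanishes as `dz = 0` there.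
At the null cone `P = O(f_p²)`, so a cutoff at `f_p ≈ 1 / k` costs nothing in the limit. Integrating
the divergence therefore forces `w = 0`. As `z` is only `C¹` up to `∂U`, the divergence theorem is
used in weak form and the domain is exhausted from inside by cutoffs of the defining functions.
-/

noncomputable section

namespace Ultrahyperbolic

open Asymptotics

/-! ### Coordinates and partial derivatives -/

section Coordinates

variable {m n : ℕ}

/-- The coordinate vector fields `∂_{t_1}, …, ∂_{t_m}, ∂_{x_1}, …, ∂_{x_n}` as one family. -/
def coordVec : Fin m ⊕ Fin n → Spacetime m n := Sum.elim dt dx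

/-- The diagonal entries of the metric in the coordinates `coordVec`. -/
def gSign : Fin m ⊕ Fin n → ℝ := Sum.elim (fun _ => -1) (fun _ => 1)

/-- The indicator function of the spatial indices. -/
def spaceInd : Fin m ⊕ Fin n → ℝ := Sum.elim (fun _ => 0) (fun _ => 1)

/-- The coordinates of a vector in the basis `coordVec`. -/
def coord (v : Spacetime m n) : Fin m ⊕ Fin n → ℝ := Sum.elim (fun i => v.1 i) (fun j => v.2 j)

@[simp] lemma gSign_inl (i : Fin m) : gSign (Sum.inl i : Fin m ⊕ Fin n) = -1 := rfl
@[simp] lemma gSign_inr (j : Fin n) : gSign (Sum.inr j : Fin m ⊕ Fin n) = 1 := rfl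
@[simp] lemma spaceInd_inl (i : Fin m) : spaceInd (Sum.inl i : Fin m ⊕ Fin n) = 0 := rfl
@[simp] lemma spaceInd_inr (j : Fin n) : spaceInd (Sum.inr j : Fin m ⊕ Fin n) = 1 := rfl
@[simp] lemma coord_inl (v : Spacetime m n) (i : Fin m) : coord v (Sum.inl i) = v.1 i := rfl
@[simp] lemma coord_inr (v : Spacetime m n) (j : Fin n) : coord v (Sum.inr j) = v.2 j := rfl
@[simp] lemma coordVec_inl (i : Fin m) : (coordVec (Sum.inl i) : Spacetime m n) = dt i := rfl
@[simp] lemma coordVec_inr (j : Fin n) : (coordVec (Sum.inr j) : Spacetime m n) = dx j := rfl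

lemma gSign_mul_self (i : Fin m ⊕ Fin n) : gSign i * gSign i = 1 := by
  rcases i with i | j <;> simp

lemma sum_coord_smul_coordVec (v : Spacetime m n) : ∑ i, coord v i • coordVec i = v := by
  simp only [Fintype.sum_sum_type, coord_inl, coord_inr, coordVec_inl, coordVec_inr, dt, dx]
  ext i
  · simp [Prod.fst_sum, Finset.sum_apply, Pi.single_apply]
  · simp [Prod.snd_sum, Finset.sum_apply, Pi.single_apply]

lemma map_eq_sum_coord {F : Type*} [NormedAddCommGroup F] [NormedSpace ℝ F]
    (L : Spacetime m n →L[ℝ] F) (v : Spacetime m n) :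
    L v = ∑ i, coord v i • L (coordVec i) := by
  conv_lhs => rw [← sum_coord_smul_coordVec v]
  simp [map_sum]

lemma metric_eq_sum (v w : Spacetime m n) :
    metric v w = ∑ i, gSign i * coord v i * coord w i := by
  simp only [metric, Fintype.sum_sum_type, PiLp.inner_apply, RCLike.inner_apply,
    Real.ringHom_apply, mul_comm, coord_inl, coord_inr, gSign_inl, gSign_inr, neg_mul, one_mul,
    Finset.sum_neg_distrib]
  ring

lemma metric_coordVec (v : Spacetime m n) (i : Fin m ⊕ Fin n) :
    metric v (coordVec i) = gSign i * coord v i := by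
  rcases i with i | j <;> simp [metric, dt, dx, EuclideanSpace.inner_single_right]

end Coordinates

section PartialDerivatives

variable {m n : ℕ}

/-- The partial derivative of `u` in the coordinate direction `i`. -/
def pderiv (i : Fin m ⊕ Fin n) (u : Spacetime m n → ℝ) (q : Spacetime m n) : ℝ :=
  fderiv ℝ u q (coordVec i)

/-- `u` is differentiable at `q` with the partial derivatives `u'`. -/
def HasPartials (u : Spacetime m n → ℝ) (u' : Fin m ⊕ Fin n → ℝ) (q : Spacetime m n) : Prop :=
  DifferentiableAt ℝ u q ∧ ∀ i, pderiv i u q = u' i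

variable {u v : Spacetime m n → ℝ} {u' v' : Fin m ⊕ Fin n → ℝ} {p q : Spacetime m n}

lemma hasPartials_pderiv (h : DifferentiableAt ℝ u q) :
    HasPartials u (fun i => pderiv i u q) q := ⟨h, fun _ => rfl⟩

namespace HasPartials

lemma congr (h : HasPartials u u' q) (hv : ∀ i, u' i = v' i) : HasPartials u v' q :=
  ⟨h.1, fun i => (h.2 i).trans (hv i)⟩

lemma const (c : ℝ) (q : Spacetime m n) : HasPartials (fun _ => c) (fun _ => 0) q :=
  ⟨differentiableAt_const c, fun i => by simp [pderiv]⟩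

lemma add (hu : HasPartials u u' q) (hv : HasPartials v v' q) :
    HasPartials (fun y => u y + v y) (fun i => u' i + v' i) q :=
  ⟨hu.1.add hv.1, fun i => by
    simp only [← hu.2, ← hv.2, pderiv, fderiv_fun_add hu.1 hv.1, add_apply]⟩

lemma sub (hu : HasPartials u u' q) (hv : HasPartials v v' q) :
    HasPartials (fun y => u y - v y) (fun i => u' i - v' i) q :=
  ⟨hu.1.sub hv.1, fun i => by
    simp only [← hu.2, ← hv.2, pderiv, fderiv_fun_sub hu.1 hv.1, sub_apply]⟩

lemma mul (hu : HasPartials u u' q) (hv : HasPartials v v' q) :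
    HasPartials (fun y => u y * v y) (fun i => u' i * v q + u q * v' i) q :=
  ⟨hu.1.mul hv.1, fun i => by
    simp only [← hu.2, ← hv.2, pderiv, fderiv_fun_mul hu.1 hv.1, add_apply, smul_apply,
      smul_eq_mul]
    ring⟩

lemma const_mul (c : ℝ) (hu : HasPartials u u' q) :
    HasPartials (fun y => c * u y) (fun i => c * u' i) q :=
  ((const c q).mul hu).congr fun i => by ring

lemma inv (hu : HasPartials u u' q) (h0 : u q ≠ 0) :
    HasPartials (fun y => (u y)⁻¹) (fun i => -u' i / u q ^ 2) q := by
  have h : HasFDerivAt (fun y => (u y)⁻¹) ((-(u q ^ 2)⁻¹) • fderiv ℝ u q) q :=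
    (hasDerivAt_inv h0).comp_hasFDerivAt q hu.1.hasFDerivAt
  refine ⟨h.differentiableAt, fun i => ?_⟩
  simp only [← hu.2, pderiv, h.fderiv, smul_apply, smul_eq_mul]
  ring

lemma pow (hu : HasPartials u u' q) (k : ℕ) :
    HasPartials (fun y => u y ^ k) (fun i => k * u q ^ (k - 1) * u' i) q :=
  ⟨hu.1.pow k, fun i => by
    simp [← hu.2, pderiv, fderiv_fun_pow k hu.1]⟩

lemma sum {ι : Type*} {s : Finset ι} {u : ι → Spacetime m n → ℝ}
    {u' : ι → Fin m ⊕ Fin n → ℝ} (h : ∀ j ∈ s, HasPartials (u j) (u' j) q) :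
    HasPartials (fun y => ∑ j ∈ s, u j y) (fun i => ∑ j ∈ s, u' j i) q :=
  ⟨DifferentiableAt.fun_sum fun j hj => (h j hj).1, fun i => by
    rw [pderiv, fderiv_fun_sum fun j hj => (h j hj).1]
    simp only [sum_apply]
    exact Finset.sum_congr rfl fun j hj => (h j hj).2 i⟩

end HasPartials

/-- The coordinate functional dual to `coordVec j`. -/
def coordCLM (j : Fin m ⊕ Fin n) : Spacetime m n →L[ℝ] ℝ :=
  Sum.elim (fun i => (EuclideanSpace.proj i).comp (ContinuousLinearMap.fst ℝ _ _))
    (fun i => (EuclideanSpace.proj i).comp (ContinuousLinearMap.snd ℝ _ _)) j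

lemma coordCLM_apply (j : Fin m ⊕ Fin n) (v : Spacetime m n) : coordCLM j v = coord v j := by
  rcases j with j | j <;> rfl

lemma coord_coordVec (i j : Fin m ⊕ Fin n) :
    coord (coordVec i : Spacetime m n) j = if i = j then 1 else 0 := by
  rcases i with i | i <;> rcases j with j | j <;> simp [dt, dx, eq_comm]

lemma contDiff_coord_sub (p : Spacetime m n) (j : Fin m ⊕ Fin n) {k : WithTop ℕ∞} :
    ContDiff ℝ k (fun y => coord (y - p) j) := by
  simp only [← coordCLM_apply]
  fun_prop

lemma hasPartials_coord_sub (p q : Spacetime m n) (j : Fin m ⊕ Fin n) :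
    HasPartials (fun y => coord (y - p) j) (fun i => if i = j then 1 else 0) q := by
  have h : HasFDerivAt (fun y => coord (y - p) j) (coordCLM j) q := by
    simp only [← coordCLM_apply]
    exact (coordCLM j).hasFDerivAt.comp q ((hasFDerivAt_id q).sub_const p)
  exact ⟨h.differentiableAt, fun i => by rw [pderiv, h.fderiv, coordCLM_apply, coord_coordVec]⟩

lemma fderiv_eq_sum_pderiv (u : Spacetime m n → ℝ) (q v : Spacetime m n) :
    fderiv ℝ u q v = ∑ i, coord v i * pderiv i u q := map_eq_sum_coord _ v

lemma hasPartials_pderiv_of_contDiffAt (hu : ContDiffAt ℝ 2 u q) (i : Fin m ⊕ Fin n) :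
    HasPartials (pderiv i u) (fun j => fderiv ℝ (fderiv ℝ u) q (coordVec j) (coordVec i)) q := by
  have hd : DifferentiableAt ℝ (fderiv ℝ u) q :=
    (hu.fderiv_right (m := 1) (by norm_num)).differentiableAt (by norm_num)
  have h : HasFDerivAt (fun y => fderiv ℝ u y (coordVec i))
      ((fderiv ℝ (fderiv ℝ u) q).flip (coordVec i)) q := by
    simpa using hd.hasFDerivAt.clm_apply (hasFDerivAt_const (coordVec i) q)
  exact ⟨h.differentiableAt, fun j => congrArg (fun L => L (coordVec j)) h.fderiv⟩

lemma differentiableAt_pderiv (hu : ContDiffAt ℝ 2 u q) (i : Fin m ⊕ Fin n) :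
    DifferentiableAt ℝ (pderiv i u) q := (hasPartials_pderiv_of_contDiffAt hu i).1

lemma eventually_differentiableAt (hu : ContDiffAt ℝ 2 u q) :
    ∀ᶠ y in 𝓝 q, DifferentiableAt ℝ u y :=
  (hu.eventually (by simp)).mono fun _ hy => hy.differentiableAt (by norm_num)

lemma box_eq_sum_pderiv_pderiv (hu : ContDiffAt ℝ 2 u q) :
    box u q = ∑ i, gSign i * pderiv i (pderiv i u) q := by
  simp only [fun i => (hasPartials_pderiv_of_contDiffAt hu i).2 i]
  rw [box, Fintype.sum_sum_type]
  simp

lemma pderiv_comm (hu : ContDiffAt ℝ 2 u q) (i j : Fin m ⊕ Fin n) :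
    pderiv i (pderiv j u) q = pderiv j (pderiv i u) q := by
  rw [(hasPartials_pderiv_of_contDiffAt hu j).2, (hasPartials_pderiv_of_contDiffAt hu i).2]
  exact hu.isSymmSndFDerivAt (by simp) _ _

lemma box_eq_sum_of_hasPartials {u' : Fin m ⊕ Fin n → Spacetime m n → ℝ}
    {u'' : Fin m ⊕ Fin n → Fin m ⊕ Fin n → ℝ} (hu : ContDiffAt ℝ 2 u q)
    (hu' : ∀ᶠ y in 𝓝 q, HasPartials u (fun i => u' i y) y)
    (hu'' : ∀ i, HasPartials (u' i) (u'' i) q) : box u q = ∑ i, gSign i * u'' i i := by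
  rw [box_eq_sum_pderiv_pderiv hu]
  refine Finset.sum_congr rfl fun i _ => ?_
  have he : pderiv i u =ᶠ[𝓝 q] u' i := hu'.mono fun y hy => hy.2 i
  rw [← (hu'' i).2 i, pderiv, he.fderiv_eq, pderiv]

lemma box_add (hu : ContDiffAt ℝ 2 u q) (hv : ContDiffAt ℝ 2 v q) :
    box (fun y => u y + v y) q = box u q + box v q := by
  have hd := (eventually_differentiableAt hu).and (eventually_differentiableAt hv)
  rw [box_eq_sum_of_hasPartials (hu.add hv)
    (hd.mono fun y hy => (hasPartials_pderiv hy.1).add (hasPartials_pderiv hy.2))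
    fun i => (hasPartials_pderiv (differentiableAt_pderiv hu i)).add
      (hasPartials_pderiv (differentiableAt_pderiv hv i)),
    box_eq_sum_pderiv_pderiv hu, box_eq_sum_pderiv_pderiv hv]
  simp only [mul_add, Finset.sum_add_distrib]

lemma box_const_mul (c : ℝ) (hu : ContDiffAt ℝ 2 u q) :
    box (fun y => c * u y) q = c * box u q := by
  rw [box_eq_sum_of_hasPartials (contDiffAt_const.mul hu)
    ((eventually_differentiableAt hu).mono fun y hy => (hasPartials_pderiv hy).const_mul c)
    fun i => (hasPartials_pderiv (differentiableAt_pderiv hu i)).const_mul c,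
    box_eq_sum_pderiv_pderiv hu, Finset.mul_sum]
  exact Finset.sum_congr rfl fun i _ => by ring

lemma box_sub (hu : ContDiffAt ℝ 2 u q) (hv : ContDiffAt ℝ 2 v q) :
    box (fun y => u y - v y) q = box u q - box v q := by
  have h := box_add hu ((contDiffAt_const (c := (-1 : ℝ))).mul hv)
  rw [box_const_mul (-1) hv] at h
  simpa [← sub_eq_add_neg] using h

/-- The function `g(∇u, ∇v)`. -/
def gradInner (u v : Spacetime m n → ℝ) (q : Spacetime m n) : ℝ :=
  ∑ i, gSign i * (pderiv i u q * pderiv i v q)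

/-- The derivative `Y u` of `u` along the vector field with the components `Y`. -/
def fieldDeriv (Y : Fin m ⊕ Fin n → Spacetime m n → ℝ) (u : Spacetime m n → ℝ)
    (q : Spacetime m n) : ℝ := ∑ i, Y i q * pderiv i u q

/-- The divergence of the vector field with the components `Y`. -/
def fieldDiv (Y : Fin m ⊕ Fin n → Spacetime m n → ℝ) (q : Spacetime m n) : ℝ :=
  ∑ i, pderiv i (Y i) q

/-- The deformation `g(∇_{∇u} Y, ∇u)` of the metric along the vector field with the
components `Y`, evaluated on the gradient of `u`. -/
def deformation (Y : Fin m ⊕ Fin n → Spacetime m n → ℝ) (u : Spacetime m n → ℝ)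
    (q : Spacetime m n) : ℝ :=
  ∑ i, ∑ j, gSign i * pderiv i u q * pderiv i (Y j) q * pderiv j u q

lemma box_mul (hu : ContDiffAt ℝ 2 u q) (hv : ContDiffAt ℝ 2 v q) :
    box (fun y => u y * v y) q = box u q * v q
      + 2 * gradInner u v q + u q * box v q := by
  have hd := (eventually_differentiableAt hu).and (eventually_differentiableAt hv)
  have hu' := (hasPartials_pderiv (hu.differentiableAt (by norm_num)))
  have hv' := (hasPartials_pderiv (hv.differentiableAt (by norm_num)))
  rw [box_eq_sum_of_hasPartials (hu.mul hv)
    (hd.mono fun y hy => (hasPartials_pderiv hy.1).mul (hasPartials_pderiv hy.2))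
    fun i => ((hasPartials_pderiv (differentiableAt_pderiv hu i)).mul hv').add
      (hu'.mul (hasPartials_pderiv (differentiableAt_pderiv hv i))),
    box_eq_sum_pderiv_pderiv hu, box_eq_sum_pderiv_pderiv hv]
  simp only [gradInner, Finset.sum_mul, Finset.mul_sum, ← Finset.sum_add_distrib]
  exact Finset.sum_congr rfl fun i _ => by ring

end PartialDerivatives

/-! ### Divergence of multiplier currents -/

section Current

variable {m n : ℕ} {q : Spacetime m n}

/-- The current of the multiplier `Y w + γ w / 2` with the zeroth order potential `A`, at a point
where `w` and `γ` have the partial derivatives `ζ` and `γ'`. -/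
def current (Y : Fin m ⊕ Fin n → ℝ) (γ : ℝ) (γ' : Fin m ⊕ Fin n → ℝ) (A : ℝ)
    (w : ℝ) (ζ : Fin m ⊕ Fin n → ℝ) (i : Fin m ⊕ Fin n) : ℝ :=
  gSign i * ((∑ j, Y j * ζ j) * ζ i) - 1 / 2 * ((∑ j, gSign j * (ζ j * ζ j)) * Y i)
    + gSign i * (1 / 2 * (γ * (w * ζ i)) - 1 / 4 * (w * w * γ' i)) + 1 / 2 * (A * (w * w) * Y i)

/-- The current of the multiplier `Y w + γ w / 2`, as a vector field. -/
def currentField (Y : Fin m ⊕ Fin n → Spacetime m n → ℝ) (γ A w : Spacetime m n → ℝ)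
    (i : Fin m ⊕ Fin n) (q : Spacetime m n) : ℝ :=
  current (fun j => Y j q) (γ q) (fun j => pderiv j γ q) (A q) (w q) (fun j => pderiv j w q) i

variable {Y : Fin m ⊕ Fin n → Spacetime m n → ℝ} {γ A w : Spacetime m n → ℝ}

lemma pderiv_currentField (hY : ∀ j, DifferentiableAt ℝ (Y j) q) (hγ : ContDiffAt ℝ 2 γ q)
    (hA : DifferentiableAt ℝ A q) (hw : ContDiffAt ℝ 2 w q) (i : Fin m ⊕ Fin n) :
    pderiv i (currentField Y γ A w i) q =
      fieldDeriv Y w q * (gSign i * pderiv i (pderiv i w) q)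
      + (∑ j, gSign i * pderiv i w q * pderiv i (Y j) q * pderiv j w q)
      + ((∑ j, gSign i * pderiv i w q * pderiv i (pderiv j w) q * Y j q)
        - ∑ j, gSign j * pderiv j w q * pderiv i (pderiv j w) q * Y i q)
      - 1 / 2 * gradInner w w q * pderiv i (Y i) q
      + 1 / 2 * γ q * (w q * (gSign i * pderiv i (pderiv i w) q)
        + gSign i * (pderiv i w q * pderiv i w q))
      - 1 / 4 * w q ^ 2 * (gSign i * pderiv i (pderiv i γ) q)
      + 1 / 2 * w q ^ 2 * (Y i q * pderiv i A q + A q * pderiv i (Y i) q)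
      + A q * w q * (Y i q * pderiv i w q) := by
  have hY' j := hasPartials_pderiv (hY j)
  have hw' := hasPartials_pderiv (hw.differentiableAt (by norm_num))
  have hw'' j := hasPartials_pderiv (differentiableAt_pderiv hw j)
  have h := (((((HasPartials.sum (s := Finset.univ) fun j _ => (hY' j).mul (hw'' j)).mul
    (hw'' i)).const_mul (gSign i)).sub (((HasPartials.sum (s := Finset.univ) fun j _ =>
      ((hw'' j).mul (hw'' j)).const_mul (gSign j)).mul (hY' i)).const_mul (1 / 2))).add
    (((((hasPartials_pderiv (hγ.differentiableAt (by norm_num))).mul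
      (hw'.mul (hw'' i))).const_mul (1 / 2)).sub
        (((hw'.mul hw').mul (hasPartials_pderiv (differentiableAt_pderiv hγ i))).const_mul
          (1 / 4))).const_mul (gSign i))).add
    ((((hasPartials_pderiv hA).mul (hw'.mul hw')).mul (hY' i)).const_mul (1 / 2))
  have hY_sum : (∑ j, (pderiv i (Y j) q * pderiv j w q + Y j q * pderiv i (pderiv j w) q)) *
      (gSign i * pderiv i w q) =
      (∑ j, gSign i * pderiv i w q * pderiv i (Y j) q * pderiv j w q)
        + ∑ j, gSign i * pderiv i w q * pderiv i (pderiv j w) q * Y j q := by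
    rw [← Finset.sum_add_distrib, Finset.sum_mul]
    exact Finset.sum_congr rfl fun j _ => by ring
  have hgrad_sum : (∑ j, gSign j * (pderiv i (pderiv j w) q * pderiv j w q
      + pderiv j w q * pderiv i (pderiv j w) q)) * (1 / 2 * Y i q) =
      ∑ j, gSign j * pderiv j w q * pderiv i (pderiv j w) q * Y i q := by
    rw [Finset.sum_mul]
    exact Finset.sum_congr rfl fun j _ => by ring
  refine (h.2 i).trans ?_
  rw [fieldDeriv, gradInner]
  linear_combination hY_sum - hgrad_sum

theorem fieldDiv_currentField (hY : ∀ j, DifferentiableAt ℝ (Y j) q) (hγ : ContDiffAt ℝ 2 γ q)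
    (hA : DifferentiableAt ℝ A q) (hw : ContDiffAt ℝ 2 w q) :
    fieldDiv (currentField Y γ A w) q =
      (fieldDeriv Y w q + 1 / 2 * γ q * w q) * box w q + deformation Y w q
      + 1 / 2 * (γ q - fieldDiv Y q) * gradInner w w q
      - 1 / 4 * w q ^ 2 * box γ q
      + 1 / 2 * w q ^ 2 * (fieldDeriv Y A q + A q * fieldDiv Y q)
      + A q * w q * fieldDeriv Y w q := by
  have hswap : (∑ i, ∑ j, gSign i * pderiv i w q * pderiv i (pderiv j w) q * Y j q) =
      ∑ i, ∑ j, gSign j * pderiv j w q * pderiv i (pderiv j w) q * Y i q := by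
    rw [Finset.sum_comm]
    refine Finset.sum_congr rfl fun i _ => Finset.sum_congr rfl fun j _ => ?_
    rw [pderiv_comm hw]
  rw [fieldDiv, Finset.sum_congr rfl fun i _ => pderiv_currentField hY hγ hA hw i]
  simp only [Finset.sum_add_distrib, Finset.sum_sub_distrib, ← Finset.mul_sum, hswap]
  rw [box_eq_sum_pderiv_pderiv hw, box_eq_sum_pderiv_pderiv hγ]
  simp only [fieldDeriv, fieldDiv, deformation, gradInner]
  ring

end Current

/-! ### The functions `f_p` and `r_p` -/

section Distances

variable {m n : ℕ} {p q : Spacetime m n}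

lemma fFun_eq_sum (p q : Spacetime m n) :
    fFun p q = 1 / 4 * ∑ j, gSign j * coord (q - p) j ^ 2 := by
  rw [fFun, EuclideanSpace.real_norm_sq_eq, EuclideanSpace.real_norm_sq_eq, Fintype.sum_sum_type]
  simp only [coord_inl, coord_inr, gSign_inl, gSign_inr, neg_mul, one_mul,
    Finset.sum_neg_distrib, Prod.fst_sub, Prod.snd_sub]
  ring

lemma rFun_sq (p q : Spacetime m n) :
    rFun p q ^ 2 = ∑ j : Fin n, coord (q - p) (Sum.inr j) ^ 2 :=
  EuclideanSpace.real_norm_sq_eq _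

lemma four_fFun (p q : Spacetime m n) : 4 * fFun p q = rFun p q ^ 2 - ‖q.1 - p.1‖ ^ 2 := by
  rw [fFun, rFun]; ring

lemma four_fFun_le (p q : Spacetime m n) : 4 * fFun p q ≤ rFun p q ^ 2 := by
  rw [four_fFun]; linarith [sq_nonneg ‖q.1 - p.1‖]

lemma rFun_pos (h : 0 < fFun p q) : 0 < rFun p q := by
  refine lt_of_le_of_ne (norm_nonneg _) fun h0 => ?_
  have h4 := four_fFun_le p q
  rw [← h0] at h4
  linarith

lemma sum_time_coord_sq (p q : Spacetime m n) :
    ∑ i : Fin m, coord (q - p) (Sum.inl i) ^ 2 = rFun p q ^ 2 - 4 * fFun p q := by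
  rw [four_fFun, EuclideanSpace.real_norm_sq_eq]
  simp

lemma contDiff_fFun (p : Spacetime m n) {k : WithTop ℕ∞} : ContDiff ℝ k (fFun p) := by
  rw [show fFun p = fun q => 1 / 4 * ∑ j, gSign j * coord (q - p) j ^ 2 from
    funext (fFun_eq_sum p)]
  exact contDiff_const.mul
    (ContDiff.sum fun j _ => contDiff_const.mul ((contDiff_coord_sub p j).pow 2))

lemma continuous_fFun (p : Spacetime m n) : Continuous (fFun p) :=
  (contDiff_fFun (k := 0) p).continuous

lemma continuous_rFun (p : Spacetime m n) : Continuous (rFun p) := by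
  unfold rFun; fun_prop

lemma contDiffAt_rFun (h : 0 < rFun p q) {k : WithTop ℕ∞} : ContDiffAt ℝ k (rFun p) q :=
  (contDiffAt_snd.sub contDiffAt_const).norm ℝ (norm_pos_iff.1 h)

lemma contDiffAt_rInv (h : 0 < rFun p q) {k : WithTop ℕ∞} :
    ContDiffAt ℝ k (fun y => (rFun p y)⁻¹) q := (contDiffAt_rFun h).inv h.ne'

lemma hasPartials_fFun (p q : Spacetime m n) :
    HasPartials (fFun p) (fun i => gSign i * coord (q - p) i / 2) q := by
  rw [show fFun p = fun q => 1 / 4 * ∑ j, gSign j * coord (q - p) j ^ 2 from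
    funext (fFun_eq_sum p)]
  refine ((HasPartials.sum (s := Finset.univ) fun j _ =>
    ((hasPartials_coord_sub p q j).pow 2).const_mul (gSign j)).const_mul (1 / 4)).congr
      fun i => ?_
  rw [Finset.sum_eq_single i (fun j _ hj => by simp [hj.symm]) (by simp)]
  norm_num
  ring

lemma hasPartials_rFun (h : 0 < rFun p q) :
    HasPartials (rFun p) (fun i => spaceInd i * (coord (q - p) i * (rFun p q)⁻¹)) q := by
  have hr := hasPartials_pderiv ((contDiffAt_rFun (k := 1) h).differentiableAt (by norm_num))
  refine hr.congr fun i => ?_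
  have hsq := (hr.pow 2).2 i
  rw [show (fun y => rFun p y ^ 2) = fun y => ∑ j : Fin n, coord (y - p) (Sum.inr j) ^ 2 from
    funext (rFun_sq p), (HasPartials.sum (s := Finset.univ) fun j _ =>
      (hasPartials_coord_sub p q (Sum.inr j)).pow 2).2 i] at hsq
  have hmul : spaceInd i * coord (q - p) i = rFun p q * pderiv i (rFun p) q := by
    rcases i with i | i
    · simpa using hsq
    · simp only [Nat.cast_ofNat, Sum.inr.injEq, mul_ite, mul_one, mul_zero, Finset.sum_ite_eq,
        Finset.mem_univ, if_true, Nat.add_one_sub_one, pow_one] at hsq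
      simp only [spaceInd_inr, one_mul]
      linarith
  field_simp
  linarith

lemma hasPartials_rInv (h : 0 < rFun p q) : HasPartials (fun y => (rFun p y)⁻¹)
    (fun i => -(spaceInd i * (coord (q - p) i * (rFun p q)⁻¹ ^ 3))) q :=
  ((hasPartials_rFun h).inv h.ne').congr fun i => by field_simp

lemma sum_quadratic (g : Fin m ⊕ Fin n → ℝ) (c₁ c₂ d₁ d₂ : ℝ)
    (htime : ∀ i : Fin m, g (Sum.inl i) = c₁ * coord (q - p) (Sum.inl i) ^ 2 + d₁)
    (hspace : ∀ i : Fin n, g (Sum.inr i) = c₂ * coord (q - p) (Sum.inr i) ^ 2 + d₂) :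
    ∑ i, g i = c₁ * (rFun p q ^ 2 - 4 * fFun p q) + c₂ * rFun p q ^ 2 + m * d₁ + n * d₂ := by
  simp only [Fintype.sum_sum_type, htime, hspace, Finset.sum_add_distrib, ← Finset.mul_sum,
    sum_time_coord_sq, ← rFun_sq, Finset.sum_const, Finset.card_univ, Fintype.card_fin,
    nsmul_eq_mul]
  ring

lemma eventually_rFun_pos (h : 0 < rFun p q) : ∀ᶠ y in 𝓝 q, 0 < rFun p y :=
  (continuous_rFun p).continuousAt.eventually (lt_mem_nhds h)

lemma box_fFun (p q : Spacetime m n) : box (fFun p) q = ((m : ℝ) + n) / 2 := by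
  rw [box_eq_sum_of_hasPartials (contDiff_fFun p).contDiffAt
    (Eventually.of_forall fun y => (hasPartials_fFun p y).congr fun i => mul_div_right_comm _ _ _)
    fun i => (hasPartials_coord_sub p q i).const_mul (gSign i / 2),
    sum_quadratic (p := p) (q := q) _ 0 0 (1 / 2) (1 / 2)]
  · ring
  · intro i; norm_num
  · intro i; simp

lemma box_rFun (h : 0 < rFun p q) : box (rFun p) q = ((n : ℝ) - 1) / rFun p q := by
  rw [box_eq_sum_of_hasPartials (contDiffAt_rFun h)
    ((eventually_rFun_pos h).mono fun y => hasPartials_rFun)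
    fun i => ((hasPartials_coord_sub p q i).mul (hasPartials_rInv h)).const_mul (spaceInd i),
    sum_quadratic (p := p) (q := q) _ 0 (-(rFun p q)⁻¹ ^ 3) 0 (rFun p q)⁻¹]
  · field_simp
    ring
  · intro i; simp
  · intro i
    simp only [gSign_inr, spaceInd_inr, if_true]
    ring

lemma box_rInv (h : 0 < rFun p q) :
    box (fun y => (rFun p y)⁻¹) q = -(((n : ℝ) - 3) / rFun p q ^ 3) := by
  rw [box_eq_sum_of_hasPartials (contDiffAt_rInv h)
    ((eventually_rFun_pos h).mono fun y hy =>
      (hasPartials_rInv hy).congr fun i => neg_mul_eq_neg_mul _ _)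
    fun i => ((hasPartials_coord_sub p q i).mul ((hasPartials_rInv h).pow 3)).const_mul
      (-spaceInd i),
    sum_quadratic (p := p) (q := q) _ 0 (3 * (rFun p q)⁻¹ ^ 5) 0 (-(rFun p q)⁻¹ ^ 3)]
  · field_simp
    ring
  · intro i; simp
  · intro i
    simp only [gSign_inr, spaceInd_inr, if_true]
    ring

lemma gradInner_fFun_rInv (h : 0 < rFun p q) :
    gradInner (fFun p) (fun y => (rFun p y)⁻¹) q = -(1 / 2 * (rFun p q)⁻¹) := by
  rw [gradInner, sum_quadratic (p := p) (q := q) _ 0 (-(1 / 2 * (rFun p q)⁻¹ ^ 3)) 0 0]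
  · field_simp
    ring
  all_goals
    intro i
    rw [(hasPartials_fFun p q).2, (hasPartials_rInv h).2]
    simp only [gSign_inl, gSign_inr, spaceInd_inl, spaceInd_inr]
    ring

end Distances

/-! ### The multiplier field -/

section Multiplier

variable {m n : ℕ}

/-- The function `1 - ε r_p`. -/
def damping (p : Spacetime m n) (ε : ℝ) (q : Spacetime m n) : ℝ := 1 - ε * rFun p q

/-- The function `ε f_p / r_p`. -/
def radialCoeff (p : Spacetime m n) (ε : ℝ) (q : Spacetime m n) : ℝ :=
  ε * (fFun p q * (rFun p q)⁻¹)

/-- The components of the multiplier field `(1 - ε r_p) ∇f_p + ε f_p ∇r_p`. -/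
def multiplier (p : Spacetime m n) (ε : ℝ) (i : Fin m ⊕ Fin n) (q : Spacetime m n) : ℝ :=
  (1 / 2 * damping p ε q + spaceInd i * radialCoeff p ε q) * coord (q - p) i

/-- The coefficient of the zeroth order part of the multiplier: the divergence of `multiplier`
minus `damping + radialCoeff`. -/
def zerothCoeff (p : Spacetime m n) (ε : ℝ) (q : Spacetime m n) : ℝ :=
  ((m : ℝ) + n - 2) / 2 * damping p ε q + ((n : ℝ) - 2) * radialCoeff p ε q

/-- The potential of the conjugated operator for the weight `(f_p / (1 - ε r_p)) ^ a`. -/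
def potential (p : Spacetime m n) (ε a : ℝ) (q : Spacetime m n) : ℝ :=
  a ^ 2 * (fFun p q * damping p ε q)⁻¹ + (a ^ 2 - a) * ε ^ 2 * (damping p ε q ^ 2)⁻¹
    - a * ε * (rFun p q * damping p ε q)⁻¹

variable {p q : Spacetime m n} {ε : ℝ}

lemma continuous_damping (p : Spacetime m n) (ε : ℝ) : Continuous (damping p ε) :=
  continuous_const.sub (continuous_const.mul (continuous_rFun p))

section Regularity

variable {k : WithTop ℕ∞}

lemma contDiffAt_damping (h : 0 < rFun p q) : ContDiffAt ℝ k (damping p ε) q :=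
  contDiffAt_const.sub (contDiffAt_const.mul (contDiffAt_rFun h))

lemma contDiffAt_radialCoeff (h : 0 < rFun p q) : ContDiffAt ℝ k (radialCoeff p ε) q :=
  contDiffAt_const.mul ((contDiff_fFun p).contDiffAt.mul (contDiffAt_rInv h))

lemma contDiffAt_multiplier (h : 0 < rFun p q) (i : Fin m ⊕ Fin n) :
    ContDiffAt ℝ k (multiplier p ε i) q :=
  ((contDiffAt_const.mul (contDiffAt_damping h)).add
    (contDiffAt_const.mul (contDiffAt_radialCoeff h))).mul (contDiff_coord_sub p i).contDiffAt

lemma contDiffAt_zerothCoeff (h : 0 < rFun p q) : ContDiffAt ℝ k (zerothCoeff p ε) q :=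
  (contDiffAt_const.mul (contDiffAt_damping h)).add
    (contDiffAt_const.mul (contDiffAt_radialCoeff h))

lemma contDiffAt_potential (hf : 0 < fFun p q) (he : 0 < damping p ε q) (a : ℝ) :
    ContDiffAt ℝ k (potential p ε a) q := by
  have hr := rFun_pos hf
  have hE : ContDiffAt ℝ k (damping p ε) q := contDiffAt_damping hr
  have hfE := ((contDiff_fFun p).contDiffAt.mul hE).inv (mul_pos hf he).ne'
  have hE_sq := (hE.pow 2).inv (pow_pos he 2).ne'
  have hrE := ((contDiffAt_rFun hr).mul hE).inv (mul_pos hr he).ne'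
  exact ((contDiffAt_const.mul hfE).add (contDiffAt_const.mul hE_sq)).sub (contDiffAt_const.mul hrE)

end Regularity

lemma hasPartials_damping (h : 0 < rFun p q) : HasPartials (damping p ε)
    (fun i => -(ε * (spaceInd i * (coord (q - p) i * (rFun p q)⁻¹)))) q :=
  ((HasPartials.const 1 q).sub ((hasPartials_rFun h).const_mul ε)).congr fun _ => zero_sub _

lemma hasPartials_radialCoeff (h : 0 < rFun p q) : HasPartials (radialCoeff p ε)
    (fun i => ε * (gSign i * coord (q - p) i / 2 * (rFun p q)⁻¹
      + fFun p q * -(spaceInd i * (coord (q - p) i * (rFun p q)⁻¹ ^ 3)))) q :=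
  ((hasPartials_fFun p q).mul (hasPartials_rInv h)).const_mul ε

lemma hasPartials_multiplier (h : 0 < rFun p q) (j : Fin m ⊕ Fin n) :
    HasPartials (multiplier p ε j) (fun i =>
      (1 / 2 * pderiv i (damping p ε) q + spaceInd j * pderiv i (radialCoeff p ε) q)
        * coord (q - p) j
      + (1 / 2 * damping p ε q + spaceInd j * radialCoeff p ε q) * if i = j then 1 else 0) q :=
  (((hasPartials_pderiv (hasPartials_damping h).1).const_mul (1 / 2)).add
    ((hasPartials_pderiv (hasPartials_radialCoeff h).1).const_mul (spaceInd j))).mul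
      (hasPartials_coord_sub p q j)

lemma hasPartials_potential (hf : 0 < fFun p q) (he : 0 < damping p ε q) (a : ℝ) :
    HasPartials (potential p ε a) (fun i =>
      (-(a ^ 2 / (2 * fFun p q ^ 2 * damping p ε q)) * gSign i
        + (a ^ 2 * ε / (fFun p q * damping p ε q ^ 2 * rFun p q)
          + 2 * (a ^ 2 - a) * ε ^ 3 / (damping p ε q ^ 3 * rFun p q)
          + a * ε * (damping p ε q - ε * rFun p q) / (rFun p q ^ 3 * damping p ε q ^ 2))
        * spaceInd i) * coord (q - p) i) q := by
  have hr := rFun_pos hf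
  have hE := hasPartials_damping (ε := ε) hr
  have hfE := (((hasPartials_fFun p q).mul hE).inv (mul_pos hf he).ne').const_mul (a ^ 2)
  have hE_sq := ((hE.pow 2).inv (pow_pos he 2).ne').const_mul ((a ^ 2 - a) * ε ^ 2)
  have hrE := (((hasPartials_rFun hr).mul hE).inv (mul_pos hr he).ne').const_mul (a * ε)
  refine ((hfE.add hE_sq).sub hrE).congr fun i => ?_
  norm_num
  field_simp
  ring

lemma fieldDiv_multiplier (h : 0 < rFun p q) : fieldDiv (multiplier p ε) q =
    ((m : ℝ) + n) / 2 * damping p ε q + ((n : ℝ) - 1) * radialCoeff p ε q := by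
  rw [fieldDiv, Finset.sum_congr rfl fun i _ => (hasPartials_multiplier h i).2 i]
  simp only [(hasPartials_damping h).2, (hasPartials_radialCoeff h).2]
  rw [sum_quadratic (p := p) (q := q) _ 0
    (-(1 / 2 * (ε * (rFun p q)⁻¹))
      + ε * (1 / 2 * (rFun p q)⁻¹ - fFun p q * (rFun p q)⁻¹ ^ 3))
    (1 / 2 * damping p ε q) (1 / 2 * damping p ε q + radialCoeff p ε q)]
  · rw [radialCoeff]
    field_simp
    ring
  · intro i; simp
  · intro i
    simp only [gSign_inr, spaceInd_inr, if_true]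
    ring

lemma box_const (c : ℝ) (q : Spacetime m n) : box (fun _ => c) q = 0 := by simp [box]

lemma box_damping (h : 0 < rFun p q) :
    box (damping p ε) q = -(ε * (((n : ℝ) - 1) / rFun p q)) := by
  have hr : ContDiffAt ℝ 2 (rFun p) q := contDiffAt_rFun h
  rw [show damping p ε = fun y => 1 - ε * rFun p y from rfl,
    box_sub contDiffAt_const (contDiffAt_const.mul hr), box_const, box_const_mul ε hr, box_rFun h]
  ring

lemma box_radialCoeff (h : 0 < rFun p q) : box (radialCoeff p ε) q =
    ε * (((m : ℝ) + n - 2) / (2 * rFun p q) - ((n : ℝ) - 3) * fFun p q / rFun p q ^ 3) := by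
  have hf : ContDiffAt ℝ 2 (fFun p) q := (contDiff_fFun p).contDiffAt
  have hr : ContDiffAt ℝ 2 (fun y => (rFun p y)⁻¹) q := contDiffAt_rInv h
  rw [show radialCoeff p ε = fun y => ε * (fFun p y * (rFun p y)⁻¹) from rfl,
    box_const_mul ε (hf.mul hr), box_mul hf hr, box_fFun, box_rInv h, gradInner_fFun_rInv h]
  field_simp
  ring

lemma box_zerothCoeff (h : 0 < rFun p q) : box (zerothCoeff p ε) q =
    (-(((m : ℝ) + n - 2) / 2 * (n - 1)) + ((n : ℝ) - 2) * ((m + n - 2) / 2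
      - (n - 3) * (fFun p q / rFun p q ^ 2))) * (ε / rFun p q) := by
  have he : ContDiffAt ℝ 2 (damping p ε) q := contDiffAt_damping h
  have hk : ContDiffAt ℝ 2 (radialCoeff p ε) q := contDiffAt_radialCoeff h
  rw [show zerothCoeff p ε = fun y => ((m : ℝ) + n - 2) / 2 * damping p ε y
      + ((n : ℝ) - 2) * radialCoeff p ε y from rfl,
    box_add (contDiffAt_const.mul he) (contDiffAt_const.mul hk), box_const_mul _ he,
    box_const_mul _ hk, box_damping h, box_radialCoeff h]
  field_simp

lemma sum_multiplier_mul (h : 0 < rFun p q) (α β : ℝ) :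
    ∑ i, multiplier p ε i q * ((α * gSign i + β * spaceInd i) * coord (q - p) i) =
      α * (2 * fFun p q * (1 - ε * rFun p q / 2))
        + β * (rFun p q * (damping p ε q * rFun p q / 2 + ε * fFun p q)) := by
  rw [sum_quadratic (p := p) (q := q) _ (-(α * (1 / 2 * damping p ε q)))
    ((1 / 2 * damping p ε q + radialCoeff p ε q) * (α + β)) 0 0]
  · rw [radialCoeff, damping]
    field_simp
    ring
  all_goals
    intro i
    simp only [multiplier, gSign_inl, gSign_inr, spaceInd_inl, spaceInd_inr]
    ring

lemma sum_gSign_mul_multiplier_sq (h : 0 < rFun p q) :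
    ∑ i, gSign i * multiplier p ε i q ^ 2 =
      fFun p q * (damping p ε q + ε ^ 2 * fFun p q) := by
  rw [sum_quadratic (p := p) (q := q) _ (-(1 / 2 * damping p ε q) ^ 2)
    ((1 / 2 * damping p ε q + radialCoeff p ε q) ^ 2) 0 0]
  · rw [radialCoeff, damping]
    field_simp
    ring
  all_goals
    intro i
    simp only [multiplier, gSign_inl, gSign_inr, spaceInd_inl, spaceInd_inr]
    ring

section Gradient

/-- The sum of the squares of the time derivatives. -/
def timeGradSq (w : Spacetime m n → ℝ) (q : Spacetime m n) : ℝ :=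
  ∑ i, pderiv (Sum.inl i) w q ^ 2

/-- The sum of the squares of the space derivatives. -/
def spaceGradSq (w : Spacetime m n → ℝ) (q : Spacetime m n) : ℝ :=
  ∑ j, pderiv (Sum.inr j) w q ^ 2

/-- The derivative along the time part of the dilation field about `p`. -/
def timeDilation (p : Spacetime m n) (w : Spacetime m n → ℝ) (q : Spacetime m n) : ℝ :=
  ∑ i, coord (q - p) (Sum.inl i) * pderiv (Sum.inl i) w q

/-- The derivative along the space part of the dilation field about `p`. -/
def spaceDilation (p : Spacetime m n) (w : Spacetime m n → ℝ) (q : Spacetime m n) : ℝ :=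
  ∑ j, coord (q - p) (Sum.inr j) * pderiv (Sum.inr j) w q

variable (w : Spacetime m n → ℝ)

lemma timeGradSq_nonneg (q : Spacetime m n) : 0 ≤ timeGradSq w q :=
  Finset.sum_nonneg fun _ _ => sq_nonneg _

lemma spaceGradSq_nonneg (q : Spacetime m n) : 0 ≤ spaceGradSq w q :=
  Finset.sum_nonneg fun _ _ => sq_nonneg _

lemma sum_pderiv_sq (q : Spacetime m n) :
    ∑ i, pderiv i w q ^ 2 = timeGradSq w q + spaceGradSq w q := Fintype.sum_sum_type _

lemma gradInner_self (q : Spacetime m n) :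
    gradInner w w q = spaceGradSq w q - timeGradSq w q := by
  simp only [gradInner, Fintype.sum_sum_type, gSign_inl, gSign_inr, neg_mul, one_mul,
    Finset.sum_neg_distrib, spaceGradSq, timeGradSq, ← sq]
  ring

lemma timeDilation_sq_le (p q : Spacetime m n) :
    timeDilation p w q ^ 2 ≤ (rFun p q ^ 2 - 4 * fFun p q) * timeGradSq w q := by
  rw [← sum_time_coord_sq]
  exact Finset.sum_mul_sq_le_sq_mul_sq _ _ _

lemma spaceDilation_sq_le (p q : Spacetime m n) :
    spaceDilation p w q ^ 2 ≤ rFun p q ^ 2 * spaceGradSq w q := by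
  rw [rFun_sq]
  exact Finset.sum_mul_sq_le_sq_mul_sq _ _ _

lemma sum_coord_mul_pderiv (p q : Spacetime m n) :
    ∑ i, coord (q - p) i * pderiv i w q = timeDilation p w q + spaceDilation p w q :=
  Fintype.sum_sum_type _

lemma sum_spaceInd_mul_coord_mul_pderiv (p q : Spacetime m n) :
    ∑ i, spaceInd i * coord (q - p) i * pderiv i w q = spaceDilation p w q := by
  simp [Fintype.sum_sum_type, spaceDilation]

lemma fieldDeriv_multiplier (p : Spacetime m n) (ε : ℝ) (q : Spacetime m n) :
    fieldDeriv (multiplier p ε) w q =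
      1 / 2 * damping p ε q * (timeDilation p w q + spaceDilation p w q)
        + radialCoeff p ε q * spaceDilation p w q := by
  rw [← sum_coord_mul_pderiv, ← sum_spaceInd_mul_coord_mul_pderiv, fieldDeriv, Finset.mul_sum,
    Finset.mul_sum, ← Finset.sum_add_distrib]
  exact Finset.sum_congr rfl fun i _ => by rw [multiplier]; ring

variable {w}

lemma sum_pderiv_multiplier_mul (h : 0 < rFun p q) (i : Fin m ⊕ Fin n) :
    ∑ j, pderiv i (multiplier p ε j) q * pderiv j w q =
      1 / 2 * pderiv i (damping p ε) q * (timeDilation p w q + spaceDilation p w q)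
        + pderiv i (radialCoeff p ε) q * spaceDilation p w q
        + (1 / 2 * damping p ε q + spaceInd i * radialCoeff p ε q) * pderiv i w q := by
  have hdiag : ∑ j, (1 / 2 * damping p ε q + spaceInd j * radialCoeff p ε q)
      * (if i = j then 1 else 0) * pderiv j w q =
      (1 / 2 * damping p ε q + spaceInd i * radialCoeff p ε q) * pderiv i w q := by
    rw [Finset.sum_eq_single i (fun j _ hj => by simp [hj.symm]) (by simp)]
    simp
  rw [← hdiag, ← sum_coord_mul_pderiv, ← sum_spaceInd_mul_coord_mul_pderiv, Finset.mul_sum,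
    Finset.mul_sum, ← Finset.sum_add_distrib, ← Finset.sum_add_distrib]
  refine Finset.sum_congr rfl fun j _ => ?_
  rw [(hasPartials_multiplier h j).2]
  ring

lemma deformation_multiplier (h : 0 < rFun p q) : deformation (multiplier p ε) w q =
    1 / 2 * damping p ε q * gradInner w w q
      + radialCoeff p ε q * (spaceGradSq w q - spaceDilation p w q ^ 2 / rFun p q ^ 2) := by
  have hspace : ∑ i, spaceInd i * pderiv i w q ^ 2 = spaceGradSq w q := by
    simp [Fintype.sum_sum_type, spaceGradSq]
  set R := spaceDilation p w q with hR
  set D := timeDilation p w q + R with hD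
  have hterm (i : Fin m ⊕ Fin n) :
      ∑ j, gSign i * pderiv i w q * pderiv i (multiplier p ε j) q * pderiv j w q =
        (-(1 / 2 * ε * (rFun p q)⁻¹ * D) - ε * fFun p q * (rFun p q)⁻¹ ^ 3 * R)
          * (spaceInd i * coord (q - p) i * pderiv i w q)
        + 1 / 2 * ε * (rFun p q)⁻¹ * R * (coord (q - p) i * pderiv i w q)
        + 1 / 2 * damping p ε q * (gSign i * (pderiv i w q * pderiv i w q))
        + radialCoeff p ε q * (spaceInd i * pderiv i w q ^ 2) := by
    simp only [mul_assoc, ← Finset.mul_sum]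
    rw [sum_pderiv_multiplier_mul h, (hasPartials_damping h).2, (hasPartials_radialCoeff h).2]
    rcases i with i | i <;> simp only [gSign_inl, gSign_inr, spaceInd_inl, spaceInd_inr] <;> ring
  rw [deformation, Finset.sum_congr rfl fun i _ => hterm i]
  simp only [Finset.sum_add_distrib, ← Finset.mul_sum]
  rw [sum_spaceInd_mul_coord_mul_pderiv, sum_coord_mul_pderiv, hspace, ← gradInner, ← hR, ← hD,
    radialCoeff]
  field_simp
  ring

end Gradient

section Bounds

lemma damping_le_one (hε : 0 ≤ ε) (p q : Spacetime m n) : damping p ε q ≤ 1 :=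
  sub_le_self _ (mul_nonneg hε (norm_nonneg _))

lemma half_le_damping (h : ε * rFun p q ≤ 1 / 2) : 1 / 2 ≤ damping p ε q := by
  rw [damping]; linarith

lemma radialCoeff_nonneg (hε : 0 ≤ ε) (hf : 0 ≤ fFun p q) : 0 ≤ radialCoeff p ε q :=
  mul_nonneg hε (mul_nonneg hf (inv_nonneg.2 (norm_nonneg _)))

lemma radialCoeff_le (hf : 0 < fFun p q) (hε : 0 ≤ ε) (h : ε * rFun p q ≤ 1 / 2) :
    radialCoeff p ε q ≤ 1 / 8 := by
  have hr := rFun_pos hf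
  rw [radialCoeff, ← div_eq_mul_inv, ← mul_div_assoc, div_le_iff₀ hr]
  nlinarith [mul_le_mul_of_nonneg_left (four_fFun_le p q) hε,
    mul_le_mul_of_nonneg_right h hr.le]

lemma sum_multiplier_sq_le (hf : 0 < fFun p q) (hε : 0 ≤ ε) (h : ε * rFun p q ≤ 1 / 2) :
    ∑ i, multiplier p ε i q ^ 2 ≤ rFun p q ^ 2 := by
  have he0 := half_le_damping h
  have he1 := damping_le_one hε p q
  have hk0 := radialCoeff_nonneg hε hf.le
  have hk1 := radialCoeff_le hf hε h
  have ht : (0 : ℝ) ≤ rFun p q ^ 2 - 4 * fFun p q := sub_nonneg.2 (four_fFun_le p q)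
  rw [sum_quadratic (p := p) (q := q) _ ((1 / 2 * damping p ε q) ^ 2)
    ((1 / 2 * damping p ε q + radialCoeff p ε q) ^ 2) 0 0]
  · have htime : (1 / 2 * damping p ε q) ^ 2 * (rFun p q ^ 2 - 4 * fFun p q) ≤
        (1 / 2) ^ 2 * (rFun p q ^ 2 - 4 * fFun p q) := by gcongr; linarith
    have hspace : (1 / 2 * damping p ε q + radialCoeff p ε q) ^ 2 * rFun p q ^ 2 ≤
        (5 / 8) ^ 2 * rFun p q ^ 2 := by gcongr; linarith
    linarith [sq_nonneg (rFun p q)]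
  all_goals
    intro i
    simp only [multiplier, spaceInd_inl, spaceInd_inr]
    ring

/-- A constant that bounds the zeroth order coefficient of the multiplier and, up to the factor
`ε / r_p`, its image under `□`. -/
def dimConst (m n : ℕ) : ℝ := 2 * ((m : ℝ) + n + 2) ^ 2

lemma two_le_dimConst (m n : ℕ) : 2 ≤ dimConst m n := by
  have h : (1 : ℝ) ≤ (m : ℝ) + n + 2 := by linarith [(by positivity : (0 : ℝ) ≤ (m : ℝ) + n)]
  rw [dimConst]
  linarith [one_le_pow₀ h (n := 2)]

lemma abs_zerothCoeff_le (hf : 0 < fFun p q) (hε : 0 ≤ ε) (h : ε * rFun p q ≤ 1 / 2) :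
    |zerothCoeff p ε q| ≤ dimConst m n := by
  have : (0 : ℝ) ≤ m := by positivity
  have : (0 : ℝ) ≤ n := by positivity
  have hD : |((m : ℝ) + n - 2) / 2 * damping p ε q| ≤ ((m : ℝ) + n + 2) * 1 := by
    rw [abs_mul, abs_of_nonneg (by linarith [half_le_damping h] : 0 ≤ damping p ε q)]
    have hcoeff : |((m : ℝ) + n - 2) / 2| ≤ (m : ℝ) + n + 2 := by
      rw [abs_le]; constructor <;> linarith
    gcongr
    · linarith [half_le_damping h]
    · exact damping_le_one hε p q
  have hK : |((n : ℝ) - 2) * radialCoeff p ε q| ≤ ((m : ℝ) + n + 2) * (1 / 8) := by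
    rw [abs_mul, abs_of_nonneg (radialCoeff_nonneg hε hf.le)]
    have hcoeff : |(n : ℝ) - 2| ≤ (m : ℝ) + n + 2 := by rw [abs_le]; constructor <;> linarith
    gcongr
    · exact radialCoeff_nonneg hε hf.le
    · exact radialCoeff_le hf hε h
  have hsum := (abs_add_le _ _).trans (add_le_add hD hK)
  rw [zerothCoeff, dimConst]
  nlinarith

lemma abs_box_zerothCoeff_le (hf : 0 < fFun p q) (hε : 0 ≤ ε) :
    |box (zerothCoeff p ε) q| ≤ dimConst m n * (ε / rFun p q) := by
  have hr := rFun_pos hf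
  have : (0 : ℝ) ≤ m := by positivity
  have : (0 : ℝ) ≤ n := by positivity
  set s : ℝ := (m : ℝ) + n + 2
  have hφ0 : 0 ≤ fFun p q / rFun p q ^ 2 := by positivity
  have hφ : fFun p q / rFun p q ^ 2 ≤ 1 / 4 := by
    rw [div_le_iff₀ (by positivity)]; linarith [four_fFun_le p q]
  have hu : 0 ≤ ε / rFun p q := by positivity
  rw [box_zerothCoeff hr, abs_mul, abs_of_nonneg hu]
  refine mul_le_mul_of_nonneg_right ?_ hu
  have hhalf : |((m : ℝ) + n - 2) / 2| ≤ s / 2 := by rw [abs_le]; constructor <;> linarith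
  have hn_one : |(n : ℝ) - 1| ≤ s := by rw [abs_le]; constructor <;> linarith
  have hn_two : |(n : ℝ) - 2| ≤ s := by rw [abs_le]; constructor <;> linarith
  have hn_three : |(n : ℝ) - 3| ≤ 2 * s := by rw [abs_le]; constructor <;> linarith
  have hradial :
      |(m + n - 2) / 2 - (n - 3) * (fFun p q / rFun p q ^ 2)| ≤ s / 2 + 2 * s * (1 / 4) := by
    refine (abs_sub _ _).trans (add_le_add hhalf ?_)
    rw [abs_mul, abs_of_nonneg hφ0]
    gcongr
  refine (abs_add_le _ _).trans ?_
  rw [abs_neg, abs_mul, abs_mul, dimConst]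
  have hdamping_term := mul_le_mul hhalf hn_one (abs_nonneg _) (by positivity)
  have hradial_term := mul_le_mul hn_two hradial (abs_nonneg _) (by positivity)
  linarith [sq_nonneg s]

end Bounds

end Multiplier

/-! ### Conjugation with the weight -/

section Weight

variable {m n : ℕ}

/-- The weight function `f_p / (1 - ε r_p)`. -/
def weight (p : Spacetime m n) (ε : ℝ) (q : Spacetime m n) : ℝ :=
  fFun p q * (damping p ε q)⁻¹

/-- The factor `φ` with `∇(weight ^ a) = φ • multiplier`. -/
def weightRate (p : Spacetime m n) (ε : ℝ) (a : ℕ) (q : Spacetime m n) : ℝ :=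
  a * (weight p ε q ^ a * (fFun p q * damping p ε q)⁻¹)

/-- The partial derivatives of `weight ^ a`. -/
def weightPowDeriv (p : Spacetime m n) (ε : ℝ) (a : ℕ) (i : Fin m ⊕ Fin n)
    (q : Spacetime m n) : ℝ := gSign i * (weightRate p ε a q * multiplier p ε i q)

variable {p q : Spacetime m n} {ε : ℝ} {a : ℕ}

lemma eventually_pos (hf : 0 < fFun p q) (he : 0 < damping p ε q) :
    ∀ᶠ y in 𝓝 q, 0 < fFun p y ∧ 0 < damping p ε y :=
  ((continuous_fFun p).continuousAt.eventually (lt_mem_nhds hf)).and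
    ((continuous_damping p ε).continuousAt.eventually (lt_mem_nhds he))

section Regularity

variable {k : WithTop ℕ∞}

lemma contDiffAt_weight_pow (hf : 0 < fFun p q) (he : 0 < damping p ε q) (a : ℕ) :
    ContDiffAt ℝ k (fun y => weight p ε y ^ a) q :=
  ((contDiff_fFun p).contDiffAt.mul ((contDiffAt_damping (rFun_pos hf)).inv he.ne')).pow a

lemma contDiffAt_weightPowDeriv (hf : 0 < fFun p q) (he : 0 < damping p ε q) (a : ℕ)
    (i : Fin m ⊕ Fin n) : ContDiffAt ℝ k (weightPowDeriv p ε a i) q := by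
  have hE : ContDiffAt ℝ k (damping p ε) q := contDiffAt_damping (rFun_pos hf)
  exact contDiffAt_const.mul ((contDiffAt_const.mul ((contDiffAt_weight_pow hf he a).mul
    (((contDiff_fFun p).contDiffAt.mul hE).inv (mul_pos hf he).ne'))).mul
      (contDiffAt_multiplier (rFun_pos hf) i))

end Regularity

lemma hasPartials_weight_pow (hf : 0 < fFun p q) (he : 0 < damping p ε q) (ha : a ≠ 0) :
    HasPartials (fun y => weight p ε y ^ a) (fun i => weightPowDeriv p ε a i q) q := by
  have hr := rFun_pos hf
  obtain ⟨b, rfl⟩ := Nat.exists_eq_succ_of_ne_zero ha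
  refine (((hasPartials_fFun p q).mul
    ((hasPartials_damping (ε := ε) hr).inv he.ne')).pow (b + 1)).congr fun i => ?_
  rw [weightPowDeriv, weightRate, weight, multiplier, radialCoeff]
  simp only [add_tsub_cancel_right, pow_succ]
  rcases i with i | i
  · simp
    field_simp
    ring
  · simp
    field_simp

lemma hasPartials_fFun_mul_damping (h : 0 < rFun p q) :
    HasPartials (fun y => fFun p y * damping p ε y) (fun i =>
      (damping p ε q / 2 * gSign i + -(fFun p q * ε / rFun p q) * spaceInd i)
        * coord (q - p) i) q :=
  ((hasPartials_fFun p q).mul (hasPartials_damping h)).congr fun i => by ring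

lemma hasPartials_weightRate (hf : 0 < fFun p q) (he : 0 < damping p ε q) (ha : a ≠ 0) :
    HasPartials (weightRate p ε a) (fun i =>
      a * (fFun p q * damping p ε q)⁻¹ * weightPowDeriv p ε a i q
      - weightRate p ε a q * (fFun p q * damping p ε q)⁻¹
        * pderiv i (fun y => fFun p y * damping p ε y) q) q := by
  have hfe := hasPartials_pderiv (hasPartials_fFun_mul_damping (ε := ε) (rFun_pos hf)).1
  refine (((hasPartials_weight_pow hf he ha).mul
    (hfe.inv (mul_pos hf he).ne')).const_mul (a : ℝ)).congr fun i => ?_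
  rw [weightRate]
  field_simp
  ring

lemma fieldDeriv_multiplier_fFun_mul_damping (hf : 0 < fFun p q) :
    fieldDeriv (multiplier p ε) (fun y => fFun p y * damping p ε y) q =
      fFun p q * (damping p ε q ^ 2 - ε ^ 2 * fFun p q) := by
  have hr := rFun_pos hf
  simp only [fieldDeriv, (hasPartials_fFun_mul_damping hr).2]
  rw [sum_multiplier_mul hr, damping]
  field_simp
  ring

lemma sum_multiplier_mul_weightPowDeriv (hf : 0 < fFun p q) :
    ∑ i, multiplier p ε i q * weightPowDeriv p ε a i q =
      weightRate p ε a q * (fFun p q * (damping p ε q + ε ^ 2 * fFun p q)) := by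
  rw [← sum_gSign_mul_multiplier_sq (rFun_pos hf), Finset.mul_sum]
  exact Finset.sum_congr rfl fun i _ => by rw [weightPowDeriv]; ring

lemma box_weight_pow (hf : 0 < fFun p q) (he : 0 < damping p ε q) (ha : a ≠ 0) :
    box (fun y => weight p ε y ^ a) q =
      weightRate p ε a q * ((a * (damping p ε q + ε ^ 2 * fFun p q)
        - (damping p ε q ^ 2 - ε ^ 2 * fFun p q)) / damping p ε q
        + fieldDiv (multiplier p ε) q) := by
  have hr := rFun_pos hf
  have hrate := hasPartials_weightRate hf he ha
  rw [box_eq_sum_of_hasPartials (contDiffAt_weight_pow hf he a)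
    ((eventually_pos hf he).mono fun y hy => hasPartials_weight_pow hy.1 hy.2 ha)
    fun i => (hrate.mul (hasPartials_pderiv
      (hasPartials_multiplier (ε := ε) hr i).1)).const_mul (gSign i)]
  have hterm (i : Fin m ⊕ Fin n) : gSign i * (gSign i *
      ((a * (fFun p q * damping p ε q)⁻¹ * weightPowDeriv p ε a i q
        - weightRate p ε a q * (fFun p q * damping p ε q)⁻¹
          * pderiv i (fun y => fFun p y * damping p ε y) q) * multiplier p ε i q
        + weightRate p ε a q * pderiv i (multiplier p ε i) q)) =
      a * (fFun p q * damping p ε q)⁻¹ * (multiplier p ε i q * weightPowDeriv p ε a i q)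
      - weightRate p ε a q * (fFun p q * damping p ε q)⁻¹
        * (multiplier p ε i q * pderiv i (fun y => fFun p y * damping p ε y) q)
      + weightRate p ε a q * pderiv i (multiplier p ε i) q := by
    rw [← mul_assoc, gSign_mul_self]
    ring
  rw [Finset.sum_congr rfl fun i _ => hterm i]
  simp only [Finset.sum_add_distrib, Finset.sum_sub_distrib, ← Finset.mul_sum]
  rw [sum_multiplier_mul_weightPowDeriv hf, ← fieldDeriv, ← fieldDiv,
    fieldDeriv_multiplier_fFun_mul_damping hf]
  field_simp

/-- The partial derivatives of `weight ^ a * z` for a function `z` with the partial derivatives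
`z'`. -/
def conjDeriv (p : Spacetime m n) (ε : ℝ) (a : ℕ) (z : ℝ) (z' : Fin m ⊕ Fin n → ℝ)
    (i : Fin m ⊕ Fin n) (q : Spacetime m n) : ℝ :=
  weightPowDeriv p ε a i q * z + weight p ε q ^ a * z' i

section Conjugation

variable {z : Spacetime m n → ℝ}

/-- The conjugated function `(f_p / (1 - ε r_p)) ^ a * z`. -/
def conj (p : Spacetime m n) (ε : ℝ) (a : ℕ) (z : Spacetime m n → ℝ) (q : Spacetime m n) : ℝ :=
  weight p ε q ^ a * z q

lemma contDiffAt_conj {k : WithTop ℕ∞} (hz : ContDiffAt ℝ k z q) (hf : 0 < fFun p q)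
    (he : 0 < damping p ε q) (a : ℕ) : ContDiffAt ℝ k (conj p ε a z) q :=
  (contDiffAt_weight_pow hf he a).mul hz

lemma hasPartials_conj (hz : DifferentiableAt ℝ z q) (hf : 0 < fFun p q)
    (he : 0 < damping p ε q) (ha : a ≠ 0) : HasPartials (conj p ε a z)
      (fun i => conjDeriv p ε a (z q) (fun j => pderiv j z q) i q) q :=
  (hasPartials_weight_pow hf he ha).mul (hasPartials_pderiv hz)

lemma fieldDeriv_multiplier_conj (hz : DifferentiableAt ℝ z q) (hf : 0 < fFun p q)
    (he : 0 < damping p ε q) (ha : a ≠ 0) : fieldDeriv (multiplier p ε) (conj p ε a z) q =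
      weightRate p ε a q * (fFun p q * (damping p ε q + ε ^ 2 * fFun p q)) * z q
        + weight p ε q ^ a * fieldDeriv (multiplier p ε) z q := by
  rw [← sum_multiplier_mul_weightPowDeriv hf, fieldDeriv, fieldDeriv, Finset.sum_mul,
    Finset.mul_sum, ← Finset.sum_add_distrib]
  refine Finset.sum_congr rfl fun i _ => ?_
  simp only [(hasPartials_conj hz hf he ha).2, conjDeriv]
  ring

lemma gradInner_weight_pow (hf : 0 < fFun p q) (he : 0 < damping p ε q) (ha : a ≠ 0) :
    gradInner (fun y => weight p ε y ^ a) z q =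
      weightRate p ε a q * fieldDeriv (multiplier p ε) z q := by
  rw [gradInner, fieldDeriv, Finset.mul_sum]
  refine Finset.sum_congr rfl fun i _ => ?_
  simp only [(hasPartials_weight_pow hf he ha).2, weightPowDeriv]
  linear_combination
    (weightRate p ε a q * multiplier p ε i q * pderiv i z q) * gSign_mul_self i

lemma box_conj (hz : ContDiffAt ℝ 2 z q) (hf : 0 < fFun p q) (he : 0 < damping p ε q)
    (ha : a ≠ 0) : box (conj p ε a z) q =
      weight p ε q ^ a * box z q
      + 2 * a / (fFun p q * damping p ε q) * fieldDeriv (multiplier p ε) (conj p ε a z) q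
      - (potential p ε a q - a * zerothCoeff p ε q / (fFun p q * damping p ε q))
        * conj p ε a z q := by
  have hr := rFun_pos hf
  have hε : ε = (1 - damping p ε q) / rFun p q := by rw [damping]; field_simp; ring
  rw [fieldDeriv_multiplier_conj (hz.differentiableAt (by norm_num)) hf he ha,
    show conj p ε a z = fun y => weight p ε y ^ a * z y from rfl,
    box_mul (contDiffAt_weight_pow hf he a) hz, box_weight_pow hf he ha,
    gradInner_weight_pow hf he ha, fieldDiv_multiplier hr, potential, zerothCoeff, radialCoeff,
    weightRate]
  beta_reduce
  generalize weight p ε q ^ a = W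
  generalize fieldDeriv (multiplier p ε) z q = D
  generalize damping p ε q = e at hε he ⊢
  subst hε
  field_simp
  ring

end Conjugation

end Weight

/-! ### The pointwise Carleman estimate -/

section Coercivity

variable {m n : ℕ} {p q : Spacetime m n} {ε : ℝ}

lemma sub_sq_le_mul_of_sq_le_mul {A B W T X : ℝ} (hA : 0 < A) (hB : 0 ≤ B) (hW : 0 ≤ W)
    (hT : T ^ 2 ≤ B * W) : (X - T) ^ 2 ≤ (A + B) * (X ^ 2 / A + W) := by
  have hcross : -(2 * X * T) ≤ B * X ^ 2 / A + A * W := by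
    refine (neg_le_abs _).trans (abs_le_of_sq_le_sq ?_ (by positivity))
    have hXT := mul_le_mul_of_nonneg_left hT (sq_nonneg X)
    have hprod : B * X ^ 2 / A * (A * W) = X ^ 2 * (B * W) := by field_simp
    linarith [sq_nonneg (B * X ^ 2 / A - A * W)]
  have hexpand : (A + B) * (X ^ 2 / A + W) = X ^ 2 + B * X ^ 2 / A + A * W + B * W := by
    field_simp
    ring
  linarith

lemma spaceDilation_sq_le_of_multiplier (hf : 0 < fFun p q) (hε : 0 ≤ ε)
    (h : ε * rFun p q ≤ 1 / 2) (w : Spacetime m n → ℝ) :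
    spaceDilation p w q ^ 2 ≤ (rFun p q ^ 2 - 2 * fFun p q)
      * (timeGradSq w q + 8 * fieldDeriv (multiplier p ε) w q ^ 2 / fFun p q) := by
  have he := half_le_damping h
  have : 0 < damping p ε q := by linarith
  have hk := radialCoeff_nonneg hε hf.le
  set S := fieldDeriv (multiplier p ε) w q with hS
  set T := timeDilation p w q
  set R := spaceDilation p w q
  set X := 2 * S / damping p ε q with hX
  have hXT : X - T = R * (1 + 2 * radialCoeff p ε q / damping p ε q) := by
    rw [hX, hS, fieldDeriv_multiplier]
    field_simp
    ring
  have hR : R ^ 2 ≤ (X - T) ^ 2 := by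
    rw [hXT, mul_pow]
    exact le_mul_of_one_le_right (sq_nonneg _)
      (one_le_pow₀ (le_add_of_nonneg_right (by positivity)))
  have hXS : X ^ 2 / (2 * fFun p q) ≤ 8 * S ^ 2 / fFun p q := by
    rw [hX, div_pow, div_div, div_le_div_iff₀ (by positivity) hf]
    nlinarith [mul_nonneg (mul_nonneg (sq_nonneg S) hf.le)
      (by nlinarith : 0 ≤ 4 * damping p ε q ^ 2 - 1)]
  have hr : 0 ≤ rFun p q ^ 2 - 4 * fFun p q := sub_nonneg.2 (four_fFun_le p q)
  calc R ^ 2 ≤ (X - T) ^ 2 := hR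
    _ ≤ (2 * fFun p q + (rFun p q ^ 2 - 4 * fFun p q))
        * (X ^ 2 / (2 * fFun p q) + timeGradSq w q) :=
      sub_sq_le_mul_of_sq_le_mul (by positivity) hr (timeGradSq_nonneg w q)
        (timeDilation_sq_le w p q)
    _ = (rFun p q ^ 2 - 2 * fFun p q) * (timeGradSq w q + X ^ 2 / (2 * fFun p q)) := by ring
    _ ≤ _ := mul_le_mul_of_nonneg_left (add_le_add_right hXS _) (by linarith)

lemma gradient_coercivity (hf : 0 < fFun p q) (hε : 0 ≤ ε) (h : ε * rFun p q ≤ 1 / 2)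
    (w : Spacetime m n → ℝ) :
    fFun p q ^ 2 / rFun p q ^ 2 * (timeGradSq w q + spaceGradSq w q) ≤
      fFun p q * (timeGradSq w q + spaceGradSq w q
        - 2 * (spaceDilation p w q ^ 2 / rFun p q ^ 2))
      + 10 * fieldDeriv (multiplier p ε) w q ^ 2 := by
  have hr := rFun_pos hf
  set S2 := fieldDeriv (multiplier p ε) w q ^ 2 with hS2
  set ρ := spaceDilation p w q ^ 2 / rFun p q ^ 2 with hρ
  set φ := fFun p q / rFun p q ^ 2 with hφ
  have hφ0 : 0 < φ := by positivity
  have hφ4 : φ ≤ 1 / 4 := by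
    rw [hφ, div_le_iff₀ (by positivity)]
    linarith [four_fFun_le p q]
  have hspace : ρ ≤ spaceGradSq w q := by
    rw [hρ, div_le_iff₀' (by positivity)]
    exact spaceDilation_sq_le w p q
  have htime : ρ ≤ (1 - 2 * φ) * (timeGradSq w q + 8 * (S2 / fFun p q)) := by
    rw [hρ, hφ, hS2, div_le_iff₀ (by positivity)]
    refine (spaceDilation_sq_le_of_multiplier hf hε h w).trans (le_of_eq ?_)
    field_simp
  have hS : 0 ≤ S2 / fFun p q := div_nonneg (sq_nonneg _) hf.le
  have hscaled : φ * (timeGradSq w q + spaceGradSq w q) ≤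
      timeGradSq w q + spaceGradSq w q - 2 * ρ + 10 * (S2 / fFun p q) := by
    have hT := timeGradSq_nonneg w q
    nlinarith [mul_nonneg hφ0.le hS, mul_nonneg hφ0.le (sub_nonneg.2 hspace),
      mul_nonneg hφ0.le hT, mul_nonneg (sub_nonneg.2 hφ4) hS,
      mul_nonneg (sub_nonneg.2 hφ4) (sub_nonneg.2 hspace)]
  have := mul_le_mul_of_nonneg_left hscaled hf.le
  have hcancel : fFun p q * (S2 / fFun p q) = S2 := mul_div_cancel₀ _ hf.ne'
  have hsplit : fFun p q ^ 2 / rFun p q ^ 2 = fFun p q * φ := by rw [hφ]; ring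
  rw [hsplit]
  linarith

lemma fieldDeriv_multiplier_potential (hf : 0 < fFun p q) (he : 0 < damping p ε q) (a : ℝ) :
    potential p ε a q * (damping p ε q + radialCoeff p ε q)
      + fieldDeriv (multiplier p ε) (potential p ε a) q =
    (a ^ 2 / damping p ε q ^ 2
      + (a ^ 2 - a) * (ε * rFun p q / damping p ε q ^ 3
        * (damping p ε q + radialCoeff p ε q * (1 + ε * rFun p q)))
      - a * ((damping p ε q + 2 * (ε * rFun p q) * radialCoeff p ε q)
        / (2 * damping p ε q ^ 2))) * (ε / rFun p q) := by
  have hr := rFun_pos hf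
  have hε : ε = (1 - damping p ε q) / rFun p q := by rw [damping]; field_simp; ring
  simp only [fieldDeriv, (hasPartials_potential hf he a).2]
  rw [sum_multiplier_mul hr, potential, radialCoeff]
  generalize damping p ε q = e at hε he ⊢
  subst hε
  field_simp
  ring

lemma sq_le_potential_add_fieldDeriv {a : ℝ} (hf : 0 < fFun p q) (hε : 0 ≤ ε)
    (h : ε * rFun p q ≤ 1 / 2) (ha : 1 ≤ a) :
    (a ^ 2 - a / 2) * (ε / rFun p q) ≤
      potential p ε a q * (damping p ε q + radialCoeff p ε q)
        + fieldDeriv (multiplier p ε) (potential p ε a) q := by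
  have hr := rFun_pos hf
  have he : 0 < damping p ε q := by linarith [half_le_damping h]
  have hk := radialCoeff_nonneg hε hf.le
  have hk8 := radialCoeff_le hf hε h
  have ht : 0 ≤ ε * rFun p q := by positivity
  have hae : damping p ε q ^ 2 ≤ 1 := pow_le_one₀ he.le (damping_le_one hε p q)
  rw [fieldDeriv_multiplier_potential hf he]
  refine mul_le_mul_of_nonneg_right ?_ (by positivity)
  have hmid : 0 ≤ (a ^ 2 - a) * (ε * rFun p q / damping p ε q ^ 3
      * (damping p ε q + radialCoeff p ε q * (1 + ε * rFun p q))) :=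
    mul_nonneg (by nlinarith) (by positivity)
  have hnum : damping p ε q + 2 * (ε * rFun p q) * radialCoeff p ε q ≤ 1 := by
    have := mul_le_mul_of_nonneg_left hk8 ht
    rw [damping]
    linarith
  have hlast : a * ((damping p ε q + 2 * (ε * rFun p q) * radialCoeff p ε q)
      / (2 * damping p ε q ^ 2)) ≤ a / 2 / damping p ε q ^ 2 := by
    rw [← mul_div_assoc, div_div]
    gcongr
    exact mul_le_of_le_one_right (by linarith) hnum
  have hmain : a ^ 2 - a / 2 ≤ (a ^ 2 - a / 2) / damping p ε q ^ 2 :=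
    le_div_self (by nlinarith) (by positivity) hae
  rw [sub_div] at hmain
  linarith

lemma zerothOrder_lower_bound {a : ℝ} (hf : 0 < fFun p q) (hε : 0 ≤ ε)
    (h : ε * rFun p q ≤ 1 / 2) (ha : 7 * dimConst m n ≤ a) :
    a ^ 2 * (ε / rFun p q) / 4 ≤
      1 / 2 * (potential p ε a q * (damping p ε q + radialCoeff p ε q)
        + fieldDeriv (multiplier p ε) (potential p ε a) q) - 1 / 4 * box (zerothCoeff p ε) q := by
  have hL := two_le_dimConst m n
  have hr := rFun_pos hf
  have hpot := sq_le_potential_add_fieldDeriv hf hε h (by linarith : 1 ≤ a)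
  have hbox := (le_abs_self _).trans (abs_box_zerothCoeff_le hf hε)
  have ha2 : a + dimConst m n ≤ a ^ 2 := by nlinarith
  have := mul_le_mul_of_nonneg_right ha2 (by positivity : 0 ≤ ε / rFun p q)
  linarith

end Coercivity

section Pointwise

variable {m n : ℕ} {p q : Spacetime m n} {ε : ℝ} {a : ℕ} {z : Spacetime m n → ℝ}

/-- The current of the Carleman estimate for the weight `(f_p / (1 - ε r_p)) ^ a`. -/
def carlemanCurrent (p : Spacetime m n) (ε : ℝ) (a : ℕ) (z : Spacetime m n → ℝ) :
    Fin m ⊕ Fin n → Spacetime m n → ℝ :=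
  currentField (multiplier p ε) (zerothCoeff p ε) (potential p ε a) (conj p ε a z)

lemma fieldDiv_carlemanCurrent (hz : ContDiffAt ℝ 2 z q) (hf : 0 < fFun p q)
    (he : 0 < damping p ε q) (ha : a ≠ 0) : fieldDiv (carlemanCurrent p ε a z) q =
      weight p ε q ^ a * box z q * (fieldDeriv (multiplier p ε) (conj p ε a z) q
        + 1 / 2 * zerothCoeff p ε q * conj p ε a z q)
      + 2 * a / (fFun p q * damping p ε q) * (fieldDeriv (multiplier p ε) (conj p ε a z) q
        + 1 / 2 * zerothCoeff p ε q * conj p ε a z q) ^ 2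
      + 1 / 2 * radialCoeff p ε q * (timeGradSq (conj p ε a z) q + spaceGradSq (conj p ε a z) q
        - 2 * (spaceDilation p (conj p ε a z) q ^ 2 / rFun p q ^ 2))
      + (1 / 2 * (potential p ε a q * (damping p ε q + radialCoeff p ε q)
        + fieldDeriv (multiplier p ε) (potential p ε a) q) - 1 / 4 * box (zerothCoeff p ε) q)
        * conj p ε a z q ^ 2 := by
  have hr := rFun_pos hf
  have hdiv : fieldDiv (multiplier p ε) q =
      zerothCoeff p ε q + damping p ε q + radialCoeff p ε q := by
    rw [fieldDiv_multiplier hr, zerothCoeff]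
    ring
  rw [carlemanCurrent, fieldDiv_currentField (fun j => (hasPartials_multiplier hr j).1)
    (contDiffAt_zerothCoeff hr) (hasPartials_potential hf he a).1 (contDiffAt_conj hz hf he a),
    deformation_multiplier hr, hdiv, box_conj hz hf he ha, gradInner_self]
  ring

lemma gSign_mul_sq (i : Fin m ⊕ Fin n) (x : ℝ) : (gSign i * x) ^ 2 = x ^ 2 := by
  rw [mul_pow, sq (gSign i), gSign_mul_self, one_mul]

lemma weight_pow_mul_fderiv (hz : DifferentiableAt ℝ z q) (hf : 0 < fFun p q)
    (he : 0 < damping p ε q) (ha : a ≠ 0) (X : Spacetime m n) :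
    weight p ε q ^ a * fderiv ℝ z q X = ∑ i, coord X i * pderiv i (conj p ε a z) q
      - a * (fFun p q * damping p ε q)⁻¹ * (∑ i, coord X i * (gSign i * multiplier p ε i q))
        * conj p ε a z q := by
  rw [fderiv_eq_sum_pderiv, Finset.mul_sum, Finset.mul_sum, Finset.sum_mul,
    ← Finset.sum_sub_distrib]
  refine Finset.sum_congr rfl fun i _ => ?_
  simp only [(hasPartials_conj hz hf he ha).2, conjDeriv, weightPowDeriv, weightRate, conj]
  ring

lemma neg_add_sub_sq_le (x y v : ℝ) : (-x + y - v) ^ 2 ≤ 3 * (x ^ 2 + y ^ 2 + v ^ 2) := by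
  linarith [sq_nonneg (x + y), sq_nonneg (x - v), sq_nonneg (y + v)]

variable {C Vb V : ℝ} {X : Spacetime m n}

lemma weighted_inner_multiplier_sq_le (hf : 0 < fFun p q) (hε : 0 ≤ ε)
    (h : ε * rFun p q ≤ 1 / 2) (hX : ∑ i, coord X i ^ 2 ≤ C * fFun p q) :
    (a * (fFun p q * damping p ε q)⁻¹ * ∑ i, coord X i * (gSign i * multiplier p ε i q)) ^ 2 ≤
      4 * a ^ 2 / fFun p q * (C * rFun p q ^ 2) := by
  have he := half_le_damping h
  set Q := ∑ i, coord X i * (gSign i * multiplier p ε i q)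
  have hQ_le : Q ^ 2 ≤ C * fFun p q * rFun p q ^ 2 := by
    refine (Finset.sum_mul_sq_le_sq_mul_sq _ _ _).trans ?_
    simp only [gSign_mul_sq]
    exact mul_le_mul hX (sum_multiplier_sq_le hf hε h)
      (Finset.sum_nonneg fun i _ => sq_nonneg _)
      ((Finset.sum_nonneg fun i _ => sq_nonneg _).trans hX)
  have hinv : (damping p ε q ^ 2)⁻¹ ≤ 4 := by
    have : 0 < damping p ε q := by linarith
    rw [inv_le_comm₀ (by positivity) (by norm_num)]
    nlinarith
  calc (a * (fFun p q * damping p ε q)⁻¹ * Q) ^ 2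
      = a ^ 2 / fFun p q ^ 2 * ((damping p ε q ^ 2)⁻¹ * Q ^ 2) := by field_simp
    _ ≤ a ^ 2 / fFun p q ^ 2 * (4 * (C * fFun p q * rFun p q ^ 2)) := by gcongr
    _ = 4 * a ^ 2 / fFun p q * (C * rFun p q ^ 2) := by field_simp

lemma weighted_box_sq_le (hz : DifferentiableAt ℝ z q) (hf : 0 < fFun p q) (hε : 0 ≤ ε)
    (h : ε * rFun p q ≤ 1 / 2) (ha : a ≠ 0) (hX : ∑ i, coord X i ^ 2 ≤ C * fFun p q)
    (hV : |V| ≤ Vb) (heq : box z q + fderiv ℝ z q X + V * z q = 0) :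
    (weight p ε q ^ a * box z q) ^ 2 ≤
      3 * (C * fFun p q * (timeGradSq (conj p ε a z) q + spaceGradSq (conj p ε a z) q)
        + (4 * a ^ 2 / fFun p q * (C * rFun p q ^ 2) + Vb ^ 2) * conj p ε a z q ^ 2) := by
  have he0 : 0 < damping p ε q := by linarith [half_le_damping h]
  set Q₁ := ∑ i, coord X i * pderiv i (conj p ε a z) q
  set Q₂ := ∑ i, coord X i * (gSign i * multiplier p ε i q)
  set w := conj p ε a z q
  have hsplit : weight p ε q ^ a * box z q =
      -Q₁ + a * (fFun p q * damping p ε q)⁻¹ * Q₂ * w - V * w := by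
    have hfield := weight_pow_mul_fderiv hz hf he0 ha X
    have hconj : w = weight p ε q ^ a * z q := rfl
    linear_combination weight p ε q ^ a * heq - hfield + V * hconj
  have hQ₁_le : Q₁ ^ 2 ≤
      C * fFun p q * (timeGradSq (conj p ε a z) q + spaceGradSq (conj p ε a z) q) := by
    rw [← sum_pderiv_sq]
    exact (Finset.sum_mul_sq_le_sq_mul_sq _ _ _).trans (mul_le_mul_of_nonneg_right hX
      (Finset.sum_nonneg fun i _ => sq_nonneg _))
  have hV_sq : V ^ 2 ≤ Vb ^ 2 := sq_le_sq.2 (hV.trans (le_abs_self _))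
  rw [hsplit]
  refine (neg_add_sub_sq_le _ _ _).trans ?_
  rw [mul_pow _ w, mul_pow _ w]
  have := mul_le_mul_of_nonneg_right 
    (add_le_add (weighted_inner_multiplier_sq_le (a := a) hf hε h hX) hV_sq) (sq_nonneg w)
  linarith

lemma mul_add_mul_sq_ge {M : ℝ} (hM : 0 < M) (x y : ℝ) :
    3 / 4 * M * y ^ 2 - x ^ 2 / M ≤ x * y + M * y ^ 2 := by
  have hsq : M * (y / 2 + x / M) ^ 2 = M * y ^ 2 / 4 + x * y + x ^ 2 / M := by
    field_simp
    ring
  linarith [mul_nonneg hM.le (sq_nonneg (y / 2 + x / M))]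

lemma sq_le_two_mul_add_sq {S γ L : ℝ} (hγ : |γ| ≤ L) (w : ℝ) :
    S ^ 2 ≤ 2 * (S + 1 / 2 * γ * w) ^ 2 + 1 / 2 * L ^ 2 * w ^ 2 := by
  have h := mul_le_mul_of_nonneg_right (sq_le_sq.2 (hγ.trans (le_abs_self L))) (sq_nonneg w)
  linarith [sq_nonneg (S + γ * w)]

/-- The size of the exponent `a` at which the Carleman estimate absorbs, in a region `r_p ≤ R`, a
drift `X` with `|X|² ≤ C f_p` and a potential bounded by `Vb`. -/
structure Absorbing (m n : ℕ) (ε R C Vb : ℝ) (a : ℕ) : Prop where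
  dimConst_le : 7 * dimConst m n ≤ a
  drift_le : 96 * C * R ^ 3 ≤ a * ε
  potential_le : 6 * R ^ 3 * Vb ^ 2 ≤ a * ε

lemma eventually_absorbing (m n : ℕ) (hε : 0 < ε) (R C Vb : ℝ) :
    ∀ᶠ a in atTop, Absorbing m n ε R C Vb a := by
  have hlarge (c : ℝ) : ∀ᶠ a : ℕ in atTop, c ≤ a :=
    tendsto_natCast_atTop_atTop.eventually_ge_atTop c
  filter_upwards [hlarge (7 * dimConst m n), hlarge (96 * C * R ^ 3 / ε),
    hlarge (6 * R ^ 3 * Vb ^ 2 / ε)] with a hdim hdrift hpotential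
  exact ⟨hdim, (div_le_iff₀ hε).1 hdrift, (div_le_iff₀ hε).1 hpotential⟩

variable {R : ℝ}

namespace Absorbing

lemma one_le (h : Absorbing m n ε R C Vb a) : (1 : ℝ) ≤ a := by
  linarith [h.dimConst_le, two_le_dimConst m n]

lemma drift_le_div (ha : Absorbing m n ε R C Vb a) (hf : 0 < fFun p q) (hR : rFun p q ≤ R)
    (hC : 0 ≤ C) : 96 * (C * rFun p q ^ 2) ≤ a * (ε / rFun p q) := by
  have hr := rFun_pos hf
  have hr3 : rFun p q ^ 3 ≤ R ^ 3 := by gcongr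
  rw [← mul_div_assoc, le_div_iff₀ hr]
  linarith [ha.drift_le, mul_le_mul_of_nonneg_left hr3 hC]

lemma potential_le_div (ha : Absorbing m n ε R C Vb a) (hf : 0 < fFun p q) (hR : rFun p q ≤ R) :
    24 * (fFun p q * Vb ^ 2) ≤ a * (ε / rFun p q) := by
  have hr := rFun_pos hf
  have hr3 : rFun p q ^ 3 ≤ R ^ 3 := by gcongr
  rw [← mul_div_assoc, le_div_iff₀ hr]
  linarith [ha.potential_le, mul_le_mul_of_nonneg_right hr3 (sq_nonneg Vb),
    mul_le_mul_of_nonneg_right (four_fFun_le p q) (by positivity : 0 ≤ rFun p q * Vb ^ 2)]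

lemma weighted_box_sq_le (ha : Absorbing m n ε R C Vb a) (hz : DifferentiableAt ℝ z q)
    (hf : 0 < fFun p q) (hε : 0 ≤ ε) (h : ε * rFun p q ≤ 1 / 2) (hR : rFun p q ≤ R) (hC : 0 ≤ C)
    (hX : ∑ i, coord X i ^ 2 ≤ C * fFun p q) (hV : |V| ≤ Vb)
    (heq : box z q + fderiv ℝ z q X + V * z q = 0) :
    (weight p ε q ^ a * box z q) ^ 2 / (2 * a / (fFun p q * damping p ε q)) ≤
      1 / 2 * (ε / rFun p q) * (fFun p q ^ 2 / rFun p q ^ 2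
        * (timeGradSq (conj p ε a z) q + spaceGradSq (conj p ε a z) q))
      + a ^ 2 * (ε / rFun p q) / 8 * conj p ε a z q ^ 2 := by
  have hr := rFun_pos hf
  have he : 0 < damping p ε q := by linarith [half_le_damping h]
  have ha1 := ha.one_le
  have hCr := ha.drift_le_div hf hR hC
  have hVr := ha.potential_le_div hf hR
  set u := ε / rFun p q
  set G := timeGradSq (conj p ε a z) q + spaceGradSq (conj p ε a z) q
  set w2 := conj p ε a z q ^ 2
  have hG : 0 ≤ G := add_nonneg (timeGradSq_nonneg _ q) (spaceGradSq_nonneg _ q)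
  have hgrad : 3 * (C * fFun p q ^ 2) / (2 * a) ≤ 1 / 2 * u * (fFun p q ^ 2 / rFun p q ^ 2) := by
    rw [div_le_iff₀ (by positivity), mul_div_assoc', div_mul_eq_mul_div,
      le_div_iff₀ (by positivity)]
    have hCr' : 3 * (C * rFun p q ^ 2) ≤ a * u := by
      linarith [(by positivity : 0 ≤ C * rFun p q ^ 2)]
    linarith [mul_le_mul_of_nonneg_right hCr' (sq_nonneg (fFun p q))]
  have hdrift : 6 * a * (C * rFun p q ^ 2) ≤ a ^ 2 * u / 16 := by
    linarith [mul_le_mul_of_nonneg_left hCr (by linarith : (0 : ℝ) ≤ a)]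
  have hpot : 3 * (fFun p q * Vb ^ 2) / (2 * a) ≤ a ^ 2 * u / 16 := by
    rw [div_le_iff₀ (by positivity)]
    have hu : 0 ≤ a * u := by positivity
    linarith [mul_le_mul_of_nonneg_left (one_le_pow₀ ha1 : (1 : ℝ) ≤ a ^ 2) hu]
  calc (weight p ε q ^ a * box z q) ^ 2 / (2 * a / (fFun p q * damping p ε q))
      ≤ (weight p ε q ^ a * box z q) ^ 2 / (2 * a / fFun p q) := by
        gcongr
        exact mul_le_of_le_one_right hf.le (damping_le_one hε p q)
    _ ≤ 3 * (C * fFun p q * G + (4 * a ^ 2 / fFun p q * (C * rFun p q ^ 2) + Vb ^ 2) * w2)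
        / (2 * a / fFun p q) := by
        gcongr
        exact Ultrahyperbolic.weighted_box_sq_le hz hf hε h (by rintro rfl; norm_num at ha1) hX
          hV heq
    _ = 3 * (C * fFun p q ^ 2) / (2 * a) * G + (6 * a * (C * rFun p q ^ 2)
        + 3 * (fFun p q * Vb ^ 2) / (2 * a)) * w2 := by
        field_simp
        ring
    _ ≤ 1 / 2 * u * (fFun p q ^ 2 / rFun p q ^ 2) * G
        + (a ^ 2 * u / 16 + a ^ 2 * u / 16) * w2 := by gcongr
    _ = _ := by ring

theorem carleman_pointwise (ha : Absorbing m n ε R C Vb a) (hz : ContDiffAt ℝ 2 z q)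
    (hf : 0 < fFun p q) (hε : 0 ≤ ε) (h : ε * rFun p q ≤ 1 / 2) (hR : rFun p q ≤ R) (hC : 0 ≤ C)
    (hX : ∑ i, coord X i ^ 2 ≤ C * fFun p q) (hV : |V| ≤ Vb)
    (heq : box z q + fderiv ℝ z q X + V * z q = 0) :
    (a : ℝ) ^ 2 * (ε / rFun p q) / 16 * conj p ε a z q ^ 2 ≤
      fieldDiv (carlemanCurrent p ε a z) q := by
  have hr := rFun_pos hf
  have he : 0 < damping p ε q := by linarith [half_le_damping h]
  have ha1 := ha.one_le
  have hM : 0 < 2 * a / (fFun p q * damping p ε q) := by positivity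
  have hbox := ha.weighted_box_sq_le (hz.differentiableAt (by norm_num)) hf hε h hR hC hX hV heq
  have hgrad := gradient_coercivity hf hε h (conj p ε a z)
  have hzeroth := mul_le_mul_of_nonneg_right (zerothOrder_lower_bound hf hε h ha.dimConst_le)
    (sq_nonneg (conj p ε a z q))
  have hS := sq_le_two_mul_add_sq (S := fieldDeriv (multiplier p ε) (conj p ε a z) q)
    (abs_zerothCoeff_le hf hε h) (conj p ε a z q)
  rw [fieldDiv_carlemanCurrent hz hf he (by rintro rfl; norm_num at ha1)]
  set Sw := fieldDeriv (multiplier p ε) (conj p ε a z) q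
    + 1 / 2 * zerothCoeff p ε q * conj p ε a z q
  have hcross := mul_add_mul_sq_ge hM (weight p ε q ^ a * box z q) Sw
  have hk := radialCoeff_le hf hε h
  have hku : radialCoeff p ε q = ε / rFun p q * fFun p q := by rw [radialCoeff]; ring
  have hu : 0 ≤ ε / rFun p q := by positivity
  have hSw : 10 * (ε / rFun p q) * Sw ^ 2 ≤
      3 / 4 * (2 * a / (fFun p q * damping p ε q)) * Sw ^ 2 := by
    refine mul_le_mul_of_nonneg_right ?_ (sq_nonneg Sw)
    rw [← mul_div_assoc (3 / 4 : ℝ), le_div_iff₀ (by positivity)]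
    have := mul_le_mul hk (damping_le_one hε p q) he.le (by norm_num)
    rw [hku] at this
    linarith
  have hdim : 40 * dimConst m n ^ 2 ≤ (a : ℝ) ^ 2 := by
    nlinarith [ha.dimConst_le, two_le_dimConst m n]
  have hw := mul_le_mul_of_nonneg_right (mul_le_mul_of_nonneg_right hdim hu)
    (sq_nonneg (conj p ε a z q))
  have hgrad_u := mul_le_mul_of_nonneg_left hgrad hu
  have hS_u := mul_le_mul_of_nonneg_left hS hu
  rw [hku] at hzeroth ⊢
  linear_combination hzeroth + hcross + hbox + hSw + 1 / 2 * hgrad_u + 5 * hS_u + hw / 16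

end Absorbing

end Pointwise

/-! ### Weak divergence inequalities up to the boundary -/

section Divergence

open MeasureTheory

/-- A smooth cutoff on the line, equal to `0` up to `1` and to `1` from `2` on. -/
def cutoff (s : ℝ) : ℝ := Real.smoothTransition (s - 1)

lemma contDiff_cutoff : ContDiff ℝ 1 cutoff :=
  Real.smoothTransition.contDiff.comp (contDiff_id.sub contDiff_const)

lemma cutoff_of_le {s : ℝ} (h : s ≤ 1) : cutoff s = 0 :=
  Real.smoothTransition.zero_of_nonpos (by linarith)

lemma cutoff_of_ge {s : ℝ} (h : 2 ≤ s) : cutoff s = 1 :=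
  Real.smoothTransition.one_of_one_le (by linarith)

lemma cutoff_nonneg (s : ℝ) : 0 ≤ cutoff s := Real.smoothTransition.nonneg _

lemma norm_cutoff_le_one (s : ℝ) : ‖cutoff s‖ ≤ 1 := by
  rw [Real.norm_of_nonneg (cutoff_nonneg s)]
  exact Real.smoothTransition.le_one _

lemma deriv_cutoff_nonneg (s : ℝ) : 0 ≤ deriv cutoff s :=
  Monotone.deriv_nonneg fun _ _ h => Real.smoothTransition.monotone (sub_le_sub_right h 1)

lemma deriv_cutoff_of_notMem {s : ℝ} (h : s ∉ Icc (1 : ℝ) 2) : deriv cutoff s = 0 := by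
  rw [mem_Icc, not_and_or, not_le, not_le] at h
  rcases h with h | h
  · have : cutoff =ᶠ[𝓝 s] fun _ => 0 :=
      mem_of_superset (Iio_mem_nhds h) fun y hy => cutoff_of_le (le_of_lt hy)
    rw [this.deriv_eq, deriv_const]
  · have : cutoff =ᶠ[𝓝 s] fun _ => 1 :=
      mem_of_superset (Ioi_mem_nhds h) fun y hy => cutoff_of_ge (le_of_lt hy)
    rw [this.deriv_eq, deriv_const]

lemma exists_deriv_cutoff_mul_sq_le : ∃ M, ∀ s, deriv cutoff s * s ^ 2 ≤ M := by
  obtain ⟨M, hM⟩ := (isCompact_Icc (a := (1 : ℝ)) (b := 2)).bddAbove_image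
    ((contDiff_cutoff.continuous_deriv le_rfl).mul (continuous_pow 2)).continuousOn
  refine ⟨max M 0, fun s => ?_⟩
  by_cases hs : s ∈ Icc (1 : ℝ) 2
  · exact le_max_of_le_left (hM (mem_image_of_mem _ hs))
  · rw [deriv_cutoff_of_notMem hs, zero_mul]
    exact le_max_right _ _

section Topological

variable {X : Type*} [TopologicalSpace X] {φ ξ G : X → ℝ}

lemma tsupport_cutoff_mul_subset (hφ : Continuous φ) (c : ℝ) :
    tsupport (fun x => cutoff (c * φ x) * ξ x) ⊆ tsupport ξ ∩ {x | 1 ≤ c * φ x} := by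
  refine closure_minimal (fun x hx => ?_) ((isClosed_tsupport ξ).inter
    (isClosed_le continuous_const (continuous_const.mul hφ)))
  obtain ⟨hcut, hξ⟩ := mul_ne_zero_iff.1 hx
  exact ⟨subset_tsupport _ hξ, le_of_not_ge fun h => hcut (cutoff_of_le h)⟩

lemma exists_strip_lt {K : Set X} (hK : IsCompact K) {Φ : X → ℝ} (hφ : Continuous φ)
    (hΦ : ContinuousOn Φ (K ∩ {x | φ x ≤ 0})) (h0 : ∀ x ∈ K, φ x = 0 → Φ x ≤ 0) {η : ℝ}
    (hη : 0 < η) : ∃ δ > 0, ∀ x ∈ K, -δ ≤ φ x → φ x ≤ 0 → Φ x < η := by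
  have hside : IsCompact (K ∩ {x | φ x ≤ 0}) := hK.inter_right (isClosed_le hφ continuous_const)
  obtain ⟨S, hS, hSη⟩ := continuousOn_iff_isClosed.1 hΦ (Ici η) isClosed_Ici
  obtain ⟨δ, hδ, hle⟩ := (hside.inter_left hS).exists_forall_le' (f := fun x => -φ x) (a := 0)
    hφ.neg.continuousOn fun x hx => by
      have hxη : η ≤ Φ x := (hSη.ge hx).1
      exact neg_pos.2 (lt_of_le_of_ne hx.2.2 fun h => by linarith [h0 x hx.2.1 h])
  refine ⟨δ / 2, half_pos hδ, fun x hx hxδ hx0 => ?_⟩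
  by_contra! h
  linarith [hle x (hSη.le ⟨h, hx, hx0⟩)]

variable [MeasurableSpace X] [OpensMeasurableSpace X] {μ : Measure X} {W : Set X}

lemma integrableOn_cutoff_mul (hφ : Continuous φ) (hG : IntegrableOn G W μ) (c : ℝ) :
    IntegrableOn (fun x => cutoff (c * φ x) * G x) W μ :=
  hG.bdd_mul (c := 1)
    (contDiff_cutoff.continuous.comp (continuous_const.mul hφ)).aestronglyMeasurable
    (Eventually.of_forall fun _ => norm_cutoff_le_one _)

lemma tendsto_setIntegral_cutoff_mul (hφ : Continuous φ) (hW : MeasurableSet W)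
    (hG : IntegrableOn G W μ) (hGφ : ∀ x ∈ W, G x ≠ 0 → φ x < 0) :
    Tendsto (fun k : ℕ => ∫ x in W, cutoff (-k * φ x) * G x ∂μ) atTop (𝓝 (∫ x in W, G x ∂μ)) := by
  refine tendsto_integral_of_dominated_convergence (fun x => ‖G x‖)
    (fun k => (integrableOn_cutoff_mul hφ hG _).aestronglyMeasurable) hG.norm
    (fun k => Eventually.of_forall fun x => ?_) ((ae_restrict_mem hW).mono fun x hx => ?_)
  · rw [norm_mul]
    exact mul_le_of_le_one_left (norm_nonneg _) (norm_cutoff_le_one _)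
  · by_cases hGx : G x = 0
    · simp [hGx]
    refine tendsto_const_nhds.congr' ?_
    filter_upwards [tendsto_natCast_atTop_atTop.eventually_ge_atTop (2 / -φ x)] with k hk
    rw [div_le_iff₀ (neg_pos.2 (hGφ x hx hGx))] at hk
    rw [cutoff_of_ge (by linarith), one_mul]

lemma integrable_mul_of_tsupport_subset [IsFiniteMeasureOnCompacts μ] {ψ g : X → ℝ}
    (hψ : Continuous ψ) (hc : HasCompactSupport ψ) (hs : tsupport ψ ⊆ W) (hW : IsOpen W)
    (hg : ContinuousOn g W) : Integrable (fun x => ψ x * g x) μ := by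
  refine (continuous_of_tsupport fun x hx => ?_).integrable_of_hasCompactSupport hc.mul_right
  exact hψ.continuousAt.mul (hg.continuousAt (hW.mem_nhds (hs (tsupport_mul_subset_left hx))))

end Topological

variable {E : Type*} [NormedAddCommGroup E] [NormedSpace ℝ E] {ι : Type*} [Fintype ι] {b : ι → E}
  {W : Set E} {P : ι → E → ℝ} {ξ φ d G : E → ℝ} {x : E}

/-- The derivative of `ξ` along the vector field `∑ i, P i • b i`. -/
def derivAlong (b : ι → E) (ξ : E → ℝ) (P : ι → E → ℝ) (x : E) : ℝ :=
  ∑ i, fderiv ℝ ξ x (b i) * P i x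

/-- The divergence of the vector field `∑ i, P i • b i`. -/
def divergence (b : ι → E) (P : ι → E → ℝ) (x : E) : ℝ :=
  ∑ i, fderiv ℝ (P i) x (b i)

/-- Nonnegative, compactly supported functions of class `C¹`. -/
structure IsTestFunction (ξ : E → ℝ) : Prop where
  contDiff : ContDiff ℝ 1 ξ
  hasCompactSupport : HasCompactSupport ξ
  nonneg : ∀ x, 0 ≤ ξ x

lemma derivAlong_eq_zero (h : x ∉ tsupport ξ) : derivAlong b ξ P x = 0 :=
  Finset.sum_eq_zero fun i _ => by
    rw [image_eq_zero_of_notMem_tsupport fun h' => h (tsupport_fderiv_apply_subset ℝ (b i) h'),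
      zero_mul]

lemma derivAlong_sub_const (v : ι → ℝ) :
    derivAlong b ξ (fun i x => P i x - v i) x =
      derivAlong b ξ P x - derivAlong b ξ (fun i _ => v i) x := by
  simp only [derivAlong, mul_sub, Finset.sum_sub_distrib]

lemma derivAlong_sum {κ : Type*} [Fintype κ] {ξ : κ → E → ℝ}
    (hξ : ∀ k, DifferentiableAt ℝ (ξ k) x) :
    derivAlong b (fun y => ∑ k, ξ k y) P x = ∑ k, derivAlong b (ξ k) P x := by
  simp only [derivAlong, fderiv_fun_sum fun k _ => hξ k]
  rw [Finset.sum_comm]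
  simp [Finset.sum_mul]

lemma derivAlong_const_mul (c : ℝ) (v : ι → ℝ) :
    derivAlong b ξ (fun i _ => c * v i) x = c * derivAlong b ξ (fun i _ => v i) x := by
  simp only [derivAlong, Finset.mul_sum, mul_left_comm]

lemma divergence_sub_const (v : ι → ℝ) :
    divergence b (fun i x => P i x - v i) x = divergence b P x := by
  simp only [divergence, fderiv_sub_const]

lemma continuous_derivAlong_const (hξ : ContDiff ℝ 1 ξ) (v : ι → ℝ) :
    Continuous (derivAlong b ξ fun i _ => v i) :=
  continuous_finsetSum _ fun _ _ =>
    ((hξ.continuous_fderiv one_ne_zero).clm_apply continuous_const).mul continuous_const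

lemma continuousOn_derivAlong {s : Set E} (hξ : ContDiff ℝ 1 ξ) (hP : ∀ i, ContinuousOn (P i) s) :
    ContinuousOn (derivAlong b ξ P) s :=
  continuousOn_finsetSum _ fun i _ =>
    ((hξ.continuous_fderiv one_ne_zero).clm_apply continuous_const).continuousOn.mul (hP i)

lemma contDiff_cutoff_comp (hφ : ContDiff ℝ 1 φ) (c : ℝ) :
    ContDiff ℝ 1 fun x => cutoff (c * φ x) :=
  contDiff_cutoff.comp (contDiff_const.mul hφ)

lemma IsTestFunction.cutoff_mul (hξ : IsTestFunction ξ) (hφ : ContDiff ℝ 1 φ) (c : ℝ) :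
    IsTestFunction fun x => cutoff (c * φ x) * ξ x :=
  ⟨(contDiff_cutoff_comp hφ c).mul hξ.contDiff, hξ.hasCompactSupport.mul_left,
    fun x => mul_nonneg (cutoff_nonneg _) (hξ.nonneg x)⟩

lemma derivAlong_cutoff_mul (hφ : DifferentiableAt ℝ φ x) (hξ : DifferentiableAt ℝ ξ x) (c : ℝ) :
    derivAlong b (fun x => cutoff (c * φ x) * ξ x) P x =
      cutoff (c * φ x) * derivAlong b ξ P x
        + c * deriv cutoff (c * φ x) * ξ x * derivAlong b φ P x := by
  have hcut : HasFDerivAt (fun y => cutoff (c * φ y))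
      (deriv cutoff (c * φ x) • c • fderiv ℝ φ x) x :=
    (contDiff_cutoff.differentiable one_ne_zero _).hasDerivAt.comp_hasFDerivAt x
      (hφ.hasFDerivAt.const_mul c)
  simp only [derivAlong, (hcut.fun_mul hξ.hasFDerivAt).fderiv, Finset.mul_sum,
    ← Finset.sum_add_distrib]
  refine Finset.sum_congr rfl fun i _ => ?_
  simp only [add_apply, smul_apply, smul_eq_mul]
  ring

lemma neg_derivAlong_cutoff_mul_le {κ : E → ℝ} {M C k : ℝ} (hM : ∀ s, deriv cutoff s * s ^ 2 ≤ M)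
    (hk : 0 < k) (hC : 0 ≤ C) (hf : DifferentiableAt ℝ f x) (hκ : κ =ᶠ[𝓝 x] fun _ => 1)
    (hP : |derivAlong b f P x| ≤ C * f x ^ 2) :
    -derivAlong b (fun y => cutoff (k * f y) * κ y) P x ≤ C * M / k := by
  have hκ0 : derivAlong b κ P x = 0 := by simp [derivAlong, hκ.fderiv_eq]
  rw [derivAlong_cutoff_mul hf ((differentiableAt_const _).congr_of_eventuallyEq hκ), hκ0,
    hκ.eq_of_nhds]
  calc -(cutoff (k * f x) * 0 + k * deriv cutoff (k * f x) * 1 * derivAlong b f P x)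
      = k * deriv cutoff (k * f x) * -derivAlong b f P x := by ring
    _ ≤ k * deriv cutoff (k * f x) * (C * f x ^ 2) :=
        mul_le_mul_of_nonneg_left ((neg_le_abs _).trans hP)
          (mul_nonneg hk.le (deriv_cutoff_nonneg _))
    _ = C * (deriv cutoff (k * f x) * (k * f x) ^ 2) / k := by field_simp
    _ ≤ C * M / k := by gcongr; exact hM _

section WeakDivLE

variable [MeasurableSpace E]

/-- The weak form, tested against `ξ`, of the two inequalities `d ≤ div P` in `W` and `P · ν ≤ 0`
on the boundary of `W`, where `ν` is the outer conormal. -/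
structure WeakDivLE (μ : Measure E) (b : ι → E) (W : Set E) (d : E → ℝ) (P : ι → E → ℝ)
    (ξ : E → ℝ) : Prop where
  integrableOn : IntegrableOn (derivAlong b ξ P) W μ
  le : ∫ x in W, ξ x * d x ∂μ ≤ -∫ x in W, derivAlong b ξ P x ∂μ

/-- `WeakDivLE` against all test functions supported near `q`. -/
def LocalWeakDivLE (μ : Measure E) (b : ι → E) (W : Set E) (d : E → ℝ) (P : ι → E → ℝ) (q : E) :
    Prop :=
  ∃ N ∈ 𝓝 q, ∀ ξ, IsTestFunction ξ → tsupport ξ ⊆ N → WeakDivLE μ b W d P ξ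

/-- The flux of `P` out of `W` is not positive near the boundary point `q`. The boundary is given by
a function that is negative exactly in `W`, and `P` is continuous up to the boundary. -/
def HasNonposFluxAt (b : ι → E) (W : Set E) (P : ι → E → ℝ) (q : E) : Prop :=
  ∃ φ : E → ℝ, ContDiff ℝ 1 φ ∧ (∃ i, fderiv ℝ φ q (b i) ≠ 0) ∧ ∀ᶠ x in 𝓝 q,
    (x ∈ W ↔ φ x < 0) ∧ (φ x ≤ 0 → ∀ i, ContinuousWithinAt (P i) {y | φ y ≤ 0} x) ∧
      (φ x = 0 → derivAlong b φ P x ≤ 0)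

lemma weakDivLE_of_disjoint_tsupport [BorelSpace E] {μ : Measure E} (hW : IsOpen W)
    (h : ∀ x ∈ W, x ∉ tsupport ξ) : WeakDivLE μ b W d P ξ := by
  have hderiv : EqOn (derivAlong b ξ P) (fun _ => 0) W := fun x hx => derivAlong_eq_zero (h x hx)
  have hmul : EqOn (fun x => ξ x * d x) (fun _ => 0) W := fun x hx => by
    simp only [image_eq_zero_of_notMem_tsupport (h x hx), zero_mul]
  refine ⟨(integrableOn_congr_fun hderiv hW.measurableSet).2 integrableOn_zero, ?_⟩
  rw [setIntegral_congr_fun hW.measurableSet hderiv, setIntegral_congr_fun hW.measurableSet hmul]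
  simp

lemma localWeakDivLE_of_notMem_closure [BorelSpace E] {μ : Measure E} (hW : IsOpen W)
    (hx : x ∉ closure W) : LocalWeakDivLE μ b W d P x :=
  ⟨(closure W)ᶜ, isClosed_closure.isOpen_compl.mem_nhds hx, fun _ _ hs =>
    weakDivLE_of_disjoint_tsupport hW fun _ hy h => hs h (subset_closure hy)⟩

variable [BorelSpace E] {μ : Measure E} [μ.IsAddHaarMeasure]

lemma integrable_test_mul (hξ : IsTestFunction ξ) (hd : Continuous d) :
    Integrable (fun x => ξ x * d x) μ :=
  (hξ.contDiff.continuous.mul hd).integrable_of_hasCompactSupport hξ.hasCompactSupport.mul_right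

lemma integrable_fderiv_mul (hξ : IsTestFunction ξ) (hs : tsupport ξ ⊆ W) (hW : IsOpen W)
    {g : E → ℝ} (hg : ContinuousOn g W) (v : E) : Integrable (fun x => fderiv ℝ ξ x v * g x) μ :=
  integrable_mul_of_tsupport_subset
    ((hξ.contDiff.continuous_fderiv one_ne_zero).clm_apply continuous_const)
    (hξ.hasCompactSupport.fderiv_apply ℝ v) ((tsupport_fderiv_apply_subset ℝ v).trans hs) hW hg

lemma integrable_mul_fderiv (hξ : IsTestFunction ξ) (hs : tsupport ξ ⊆ W) (hW : IsOpen W)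
    {g : E → ℝ} (hg : ContDiffOn ℝ 1 g W) (v : E) : Integrable (fun x => ξ x * fderiv ℝ g x v) μ :=
  integrable_mul_of_tsupport_subset hξ.contDiff.continuous hξ.hasCompactSupport hs hW
    ((hg.continuousOn_fderiv_of_isOpen hW le_rfl).clm_apply continuousOn_const)

lemma WeakDivLE.sum {κ : Type*} [Fintype κ] {ξ : κ → E → ℝ} (hd : Continuous d)
    (hξ : ∀ k, IsTestFunction (ξ k)) (h : ∀ k, WeakDivLE μ b W d P (ξ k)) :
    WeakDivLE μ b W d P fun y => ∑ k, ξ k y := by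
  have hderiv : derivAlong b (fun y => ∑ k, ξ k y) P = fun y => ∑ k, derivAlong b (ξ k) P y :=
    funext fun y => derivAlong_sum fun k => (hξ k).contDiff.differentiable one_ne_zero y
  constructor
  · rw [hderiv]
    exact integrable_finsetSum _ fun k _ => (h k).integrableOn
  · simp only [hderiv, Finset.sum_mul]
    rw [integral_finsetSum _ fun k _ => (integrable_test_mul (hξ k) hd).integrableOn,
      integral_finsetSum _ fun k _ => (h k).integrableOn, ← Finset.sum_neg_distrib]
    exact Finset.sum_le_sum fun k _ => (h k).le

lemma WeakDivLE.of_forall_sub_const {v : ι → ℝ} (hξ : ContDiff ℝ 1 ξ) (hc : HasCompactSupport ξ)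
    (hI : IntegrableOn (derivAlong b ξ P) W μ)
    (h : ∀ η > 0, WeakDivLE μ b W d (fun i x => P i x - η * v i) ξ) : WeakDivLE μ b W d P ξ := by
  have hv : Integrable (derivAlong b ξ fun i _ => v i) μ :=
    (continuous_derivAlong_const hξ v).integrable_of_hasCompactSupport
      (hc.mono' fun x hx => by_contra fun h => hx (derivAlong_eq_zero h))
  refine ⟨hI, ?_⟩
  have hle : ∀ η > 0, ∫ x in W, ξ x * d x ∂μ ≤
      -∫ x in W, derivAlong b ξ P x ∂μ + η * ∫ x in W, derivAlong b ξ (fun i _ => v i) x ∂μ := by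
    intro η hη
    have := (h η hη).le
    simp only [derivAlong_sub_const, derivAlong_const_mul] at this
    rw [integral_sub hI (hv.integrableOn.const_mul η), integral_const_mul] at this
    linarith
  refine ge_of_tendsto (x := 𝓝[>] (0 : ℝ)) ?_ (eventually_mem_nhdsWithin.mono hle)
  refine Tendsto.mono_left ?_ nhdsWithin_le_nhds
  exact Continuous.tendsto' (by fun_prop) _ _ (by simp)

variable [FiniteDimensional ℝ E]

lemma integral_mul_divergence (hξ : IsTestFunction ξ) (hs : tsupport ξ ⊆ W) (hW : IsOpen W)
    (hP : ∀ i, ContDiffOn ℝ 1 (P i) W) :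
    ∫ x, ξ x * divergence b P x ∂μ = -∫ x, derivAlong b ξ P x ∂μ := by
  have hint i := integrable_fderiv_mul (μ := μ) hξ hs hW (hP i).continuousOn (b i)
  have hint' i := integrable_mul_fderiv (μ := μ) hξ hs hW (hP i) (b i)
  simp only [divergence, derivAlong, Finset.mul_sum]
  rw [integral_finsetSum _ fun i _ => hint' i, integral_finsetSum _ fun i _ => hint i,
    ← Finset.sum_neg_distrib]
  refine Finset.sum_congr rfl fun i _ => ?_
  exact integral_mul_fderiv_eq_neg_fderiv_mul_of_integrable (hint i) (hint' i)
    (integrable_mul_of_tsupport_subset hξ.contDiff.continuous hξ.hasCompactSupport hs hW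
      (hP i).continuousOn) (fun x _ => hξ.contDiff.differentiable one_ne_zero x)
    (fun x hx => ((hP i).contDiffAt (hW.mem_nhds (hs hx))).differentiableAt one_ne_zero)

lemma weakDivLE_of_tsupport_subset (hW : IsOpen W) (hP : ∀ i, ContDiffOn ℝ 1 (P i) W)
    (hd : Continuous d) (hdP : ∀ x ∈ W, d x ≤ divergence b P x) (hξ : IsTestFunction ξ)
    (hs : tsupport ξ ⊆ W) : WeakDivLE μ b W d P ξ := by
  have hmul : Integrable (fun x => ξ x * divergence b P x) μ := by
    simp only [divergence, Finset.mul_sum]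
    exact integrable_finsetSum _ fun i _ => integrable_mul_fderiv hξ hs hW (hP i) (b i)
  refine ⟨(integrable_finsetSum _ fun i _ =>
    integrable_fderiv_mul hξ hs hW (hP i).continuousOn (b i)).integrableOn, ?_⟩
  calc ∫ x in W, ξ x * d x ∂μ
      ≤ ∫ x in W, ξ x * divergence b P x ∂μ :=
        setIntegral_mono_on (integrable_test_mul hξ hd).integrableOn hmul.integrableOn
          hW.measurableSet fun x hx => mul_le_mul_of_nonneg_left (hdP x hx) (hξ.nonneg x)
    _ = ∫ x, ξ x * divergence b P x ∂μ :=
        setIntegral_eq_integral_of_forall_compl_eq_zero fun x hx => by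
          rw [image_eq_zero_of_notMem_tsupport fun h => hx (hs h), zero_mul]
    _ = -∫ x, derivAlong b ξ P x ∂μ := integral_mul_divergence hξ hs hW hP
    _ = -∫ x in W, derivAlong b ξ P x ∂μ := by
        rw [setIntegral_eq_integral_of_forall_compl_eq_zero fun x hx =>
          derivAlong_eq_zero fun h => hx (hs h)]

lemma weakDivLE_of_derivAlong_nonpos (hW : IsOpen W) (hP : ∀ i, ContDiffOn ℝ 1 (P i) W)
    (hd : Continuous d) (hdP : ∀ x ∈ W, d x ≤ divergence b P x) (hξ : IsTestFunction ξ)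
    (hI : IntegrableOn (derivAlong b ξ P) W μ) (hφ : ContDiff ℝ 1 φ)
    (hφW : ∀ x ∈ tsupport ξ, (x ∈ W ↔ φ x < 0)) {δ : ℝ} (hδ : 0 < δ)
    (hφP : ∀ x ∈ tsupport ξ, -δ ≤ φ x → φ x < 0 → derivAlong b φ P x ≤ 0) :
    WeakDivLE μ b W d P ξ := by
  have happrox : ∀ᶠ k : ℕ in atTop, ∫ x in W, cutoff (-k * φ x) * (ξ x * d x) ∂μ ≤
      ∫ x in W, cutoff (-k * φ x) * (-derivAlong b ξ P x) ∂μ := by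
    filter_upwards [tendsto_natCast_atTop_atTop.eventually_ge_atTop (2 / δ),
      tendsto_natCast_atTop_atTop.eventually_gt_atTop (0 : ℝ)] with k hkδ hk
    rw [div_le_iff₀ hδ] at hkδ
    have hsupp : tsupport (fun x => cutoff (-k * φ x) * ξ x) ⊆ W := fun x hx => by
      obtain ⟨hxξ, hxφ⟩ := tsupport_cutoff_mul_subset hφ.continuous _ hx
      refine (hφW x hxξ).2 (neg_of_mul_neg_right (a := (k : ℝ)) ?_ hk.le)
      linarith [show (1 : ℝ) ≤ -k * φ x from hxφ]
    have hψ := hξ.cutoff_mul hφ (-k)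
    have hweak := weakDivLE_of_tsupport_subset (μ := μ) hW hP hd hdP hψ hsupp
    simp only [← mul_assoc]
    refine hweak.le.trans ?_
    rw [← integral_neg]
    refine setIntegral_mono_on hweak.integrableOn.neg
      (integrableOn_cutoff_mul hφ.continuous hI.neg _) hW.measurableSet fun x hx => ?_
    rw [derivAlong_cutoff_mul (hφ.differentiable one_ne_zero x)
      (hξ.contDiff.differentiable one_ne_zero x)]
    suffices 0 ≤ deriv cutoff (-k * φ x) * (ξ x * -derivAlong b φ P x) by
      linarith [mul_nonneg hk.le this]
    by_cases hxξ : x ∈ tsupport ξ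
    · by_cases hlayer : -k * φ x ∈ Icc (1 : ℝ) 2
      · have := hφP x hxξ (le_of_mul_le_mul_left (by linarith [hlayer.2]) hk) ((hφW x hxξ).1 hx)
        exact mul_nonneg (deriv_cutoff_nonneg _) (mul_nonneg (hξ.nonneg x) (neg_nonneg.2 this))
      · rw [deriv_cutoff_of_notMem hlayer, zero_mul]
    · rw [image_eq_zero_of_notMem_tsupport hxξ, zero_mul, mul_zero]
  have hlim := tendsto_setIntegral_cutoff_mul hφ.continuous hW.measurableSet
    (integrable_test_mul (μ := μ) hξ hd).integrableOn fun x hx h =>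
      (hφW x (subset_tsupport _ (left_ne_zero_of_mul h))).1 hx
  have hlim' := tendsto_setIntegral_cutoff_mul hφ.continuous hW.measurableSet hI.neg fun x hx h =>
    (hφW x (by_contra fun h' => h (by simp [derivAlong_eq_zero h']))).1 hx
  refine ⟨hI, ?_⟩
  rw [← integral_neg]
  exact le_of_tendsto_of_tendsto hlim hlim' happrox

end WeakDivLE

end Divergence

section Localization

open MeasureTheory

variable {E : Type*} [NormedAddCommGroup E] [NormedSpace ℝ E] [FiniteDimensional ℝ E]
  {ι : Type*} [Fintype ι] {b : ι → E} {W : Set E} {P : ι → E → ℝ} {ξ φ d f : E → ℝ} {x : E}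

lemma exists_isTestFunction_eventuallyEq_one (hW : Bornology.IsBounded W) :
    ∃ κ : E → ℝ, IsTestFunction κ ∧ ∀ x ∈ W, κ =ᶠ[𝓝 x] fun _ => 1 := by
  obtain ⟨R, hR⟩ := hW.subset_ball (0 : E)
  have hR' : 0 < max R 1 := lt_max_of_lt_right one_pos
  let κ : ContDiffBump (0 : E) := ⟨max R 1, max R 1 + 1, hR', lt_add_one _⟩
  refine ⟨κ, ⟨κ.contDiff, κ.hasCompactSupport, fun _ => κ.nonneg⟩, fun x hx => ?_⟩
  exact κ.eventuallyEq_one_of_mem_ball (Metric.ball_subset_ball (le_max_left R 1) (hR hx))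

lemma exists_continuous_le {Q : E → ℝ} (hW : IsOpen W) (hQ : ContinuousOn Q W)
    (hQ0 : ∀ x ∈ W, 0 ≤ Q x) (hx : x ∈ W) (hQx : 0 < Q x) :
    ∃ d : E → ℝ, Continuous d ∧ HasCompactSupport d ∧ tsupport d ⊆ W ∧ 0 ≤ d ∧ 0 < d x ∧
      ∀ y ∈ W, d y ≤ Q y := by
  obtain ⟨β, hβs, hβc, hβ, hβI, hβx⟩ := exists_contDiff_tsupport_subset (n := 0) (x := x)
    (inter_mem (hW.mem_nhds hx)
      ((hQ.continuousAt (hW.mem_nhds hx)).eventually_const_lt (half_lt_self hQx)))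
  replace hβI y : β y ∈ Icc (0 : ℝ) 1 := hβI (mem_range_self y)
  have hsub : tsupport (fun y => Q x / 2 * β y) ⊆ tsupport β := tsupport_mul_subset_right
  refine ⟨fun y => Q x / 2 * β y, continuous_const.mul hβ.continuous, hβc.mul_left,
    hsub.trans fun y hy => (hβs hy).1, fun y => mul_nonneg (half_pos hQx).le (hβI y).1,
    by simpa only [hβx, mul_one] using half_pos hQx, fun y hy => ?_⟩
  by_cases hys : y ∈ tsupport β
  · exact (mul_le_of_le_one_right (half_pos hQx).le (hβI y).2).trans (le_of_lt (hβs hys).2)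
  · simp only [image_eq_zero_of_notMem_tsupport hys, mul_zero]
    exact hQ0 y hy

section WeakDivLE

variable [MeasurableSpace E] [BorelSpace E] {μ : Measure E} [μ.IsAddHaarMeasure]

lemma localWeakDivLE_of_mem (hW : IsOpen W) (hP : ∀ i, ContDiffOn ℝ 1 (P i) W)
    (hd : Continuous d) (hdP : ∀ x ∈ W, d x ≤ divergence b P x) (hx : x ∈ W) :
    LocalWeakDivLE μ b W d P x :=
  ⟨W, hW.mem_nhds hx, fun _ hξ hs => weakDivLE_of_tsupport_subset hW hP hd hdP hξ hs⟩

/- The field is tilted by `η` times the conormal at `q`, which makes its flux strictly negative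
up to the boundary and hence nonpositive in a strip along it. -/
lemma HasNonposFluxAt.localWeakDivLE (h : HasNonposFluxAt b W P x) (hW : IsOpen W)
    (hP : ∀ i, ContDiffOn ℝ 1 (P i) W) (hd : Continuous d)
    (hdP : ∀ x ∈ W, d x ≤ divergence b P x) : LocalWeakDivLE μ b W d P x := by
  obtain ⟨φ, hφ, ⟨i₀, hi₀⟩, hflux⟩ := h
  set v : ι → ℝ := fun i => fderiv ℝ φ x (b i)
  have hv0 : 0 < derivAlong b φ (fun i _ => v i) x :=
    Finset.sum_pos' (fun i _ => mul_self_nonneg _) ⟨i₀, Finset.mem_univ _, mul_self_pos.2 hi₀⟩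
  set c := derivAlong b φ (fun i _ => v i) x / 2
  have hc : 0 < c := half_pos hv0
  refine ⟨_, hflux.and ((continuous_derivAlong_const hφ v).continuousAt.eventually_const_lt
    (half_lt_self hv0)), fun ξ hξ hs => ?_⟩
  set K := tsupport ξ
  have hK : IsCompact K := hξ.hasCompactSupport.isCompact
  have hPK : ∀ i, ContinuousOn (P i) (K ∩ {y | φ y ≤ 0}) := fun i y hy =>
    ((hs hy.1).1.2.1 hy.2 i).mono inter_subset_right
  have hI : IntegrableOn (derivAlong b ξ P) W μ := by
    refine IntegrableOn.of_forall_sdiff_eq_zero ((continuousOn_derivAlong hξ.contDiff hPK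
      ).integrableOn_compact (hK.inter_right (isClosed_le hφ.continuous continuous_const)))
      hW.measurableSet fun y hy => derivAlong_eq_zero fun hyK => ?_
    exact hy.2 ⟨hyK, ((hs hyK).1.1.1 hy.1).le⟩
  refine WeakDivLE.of_forall_sub_const (v := v) hξ.contDiff hξ.hasCompactSupport hI fun η hη => ?_
  obtain ⟨δ, hδ, hstrip⟩ := exists_strip_lt hK hφ.continuous (continuousOn_derivAlong hφ hPK)
    (fun y hy => (hs hy).1.2.2) (mul_pos hη hc)
  refine weakDivLE_of_derivAlong_nonpos hW (fun i => (hP i).sub contDiffOn_const) hd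
    (fun y hy => by rw [divergence_sub_const]; exact hdP y hy) hξ ?_ hφ (fun y hy => (hs hy).1.1)
    hδ fun y hy hyδ hy0 => ?_
  · refine (IntegrableOn.sub hI ((continuous_derivAlong_const hξ.contDiff
      fun i => η * v i).integrable_of_hasCompactSupport ?_).integrableOn).congr
      (Eventually.of_forall fun y => (derivAlong_sub_const _).symm)
    exact hξ.hasCompactSupport.mono' fun y hy => by_contra fun h => hy (derivAlong_eq_zero h)
  · rw [derivAlong_sub_const, derivAlong_const_mul]
    have : η * c < _ := mul_lt_mul_of_pos_left (hs hy).2 hη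
    linarith [hstrip y hy hyδ hy0.le]

lemma weakDivLE_of_local (hd : Continuous d) (hξ : IsTestFunction ξ)
    (hloc : ∀ x ∈ tsupport ξ, LocalWeakDivLE μ b W d P x) : WeakDivLE μ b W d P ξ := by
  choose! N hN hweak using hloc
  obtain ⟨t, htK, ht⟩ := hξ.hasCompactSupport.isCompact.elim_nhds_subcover
    (fun x => interior (N x)) fun x hx => interior_mem_nhds.2 (hN x hx)
  obtain ⟨ρ, hρ⟩ := SmoothPartitionOfUnity.exists_isSubordinate (modelWithCornersSelf ℝ E)
    (isClosed_tsupport ξ) (fun x : t => interior (N x)) (fun _ => isOpen_interior)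
    (by simpa only [iUnion_subtype] using ht)
  have hsum : ξ = fun x => ∑ k, ρ k x * ξ x := funext fun x => by
    by_cases hx : x ∈ tsupport ξ
    · rw [← Finset.sum_mul, ← finsum_eq_sum_of_fintype, ρ.sum_eq_one hx, one_mul]
    · simp [image_eq_zero_of_notMem_tsupport hx]
  have hρξ : ∀ k, IsTestFunction fun x => ρ k x * ξ x := fun k =>
    ⟨((ρ k).contMDiff.contDiff.of_le (by norm_num)).mul hξ.contDiff,
      hξ.hasCompactSupport.mul_left, fun x => mul_nonneg (ρ.nonneg k x) (hξ.nonneg x)⟩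
  rw [hsum]
  exact WeakDivLE.sum hd hρξ fun k => hweak k (htK k k.2) _ (hρξ k)
    (tsupport_mul_subset_left.trans ((hρ k).trans interior_subset))

lemma integral_nonpos_of_local (hW : IsOpen W) (hWb : Bornology.IsBounded W)
    (hf : ContDiff ℝ 1 f) {C : ℝ} (hC : 0 ≤ C)
    (hP : ∀ x ∈ W, |derivAlong b f P x| ≤ C * f x ^ 2) (hd : Continuous d)
    (hdc : HasCompactSupport d) (hdW : tsupport d ⊆ W) (hdf : ∀ x ∈ tsupport d, 0 < f x)
    (hloc : ∀ x ∈ closure W, 0 < f x → LocalWeakDivLE μ b W d P x) : ∫ x, d x ∂μ ≤ 0 := by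
  obtain ⟨M, hM⟩ := exists_deriv_cutoff_mul_sq_le
  obtain ⟨δ, hδ, hδd⟩ := hdc.isCompact.exists_forall_le' hf.continuous.continuousOn hdf
  obtain ⟨κ, hκ, hκW⟩ := exists_isTestFunction_eventuallyEq_one hWb
  have key : ∀ᶠ k : ℕ in atTop, ∫ x, d x ∂μ ≤ C * M / k * μ.real W := by
    filter_upwards [tendsto_natCast_atTop_atTop.eventually_ge_atTop (2 / δ),
      tendsto_natCast_atTop_atTop.eventually_gt_atTop (0 : ℝ)] with k hkδ hk
    rw [div_le_iff₀ hδ] at hkδ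
    have hweak : WeakDivLE μ b W d P fun x => cutoff (k * f x) * κ x := by
      refine weakDivLE_of_local hd (hκ.cutoff_mul hf k) fun x hx => ?_
      by_cases hxW : x ∈ closure W
      · have : (1 : ℝ) ≤ k * f x := (tsupport_cutoff_mul_subset hf.continuous _ hx).2
        exact hloc x hxW (pos_of_mul_pos_right (one_pos.trans_le this) hk.le)
      · exact localWeakDivLE_of_notMem_closure hW hxW
    calc ∫ x, d x ∂μ = ∫ x in W, d x ∂μ :=
          (setIntegral_eq_integral_of_forall_compl_eq_zero fun x hx =>
            image_eq_zero_of_notMem_tsupport fun h => hx (hdW h)).symm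
      _ = ∫ x in W, cutoff (k * f x) * κ x * d x ∂μ := by
          refine setIntegral_congr_fun hW.measurableSet fun x hx => ?_
          by_cases hxd : x ∈ tsupport d
          · have := hkδ.trans (mul_le_mul_of_nonneg_left (hδd x hxd) hk.le)
            simp only [cutoff_of_ge this, (hκW x hx).eq_of_nhds, one_mul]
          · simp only [image_eq_zero_of_notMem_tsupport hxd, mul_zero]
      _ ≤ -∫ x in W, derivAlong b (fun x => cutoff (k * f x) * κ x) P x ∂μ := hweak.le
      _ = ∫ x in W, -derivAlong b (fun x => cutoff (k * f x) * κ x) P x ∂μ :=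
          (integral_neg _).symm
      _ ≤ ∫ _ in W, C * M / k ∂μ :=
          setIntegral_mono_on hweak.integrableOn.neg
            (integrableOn_const hWb.measure_lt_top.ne) hW.measurableSet fun x hx =>
            neg_derivAlong_cutoff_mul_le hM hk hC (hf.differentiable one_ne_zero x) (hκW x hx)
              (hP x hx)
      _ = C * M / k * μ.real W := by rw [setIntegral_const, smul_eq_mul, mul_comm]
  refine ge_of_tendsto ?_ key
  simpa using (tendsto_const_div_atTop_nhds_zero_nat (C * M)).mul_const (μ.real W)

end WeakDivLE

/- Testing with a cutoff of `{f ≤ 1 / k}` costs only a boundary term of size `k * (1 / k) ^ 2`. -/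
theorem eq_zero_of_le_divergence {Q : E → ℝ} (hW : IsOpen W) (hWb : Bornology.IsBounded W)
    (hf : ContDiff ℝ 1 f) (hfW : ∀ x ∈ W, 0 < f x) (hP : ∀ i, ContDiffOn ℝ 1 (P i) W)
    (hPf : derivAlong b f P =O[𝓟 W] fun x => f x ^ 2)
    (hflux : ∀ x ∈ frontier W, 0 < f x → HasNonposFluxAt b W P x) (hQ : ContinuousOn Q W)
    (hQ0 : ∀ x ∈ W, 0 ≤ Q x) (hQP : ∀ x ∈ W, Q x ≤ divergence b P x) (hx : x ∈ W) : Q x = 0 := by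
  borelize E
  by_contra hne
  obtain ⟨d, hd, hdc, hdW, hd0, hdx, hdQ⟩ :=
    exists_continuous_le hW hQ hQ0 hx ((hQ0 x hx).lt_of_ne' hne)
  obtain ⟨C, hC, hCP⟩ := hPf.exists_nonneg
  have hdP : ∀ y ∈ W, d y ≤ divergence b P y := fun y hy => (hdQ y hy).trans (hQP y hy)
  refine (hd.integral_pos_of_hasCompactSupport_nonneg_nonzero (μ := Measure.addHaar) hdc hd0
    hdx.ne').not_ge (integral_nonpos_of_local hW hWb hf hC (fun y hy => ?_) hd hdc hdW
      (fun y hy => hfW y (hdW hy)) (P := P) (b := b) fun y hy hfy => ?_)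
  · simpa using eventually_principal.1 hCP.bound y hy
  · by_cases hyW : y ∈ W
    · exact localWeakDivLE_of_mem hW hP hd hdP hyW
    · exact (hflux y (hW.frontier_eq ▸ ⟨hy, hyW⟩) hfy).localWeakDivLE hW hP hd hdP

end Localization

/-! ### Timelike domains -/

section DefiningFunctions

variable {E F : Type*} [NormedAddCommGroup E] [NormedSpace ℝ E]
  [NormedAddCommGroup F] [NormedSpace ℝ F] {S : Set E} {x : E} {φ : E → ℝ}

lemma exists_map_neg {L : E →L[ℝ] ℝ} (h : L ≠ 0) : ∃ v, L v < 0 := by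
  obtain ⟨v, hv⟩ := DFunLike.ne_iff.1 h
  rcases lt_or_gt_of_ne hv with hv | hv
  · exact ⟨v, hv⟩
  · exact ⟨-v, by rw [map_neg]; simpa using hv⟩

lemma tendsto_add_smul_nhdsGT_zero (x v : E) :
    Tendsto (fun s : ℝ => x + s • v) (𝓝[>] 0) (𝓝 x) := by
  have hc : Continuous fun s : ℝ => x + s • v := by fun_prop
  exact tendsto_nhdsWithin_of_tendsto_nhds (by simpa using hc.tendsto 0)

namespace IsDefiningFunctionAt

lemma differentiableAt (h : IsDefiningFunctionAt S x φ) : DifferentiableAt ℝ φ x :=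
  (h.1.differentiable (by simp)) x

lemma hasStrictFDerivAt (h : IsDefiningFunctionAt S x φ) :
    HasStrictFDerivAt φ (fderiv ℝ φ x) x :=
  h.1.contDiffAt.hasStrictFDerivAt (by simp)

lemma const_mul (h : IsDefiningFunctionAt S x φ) {c : ℝ} (hc : 0 < c) :
    IsDefiningFunctionAt S x fun y => c * φ y := by
  refine ⟨contDiff_const.mul h.1, by simp [h.2.1], ?_, h.2.2.2.mono fun y hy => ?_⟩
  · rw [fderiv_const_mul h.differentiableAt]
    exact smul_ne_zero hc.ne' h.2.2.1
  · exact hy.trans (smul_neg_iff_of_pos_left hc).symm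

lemma comp_snd {q : F × E} (h : IsDefiningFunctionAt S q.2 φ) {G : Set F} (hG : G ∈ 𝓝 q.1) :
    IsDefiningFunctionAt (G ×ˢ S) q fun y => φ y.2 := by
  refine ⟨h.1.comp contDiff_snd, h.2.1, ?_, ?_⟩
  · change fderiv ℝ (φ ∘ Prod.snd) q ≠ 0
    rw [(h.differentiableAt.hasFDerivAt.comp q hasFDerivAt_snd).fderiv]
    refine fun h0 => h.2.2.1 (ContinuousLinearMap.ext fun w => ?_)
    simpa using DFunLike.congr_fun h0 (0, w)
  · filter_upwards [continuousAt_fst.eventually hG,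
      (continuousAt_snd (p := q)).eventually h.2.2.2] with y hy₁ hy₂
    rw [← hy₂]
    exact ⟨fun hy => hy.2, fun hy => ⟨hy₁, hy⟩⟩

lemma eventually (h : IsDefiningFunctionAt S x φ) :
    ∀ᶠ y in 𝓝 x, φ y = 0 → IsDefiningFunctionAt S y φ := by
  have hd : ContinuousAt (fderiv ℝ φ) x := (h.1.continuous_fderiv (by simp)).continuousAt
  filter_upwards [hd.eventually_ne h.2.2.1, h.2.2.2.eventually_nhds] with y hy hS h0
    using ⟨h.1, h0, hy, hS⟩

lemma eventually_add_smul_mem (h : IsDefiningFunctionAt S x φ) {v : E}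
    (hv : fderiv ℝ φ x v < 0) : ∀ᶠ s : ℝ in 𝓝[>] 0, x + s • v ∈ S := by
  have hder : HasDerivAt (fun s : ℝ => φ (x + s • v)) (fderiv ℝ φ x v) 0 :=
    h.differentiableAt.hasFDerivAt.hasLineDerivAt v
  filter_upwards [hder.tendsto_slope_zero_right.eventually_lt_const hv,
    (tendsto_add_smul_nhdsGT_zero x v).eventually h.2.2.2, self_mem_nhdsWithin] with s hs hS hs0
  replace hs0 : 0 < s := hs0
  rw [hS]
  simp only [zero_add, zero_smul, add_zero, h.2.1, sub_zero, smul_eq_mul] at hs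
  exact neg_of_mul_neg_right hs (inv_nonneg.2 hs0.le)

lemma mem_frontier (h : IsDefiningFunctionAt S x φ) : x ∈ frontier S := by
  obtain ⟨v, hv⟩ := exists_map_neg h.2.2.1
  refine ⟨mem_closure_of_tendsto (tendsto_add_smul_nhdsGT_zero x v)
    (h.eventually_add_smul_mem hv), fun hx => ?_⟩
  exact (h.2.2.2.self_of_nhds.1 (interior_subset hx)).ne h.2.1

lemma uniqueDiffWithinAt (h : IsDefiningFunctionAt S x φ) : UniqueDiffWithinAt ℝ S x := by
  have hcone : ∀ v, fderiv ℝ φ x v < 0 → v ∈ tangentConeAt ℝ S x := fun v hv =>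
    mem_tangentConeAt_of_add_smul_mem (l := 𝓝[>] (0 : ℝ)) (tendsto_id'.2 (nhdsGT_le_nhdsNE 0))
      (h.eventually_add_smul_mem hv)
  refine ⟨?_, frontier_subset_closure h.mem_frontier⟩
  suffices hspan : Submodule.span ℝ (tangentConeAt ℝ S x) = ⊤ by
    rw [hspan]
    exact dense_univ
  refine eq_top_iff.2 fun v _ => ?_
  -- the tangent cone contains an open half space
  obtain ⟨v₀, hv₀⟩ := exists_map_neg h.2.2.1
  obtain ⟨k, hk⟩ := exists_nat_gt (fderiv ℝ φ x v / -fderiv ℝ φ x v₀)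
  rw [div_lt_iff₀ (by linarith)] at hk
  have hk' : v + (k : ℝ) • v₀ ∈ Submodule.span ℝ (tangentConeAt ℝ S x) :=
    Submodule.subset_span (hcone _ (by rw [map_add, map_smul, smul_eq_mul]; linarith))
  simpa using Submodule.sub_mem _ hk'
    (Submodule.smul_mem _ (k : ℝ) (Submodule.subset_span (hcone v₀ hv₀)))

end IsDefiningFunctionAt

end DefiningFunctions

section TimelikeDomains

variable {m n : ℕ} {T : ℝ} {U : Set (Spacetime m n)}

lemma exists_forall_eq_metric (L : Spacetime m n →L[ℝ] ℝ) : ∃ N, ∀ w, L w = metric N w := by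
  refine ⟨(WithLp.toLp 2 fun i => -L (dt i), WithLp.toLp 2 fun j => L (dx j)), fun w => ?_⟩
  rw [map_eq_sum_coord, metric_eq_sum]
  simp [Fintype.sum_sum_type, mul_comm]

lemma isOpen_timeCube (T : ℝ) : IsOpen (timeCube m T) := by
  simp only [timeCube, ofPred_forall]
  refine isOpen_iInter_of_finite fun i => ?_
  have hi := (EuclideanSpace.proj (𝕜 := ℝ) i).continuous
  exact (isOpen_lt continuous_const hi).inter (isOpen_lt hi continuous_const)

/-- Open domains over the time cube with a smooth timelike spatial boundary, that is, with
spacelike normals. These are the domains for which the uniqueness argument works; they comprise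
the static and the moving ones. -/
structure IsTimelikeDomain (T : ℝ) (U : Set (Spacetime m n)) : Prop where
  isOpen : IsOpen U
  normal : ∀ q ∈ lateralBoundary T U, ∃ N, IsNormal U q N ∧ 0 < metric N N

lemma IsMovingDomain.isTimelikeDomain (h : IsMovingDomain T U) : IsTimelikeDomain T U := by
  obtain ⟨j, Ω, -, -, hopen, hsmooth, hnormal, -⟩ := h
  refine ⟨hopen, fun q hq => ?_⟩
  obtain ⟨φ, hφ⟩ := hsmooth q hq
  obtain ⟨N, hN⟩ := exists_forall_eq_metric (fderiv ℝ φ q)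
  exact ⟨N, ⟨φ, hφ, hN⟩, hnormal q hq N ⟨φ, hφ, hN⟩⟩

lemma snd_mem_frontier_of_mem_lateralBoundary_prod {Ω : Set (EuclideanSpace ℝ (Fin n))}
    {q : Spacetime m n} (hq : q ∈ lateralBoundary T (timeCube m T ×ˢ Ω)) : q.2 ∈ frontier Ω := by
  have hf := hq.1
  rw [frontier_prod_eq] at hf
  refine hf.elim (fun h => h.2) fun h => absurd hq.2 ?_
  have := h.1
  rw [(isOpen_timeCube T).frontier_eq] at this
  exact this.2

lemma IsStaticDomain.isTimelikeDomain (h : IsStaticDomain T U) : IsTimelikeDomain T U := by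
  obtain ⟨Ω, -, hΩ, -, hsmooth, rfl⟩ := h
  refine ⟨(isOpen_timeCube T).prod hΩ, fun q hq => ?_⟩
  obtain ⟨φ, hφ⟩ := hsmooth q.2 (snd_mem_frontier_of_mem_lateralBoundary_prod hq)
  set N : EuclideanSpace ℝ (Fin n) := (InnerProductSpace.toDual ℝ _).symm (fderiv ℝ φ q.2)
  have hN0 : N ≠ 0 := by simpa [N] using hφ.2.2.1
  refine ⟨(0, N), ⟨_, hφ.comp_snd ((isOpen_timeCube T).mem_nhds hq.2), fun w => ?_⟩, ?_⟩
  · change fderiv ℝ (φ ∘ Prod.snd) q w = _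
    rw [(hφ.differentiableAt.hasFDerivAt.comp q hasFDerivAt_snd).fderiv]
    simp [metric, N]
  · simp only [metric, inner_zero_left, sub_zero]
    exact real_inner_self_pos.2 hN0

namespace IsTimelikeDomain

lemma mem_of_mem_closure (hU : IsTimelikeDomain T U) {q : Spacetime m n} (hq : q ∈ closure U)
    (ht : q.1 ∈ timeCube m T) : q ∈ U ∪ lateralBoundary T U := by
  by_cases h : q ∈ U
  · exact Or.inl h
  · exact Or.inr ⟨hU.isOpen.frontier_eq ▸ ⟨hq, h⟩, ht⟩

lemma uniqueDiffOn (hU : IsTimelikeDomain T U) : UniqueDiffOn ℝ (U ∪ lateralBoundary T U) := by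
  rintro q (hq | hq)
  · exact (hU.isOpen.uniqueDiffWithinAt hq).mono subset_union_left
  · obtain ⟨N, ⟨φ, hφ, -⟩, -⟩ := hU.normal q hq
    exact hφ.uniqueDiffWithinAt.mono subset_union_left

end IsTimelikeDomain

lemma union_lateralBoundary_subset_closure : U ∪ lateralBoundary T U ⊆ closure U :=
  union_subset subset_closure fun _ h => frontier_subset_closure h.1

lemma IsDefiningFunctionAt.eventually_mem_lateralBoundary {q : Spacetime m n}
    {φ : Spacetime m n → ℝ} (hφ : IsDefiningFunctionAt U q φ) (hq : q ∈ lateralBoundary T U) :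
    ∀ᶠ y in 𝓝 q, φ y = 0 → y ∈ lateralBoundary T U := by
  filter_upwards [hφ.eventually,
    continuousAt_fst.eventually ((isOpen_timeCube T).mem_nhds hq.2)] with y hy hyt h0
  exact ⟨(hy h0).mem_frontier, hyt⟩

end TimelikeDomains

section Region

variable {m n : ℕ} {T R : ℝ} {U : Set (Spacetime m n)} {p q : Spacetime m n}

lemma rFun_nonneg (p q : Spacetime m n) : 0 ≤ rFun p q := norm_nonneg _

lemma isOpen_nullExterior (p : Spacetime m n) : IsOpen (nullExterior p) :=
  isOpen_lt continuous_const (continuous_fFun p)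

lemma fFun_nonneg_of_mem_closure (hq : q ∈ closure (U ∩ nullExterior p)) : 0 ≤ fFun p q :=
  closure_minimal (fun _ hy => le_of_lt hy.2) (isClosed_le continuous_const (continuous_fFun p)) hq

lemma rFun_le_of_mem_closure (hR : ∀ q ∈ U ∩ nullExterior p, rFun p q ≤ R)
    (hq : q ∈ closure (U ∩ nullExterior p)) : rFun p q ≤ R :=
  closure_minimal hR (isClosed_le (continuous_rFun p) continuous_const) hq

lemma norm_time_sub_le_rFun (h : 0 ≤ fFun p q) : ‖q.1 - p.1‖ ≤ rFun p q :=
  le_of_sq_le_sq (by linarith [four_fFun p q]) (rFun_nonneg p q)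

lemma isBounded_region (hR : ∀ q ∈ U ∩ nullExterior p, rFun p q ≤ R) :
    Bornology.IsBounded (U ∩ nullExterior p) := by
  refine (Metric.isBounded_closedBall (x := p) (r := R)).subset fun q hq => ?_
  rw [mem_closedBall_iff_norm]
  exact max_le ((norm_time_sub_le_rFun (le_of_lt hq.2)).trans (hR q hq)) (hR q hq)

lemma IsTimelikeDomain.closure_region_subset (hU : IsTimelikeDomain T U)
    (hR : ∀ q ∈ U ∩ nullExterior p, rFun p q ≤ R) (hT : ∀ i, R + |p.1 i| < T) :
    closure (U ∩ nullExterior p) ⊆ U ∪ lateralBoundary T U := by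
  intro q hq
  refine hU.mem_of_mem_closure (closure_mono inter_subset_left hq) fun i => ?_
  have hi : |q.1 i - p.1 i| ≤ R := (PiLp.norm_apply_le (q.1 - p.1) i).trans
    ((norm_time_sub_le_rFun (fFun_nonneg_of_mem_closure hq)).trans (rFun_le_of_mem_closure hR hq))
  have hRp := hT i
  rw [abs_le] at hi
  constructor <;> linarith [neg_abs_le (p.1 i), le_abs_self (p.1 i)]

end Region

section Velocity

variable {m n : ℕ} {T : ℝ} {U : Set (Spacetime m n)} {p q N : Spacetime m n}
  {ν : EuclideanSpace ℝ (Fin n)}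

lemma norm_prodMk_norm_smul (hν : ‖ν‖ ≤ 1) (t : EuclideanSpace ℝ (Fin m)) :
    ‖((t, ‖t‖ • ν) : Spacetime m n)‖ = ‖t‖ := by
  rw [Prod.norm_mk, norm_smul, norm_norm]
  exact max_eq_left (mul_le_of_le_one_right (norm_nonneg t) hν)

lemma smul_prodMk_norm_smul {s : ℝ} (hs : 0 ≤ s) (t : EuclideanSpace ℝ (Fin m)) :
    s • ((t, ‖t‖ • ν) : Spacetime m n) = (s • t, ‖s • t‖ • ν) := by
  rw [Prod.smul_mk, norm_smul, Real.norm_of_nonneg hs, smul_smul]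

lemma exists_metric_le (hN : 0 < metric N N) :
    ∃ ν : EuclideanSpace ℝ (Fin n), ‖ν‖ < 1 ∧ ∃ c > 0, ∀ t : EuclideanSpace ℝ (Fin m),
      metric N (t, ‖t‖ • ν) ≤ -(c * ‖t‖) := by
  have hlt : ‖N.1‖ < ‖N.2‖ := by
    simp only [metric, real_inner_self_eq_norm_sq, sub_pos] at hN
    exact lt_of_pow_lt_pow_left₀ 2 (norm_nonneg _) hN
  have hN2 : 0 < ‖N.2‖ := (norm_nonneg _).trans_lt hlt
  set l : ℝ := (‖N.1‖ / ‖N.2‖ + 1) / 2 with hl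
  have hl1 : l < 1 := by linarith [(div_lt_one hN2).2 hlt]
  have hlN : l * ‖N.2‖ = (‖N.1‖ + ‖N.2‖) / 2 := by rw [hl]; field_simp
  refine ⟨-(l / ‖N.2‖) • N.2, ?_, (‖N.2‖ - ‖N.1‖) / 2, by linarith, fun t => ?_⟩
  · rwa [norm_smul, norm_neg, Real.norm_of_nonneg (by positivity), div_mul_cancel₀ _ hN2.ne']
  · have hin : inner ℝ N.2 (‖t‖ • -(l / ‖N.2‖) • N.2) = -(l * ‖N.2‖) * ‖t‖ := by
      rw [inner_smul_right, inner_smul_right, real_inner_self_eq_norm_sq]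
      field_simp
    rw [metric, hin, hlN]
    linarith [neg_le_of_abs_le (abs_real_inner_le_norm N.1 t)]

lemma IsNormal.exists_velocity (h : IsNormal U q N) (hN : 0 < metric N N) :
    ∃ ν : EuclideanSpace ℝ (Fin n), ‖ν‖ < 1 ∧ ∀ᶠ y in 𝓝 q ×ˢ 𝓝 q, y.1 ∈ U →
      ∀ t, y.2 = y.1 + (t, ‖t‖ • ν) → y.2 ∈ U := by
  obtain ⟨φ, hφ, hφN⟩ := h
  obtain ⟨ν, hν, c, hc, hνc⟩ := exists_metric_le hN
  have hstrict := hφ.hasStrictFDerivAt.isLittleO.def hc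
  rw [nhds_prod_eq] at hstrict
  refine ⟨ν, hν, ?_⟩
  filter_upwards [eventually_swap_iff.1 hstrict, hφ.2.2.2.prod_mk hφ.2.2.2]
    with y hy hyU hy1 t ht
  rw [hyU.2]
  refine lt_of_le_of_lt ?_ (hyU.1.1 hy1)
  have hφt := (abs_le.1 hy).2
  simp only [Prod.fst_swap, Prod.snd_swap] at hφt
  rw [show y.2 - y.1 = (t, ‖t‖ • ν) by rw [ht, add_sub_cancel_left],
    norm_prodMk_norm_smul hν.le, hφN] at hφt
  linarith [hνc t]

namespace IsTimelikeDomain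

lemma exists_velocity (hU : IsTimelikeDomain T U) (hq : q ∈ U ∪ lateralBoundary T U) :
    ∃ ν : EuclideanSpace ℝ (Fin n), ‖ν‖ < 1 ∧ ∀ᶠ y in 𝓝 q ×ˢ 𝓝 q, y.1 ∈ U →
      ∀ t, y.2 = y.1 + (t, ‖t‖ • ν) → y.2 ∈ U := by
  rcases hq with hq | hq
  · exact ⟨0, by simp, (tendsto_snd.eventually (hU.isOpen.mem_nhds hq)).mono
      fun y hy _ _ _ => hy⟩
  · obtain ⟨N, hN, hNN⟩ := hU.normal q hq
    exact hN.exists_velocity hNN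

lemma exists_velocity_norm_sub_le {F : Type*} [NormedAddCommGroup F] [NormedSpace ℝ F]
    {X : Spacetime m n → F} (hU : IsTimelikeDomain T U) (hq : q ∈ U ∪ lateralBoundary T U)
    (hX : ContDiffOn ℝ 1 X (U ∪ lateralBoundary T U)) :
    ∃ ν : EuclideanSpace ℝ (Fin n), ‖ν‖ < 1 ∧ ∃ M, ∀ᶠ y in 𝓝 q ×ˢ 𝓝 q, y.1 ∈ U →
      ∀ t, y.2 = y.1 + (t, ‖t‖ • ν) → y.2 ∈ U ∧ ‖X y.2 - X y.1‖ ≤ M * ‖t‖ := by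
  set S := U ∪ lateralBoundary T U
  obtain ⟨ν, hν, hstay⟩ := hU.exists_velocity hq
  have hbound : ∀ᶠ y in 𝓝[S] q, ‖fderivWithin ℝ X S y‖ < ‖fderivWithin ℝ X S q‖ + 1 :=
    (hX.continuousOn_fderivWithin hU.uniqueDiffOn le_rfl q hq).norm.eventually_lt_const
      (lt_add_one _)
  rw [eventually_nhdsWithin_iff] at hbound
  obtain ⟨δ, hδ, hball⟩ := (Metric.nhds_basis_ball.prod_self.eventually_iff).1
    (hstay.and (hbound.prod_inr _))
  refine ⟨ν, hν, ‖fderivWithin ℝ X S q‖ + 1, Metric.nhds_basis_ball.prod_self.eventually_iff.2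
    ⟨δ, hδ, fun y hy hyU t ht => ?_⟩⟩
  have hseg : ∀ x ∈ segment ℝ y.1 y.2, x ∈ U ∩ Metric.ball q δ := by
    intro x hx
    have hxb : x ∈ Metric.ball q δ := (convex_ball q δ).segment_subset hy.1 hy.2 hx
    rw [segment_eq_image'] at hx
    obtain ⟨s, hs, rfl⟩ := hx
    refine ⟨(hball (x := (y.1, y.1 + s • (y.2 - y.1))) ⟨hy.1, hxb⟩).1 hyU (s • t) ?_, hxb⟩
    rw [← smul_prodMk_norm_smul hs.1, ht, add_sub_cancel_left]
  have hmv := (convex_segment y.1 y.2).norm_image_sub_le_of_norm_hasFDerivWithin_le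
    (fun x hx => ((hX x (Or.inl (hseg x hx).1)).differentiableWithinAt
      one_ne_zero).hasFDerivWithinAt.mono fun z hz => Or.inl (hseg z hz).1)
    (fun x hx => ((hball (x := (x, x)) ⟨(hseg x hx).2, (hseg x hx).2⟩).2
      (Or.inl (hseg x hx).1)).le) (left_mem_segment ℝ _ _) (right_mem_segment ℝ _ _)
  refine ⟨(hseg y.2 (right_mem_segment ℝ _ _)).1, ?_⟩
  rwa [show y.2 - y.1 = (t, ‖t‖ • ν) by rw [ht, add_sub_cancel_left],
    norm_prodMk_norm_smul hν.le] at hmv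

end IsTimelikeDomain

lemma exists_unit_norm_add (hm : 0 < m) (t : EuclideanSpace ℝ (Fin m)) :
    ∃ τ : EuclideanSpace ℝ (Fin m), ‖τ‖ = 1 ∧ ∀ s : ℝ, 0 ≤ s → ‖t + s • τ‖ = ‖t‖ + s := by
  have : Nonempty (Fin m) := ⟨⟨0, hm⟩⟩
  obtain ⟨τ, hτ, hτt⟩ : ∃ τ : EuclideanSpace ℝ (Fin m), ‖τ‖ = 1 ∧ SameRay ℝ t τ := by
    by_cases ht : t = 0
    · obtain ⟨τ, hτ⟩ := exists_norm_eq (EuclideanSpace ℝ (Fin m)) zero_le_one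
      exact ⟨τ, hτ, ht ▸ SameRay.zero_left τ⟩
    · exact ⟨‖t‖⁻¹ • t, norm_smul_inv_norm ht,
        SameRay.sameRay_nonneg_smul_right t (by positivity)⟩
  refine ⟨τ, hτ, fun s hs => ?_⟩
  rw [(hτt.nonneg_smul_right hs).norm_add, norm_smul, hτ, mul_one, Real.norm_of_nonneg hs]

lemma exists_fFun_add_eq_zero (hm : 0 < m) (hν : ‖ν‖ < 1) (hf : 0 ≤ fFun p q) :
    ∃ t, fFun p (q + (t, ‖t‖ • ν)) = 0 ∧ ‖t‖ * (1 - ‖ν‖) ≤ rFun p q - ‖q.1 - p.1‖ := by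
  have hν' : 0 < 1 - ‖ν‖ := by linarith
  obtain ⟨τ, hτ, hadd⟩ := exists_unit_norm_add hm (q.1 - p.1)
  set s₀ := (rFun p q - ‖q.1 - p.1‖) / (1 - ‖ν‖)
  have hs₀0 : 0 ≤ s₀ := div_nonneg (sub_nonneg.2 (norm_time_sub_le_rFun hf)) hν'.le
  have hs₀ν : s₀ * (1 - ‖ν‖) = rFun p q - ‖q.1 - p.1‖ := div_mul_cancel₀ _ hν'.ne'
  have hend : fFun p (q + s₀ • (τ, ν)) ≤ 0 := by
    have hspace : rFun p (q + s₀ • (τ, ν)) ≤ rFun p q + s₀ * ‖ν‖ := by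
      have := norm_add_le (q.2 - p.2) (s₀ • ν)
      rwa [norm_smul, Real.norm_of_nonneg hs₀0, sub_add_eq_add_sub] at this
    have htime : ‖(q + s₀ • ((τ, ν) : Spacetime m n)).1 - p.1‖ = ‖q.1 - p.1‖ + s₀ := by
      rw [← hadd s₀ hs₀0, sub_add_eq_add_sub]
      rfl
    have := pow_le_pow_left₀ (rFun_nonneg _ _)
      (hspace.trans (by linarith : _ ≤ ‖q.1 - p.1‖ + s₀)) 2
    have := four_fFun p (q + s₀ • (τ, ν))
    rw [htime] at this
    linarith
  have hcont : Continuous fun s : ℝ => fFun p (q + s • (τ, ν)) :=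
    (continuous_fFun p).comp (by fun_prop)
  obtain ⟨s, hs, hfs⟩ := intermediate_value_Icc' hs₀0 hcont.continuousOn
    (show (0 : ℝ) ∈ _ from ⟨hend, by simpa using hf⟩)
  have hnorm : ‖s • τ‖ = s := by rw [norm_smul, hτ, mul_one, Real.norm_of_nonneg hs.1]
  refine ⟨s • τ, by rwa [hnorm, ← Prod.smul_mk], ?_⟩
  rw [hnorm, ← hs₀ν]
  exact mul_le_mul_of_nonneg_right hs.2 hν'.le

end Velocity

section NullConeGrowth

variable {m n : ℕ} {T : ℝ} {U : Set (Spacetime m n)} {p q : Spacetime m n}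
  {F : Type*} [NormedAddCommGroup F] [NormedSpace ℝ F] {X : Spacetime m n → F}

namespace IsTimelikeDomain

/- From a point near the cone one reaches the cone inside `U` along a timelike segment of length
comparable to `r_p - |t - t(p)|`, whose square is at most `4 f_p`. -/
lemma isBigO_fFun_of_fFun_eq_zero (hm : 0 < m) (hU : IsTimelikeDomain T U)
    (hq : q ∈ U ∪ lateralBoundary T U) (hX : ContDiffOn ℝ 1 X (U ∪ lateralBoundary T U))
    (hX0 : ∀ q ∈ U, fFun p q = 0 → X q = 0) (hf : fFun p q = 0) :
    (fun a => ‖X a‖ ^ 2) =O[𝓝[U ∩ nullExterior p] q] fFun p := by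
  obtain ⟨ν, hν, M, hM⟩ := hU.exists_velocity_norm_sub_le hq hX
  obtain ⟨δ, hδ, hball⟩ := Metric.nhds_basis_ball.prod_self.eventually_iff.1 hM
  have hν' : 0 < 1 - ‖ν‖ := by linarith
  have hclose : ∀ᶠ a : Spacetime m n in 𝓝 q, rFun p a - ‖a.1 - p.1‖ < δ / 2 * (1 - ‖ν‖) := by
    have hc : Continuous fun a : Spacetime m n => rFun p a - ‖a.1 - p.1‖ :=
      (continuous_rFun p).sub (by fun_prop)
    refine (hc.tendsto q).eventually_lt_const ?_
    have hnorm := four_fFun p q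
    rw [hf, mul_zero, eq_comm, sub_eq_zero, sq_eq_sq₀ (rFun_nonneg p q) (norm_nonneg _)] at hnorm
    rw [hnorm, sub_self]
    positivity
  refine IsBigO.of_bound (4 * M ^ 2 / (1 - ‖ν‖) ^ 2) ?_
  filter_upwards [nhdsWithin_le_nhds hclose, self_mem_nhdsWithin,
    nhdsWithin_le_nhds (Metric.ball_mem_nhds q (half_pos hδ))] with a ha ⟨haU, haf⟩ hab
  obtain ⟨t, ht, htν⟩ := exists_fFun_add_eq_zero hm hν (le_of_lt haf)
  have htδ : ‖t‖ < δ / 2 := lt_of_mul_lt_mul_right (htν.trans_lt ha) hν'.le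
  have hend : a + (t, ‖t‖ • ν) ∈ Metric.ball q δ := by
    rw [Metric.mem_ball, dist_eq_norm, add_sub_right_comm] at *
    have := norm_add_le (a - q) (t, ‖t‖ • ν)
    rw [norm_prodMk_norm_smul hν.le] at this
    linarith
  obtain ⟨hendU, hXt⟩ := hball (x := (a, a + (t, ‖t‖ • ν)))
    ⟨Metric.ball_subset_ball (half_le_self hδ.le) hab, hend⟩ haU t rfl
  rw [hX0 _ hendU ht, zero_sub, norm_neg] at hXt
  have hXt2 : ‖X a‖ ^ 2 ≤ M ^ 2 * ‖t‖ ^ 2 := by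
    rw [← mul_pow]
    exact pow_le_pow_left₀ (norm_nonneg _) hXt 2
  have htf : (‖t‖ * (1 - ‖ν‖)) ^ 2 ≤ 4 * fFun p a := by
    refine (pow_le_pow_left₀ (by positivity) htν 2).trans ?_
    rw [four_fFun]
    nlinarith [norm_nonneg (a.1 - p.1), norm_time_sub_le_rFun (le_of_lt haf)]
  rw [Real.norm_of_nonneg (sq_nonneg _), Real.norm_of_nonneg (le_of_lt haf), div_mul_eq_mul_div,
    le_div_iff₀ (by positivity)]
  calc ‖X a‖ ^ 2 * (1 - ‖ν‖) ^ 2 ≤ M ^ 2 * ‖t‖ ^ 2 * (1 - ‖ν‖) ^ 2 := by gcongr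
    _ = M ^ 2 * (‖t‖ * (1 - ‖ν‖)) ^ 2 := by ring
    _ ≤ M ^ 2 * (4 * fFun p a) := by gcongr
    _ = 4 * M ^ 2 * fFun p a := by ring

lemma isBigO_fFun_nhdsWithin (hm : 0 < m) (hU : IsTimelikeDomain T U)
    (hq : q ∈ U ∪ lateralBoundary T U) (hX : ContDiffOn ℝ 1 X (U ∪ lateralBoundary T U))
    (hX0 : ∀ q ∈ U, fFun p q = 0 → X q = 0) :
    (fun a => ‖X a‖ ^ 2) =O[𝓝[U ∩ nullExterior p] q] fFun p := by
  by_cases hf : fFun p q = 0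
  · exact hU.isBigO_fFun_of_fFun_eq_zero hm hq hX hX0 hf
  have hXc : ContinuousWithinAt X (U ∩ nullExterior p) q :=
    (hX.continuousOn q hq).mono (inter_subset_left.trans subset_union_left)
  refine isBigO_of_div_tendsto_nhds (eventually_mem_nhdsWithin.mono fun a ha h => ?_) _
    ((hXc.norm.pow 2).div (continuous_fFun p).continuousWithinAt hf)
  exact absurd h (ne_of_gt ha.2)

end IsTimelikeDomain

lemma isBigO_principal_of_forall_nhdsWithin {E : Type*} [TopologicalSpace E]
    {u v : E → ℝ} {K W : Set E} (hK : IsCompact K) (hWK : W ⊆ K)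
    (h : ∀ q ∈ K, u =O[𝓝[W] q] v) : u =O[𝓟 W] v := by
  suffices hKW : u =O[𝓟 (K ∩ W)] v by rwa [inter_eq_right.2 hWK] at hKW
  refine hK.induction_on (p := fun s => u =O[𝓟 (s ∩ W)] v) ?_ ?_ ?_ ?_
  · simp
  · exact fun s t hst ht => ht.mono (principal_mono.2 (inter_subset_inter_left W hst))
  · intro s t hs ht
    rw [union_inter_distrib_right, ← sup_principal]
    exact hs.sup ht
  · intro q hq
    obtain ⟨c, hc⟩ := (h q hq).bound
    refine ⟨_, nhdsWithin_le_nhds (eventually_nhdsWithin_iff.1 hc), ?_⟩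
    exact isBigO_principal.2 ⟨c, fun x hx => hx.1 hx.2⟩

lemma sum_coord_sq_le (v : Spacetime m n) : ∑ i, coord v i ^ 2 ≤ 2 * ‖v‖ ^ 2 := by
  have hv : ∑ i, coord v i ^ 2 = ‖v.1‖ ^ 2 + ‖v.2‖ ^ 2 := by
    rw [EuclideanSpace.real_norm_sq_eq, EuclideanSpace.real_norm_sq_eq, Fintype.sum_sum_type]
    rfl
  rw [hv]
  linarith [pow_le_pow_left₀ (norm_nonneg _) (norm_fst_le v) 2,
    pow_le_pow_left₀ (norm_nonneg _) (norm_snd_le v) 2]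

lemma IsTimelikeDomain.exists_sum_coord_sq_le (hm : 0 < m) (hU : IsTimelikeDomain T U)
    {X : Spacetime m n → Spacetime m n} (hK : IsCompact (closure (U ∩ nullExterior p)))
    (hKU : closure (U ∩ nullExterior p) ⊆ U ∪ lateralBoundary T U)
    (hX : ContDiffOn ℝ 1 X (U ∪ lateralBoundary T U)) (hX0 : ∀ q ∈ U, fFun p q = 0 → X q = 0) :
    ∃ C, 0 ≤ C ∧ ∀ q ∈ U ∩ nullExterior p, ∑ i, coord (X q) i ^ 2 ≤ C * fFun p q := by
  obtain ⟨C, hC0, hC⟩ := (isBigO_principal_of_forall_nhdsWithin hK subset_closure fun q hq =>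
    hU.isBigO_fFun_nhdsWithin hm (hKU hq) hX hX0).exists_nonneg
  rw [isBigOWith_principal] at hC
  refine ⟨2 * C, by positivity, fun q hq => (sum_coord_sq_le (X q)).trans ?_⟩
  have hCq := hC q hq
  rw [Real.norm_of_nonneg (sq_nonneg _), Real.norm_of_nonneg (le_of_lt hq.2)] at hCq
  linarith

end NullConeGrowth

/-! ### The flux of the Carleman current -/

section BoundedFunctions

variable {α : Type*} {l : Filter α} {u v g : α → ℝ}

lemma isBigO_mul_of_boundedAtFilter (hu : BoundedAtFilter l u) (hv : v =O[l] g) :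
    (fun x => u x * v x) =O[l] g := by
  simpa only [Pi.one_apply, one_mul] using IsBigO.mul hu hv

lemma boundedAtFilter_const_mul (c : ℝ) (hu : BoundedAtFilter l u) :
    BoundedAtFilter l fun x => c * u x := hu.smul c

lemma boundedAtFilter_principal {W : Set α} {C : ℝ} (h : ∀ x ∈ W, |u x| ≤ C) :
    BoundedAtFilter (𝓟 W) u :=
  isBigO_principal.2 ⟨C, fun x hx => by simpa using h x hx⟩

lemma boundedAtFilter_of_isBigO_pow {f : α → ℝ} (hf : BoundedAtFilter l f) {k : ℕ}
    (hu : u =O[l] fun x => f x ^ k) : BoundedAtFilter l u :=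
  hu.trans (by simpa [Pi.one_def] using hf.pow k)

variable {m n : ℕ} {f γ A w : α → ℝ} {Y γ' ζ : Fin m ⊕ Fin n → α → ℝ}

lemma isBigO_current (hf : BoundedAtFilter l f) (hY : ∀ j, BoundedAtFilter l (Y j))
    (hγ : BoundedAtFilter l γ) (hγ' : ∀ j, BoundedAtFilter l (γ' j))
    (hA : BoundedAtFilter l fun x => f x * A x) (hw : w =O[l] fun x => f x ^ 2)
    (hζ : ∀ j, ζ j =O[l] fun x => f x ^ 2) (i : Fin m ⊕ Fin n) :
    (fun x => current (fun j => Y j x) (γ x) (fun j => γ' j x) (A x) (w x) (fun j => ζ j x) i)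
      =O[l] fun x => f x ^ 2 := by
  have hwb := boundedAtFilter_of_isBigO_pow hf hw
  have hζb := fun j => boundedAtFilter_of_isBigO_pow hf (hζ j)
  have hYζ : BoundedAtFilter l fun x => ∑ j, Y j x * ζ j x :=
    IsBigO.fun_sum fun j _ => (hY j).mul (hζb j)
  have hζζ : (fun x => ∑ j, gSign j * (ζ j x * ζ j x)) =O[l] fun x => f x ^ 2 :=
    IsBigO.fun_sum fun j _ => (isBigO_mul_of_boundedAtFilter (hζb j) (hζ j)).const_mul_left _
  have hAw : (fun x => A x * (w x * w x)) =O[l] fun x => f x ^ 2 := by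
    have hfA : (fun x => f x * A x * f x * f x ^ 2) =O[l] fun x => f x ^ 2 :=
      isBigO_mul_of_boundedAtFilter (hA.mul hf) (isBigO_refl _ _)
    refine ((isBigO_refl A l).mul (hw.mul hw)).trans (hfA.congr_left fun x => ?_)
    ring
  have hmain := ((isBigO_mul_of_boundedAtFilter hYζ (hζ i)).const_mul_left (gSign i)).sub
    ((isBigO_mul_of_boundedAtFilter (hY i) hζζ).const_mul_left (1 / 2))
  have hzeroth := ((isBigO_mul_of_boundedAtFilter (hγ.mul hwb) (hζ i)).const_mul_left
    (1 / 2)).sub ((isBigO_mul_of_boundedAtFilter (hwb.mul (hγ' i)) hw).const_mul_left (1 / 4))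
  have hpot := (isBigO_mul_of_boundedAtFilter (hY i) hAw).const_mul_left (1 / 2)
  refine ((hmain.add (hzeroth.const_mul_left (gSign i))).add hpot).congr_left fun x => ?_
  simp only [current, Pi.mul_apply]
  ring

end BoundedFunctions

section BoundedCoefficients

variable {m n : ℕ} {p q : Spacetime m n} {ε R : ℝ} {W : Set (Spacetime m n)}

lemma abs_coord_le_rFun (hf : 0 ≤ fFun p q) (i : Fin m ⊕ Fin n) :
    |coord (q - p) i| ≤ rFun p q := by
  rcases i with i | i
  · have : |(q.1 - p.1) i| ≤ ‖q.1 - p.1‖ := by simpa using PiLp.norm_apply_le (q.1 - p.1) i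
    exact this.trans (norm_time_sub_le_rFun hf)
  · exact (by simpa using PiLp.norm_apply_le (q.2 - p.2) i : |(q.2 - p.2) i| ≤ ‖q.2 - p.2‖)

lemma hasPartials_zerothCoeff (h : 0 < rFun p q) : HasPartials (zerothCoeff p ε) (fun i =>
    ((m : ℝ) + n - 2) / 2 * -(ε * (spaceInd i * (coord (q - p) i * (rFun p q)⁻¹)))
      + ((n : ℝ) - 2) * (ε * (gSign i * coord (q - p) i / 2 * (rFun p q)⁻¹
        + fFun p q * -(spaceInd i * (coord (q - p) i * (rFun p q)⁻¹ ^ 3))))) q :=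
  ((hasPartials_damping h).const_mul _).add ((hasPartials_radialCoeff h).const_mul _)

/-- A set in the exterior of the null cone at `p` on which `r_p` is so small compared to `1 / ε`
that the weight and the multiplier are under control. -/
structure IsAdmissible (p : Spacetime m n) (ε R : ℝ) (W : Set (Spacetime m n)) : Prop where
  nonneg : 0 ≤ ε
  fFun_pos : ∀ q ∈ W, 0 < fFun p q
  rFun_le : ∀ q ∈ W, rFun p q ≤ R
  mul_le_half : ε * R ≤ 1 / 2

namespace IsAdmissible

lemma mul_rFun_le_half (hW : IsAdmissible p ε R W) (hq : q ∈ W) : ε * rFun p q ≤ 1 / 2 :=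
  (mul_le_mul_of_nonneg_left (hW.rFun_le q hq) hW.nonneg).trans hW.mul_le_half

lemma damping_pos (hW : IsAdmissible p ε R W) (hq : q ∈ W) : 0 < damping p ε q := by
  linarith [half_le_damping (hW.mul_rFun_le_half hq)]

lemma boundedAtFilter_rFun (hW : IsAdmissible p ε R W) : BoundedAtFilter (𝓟 W) (rFun p) :=
  boundedAtFilter_principal fun q hq =>
    (abs_of_nonneg (rFun_nonneg p q)).trans_le (hW.rFun_le q hq)

lemma boundedAtFilter_damping (hW : IsAdmissible p ε R W) :
    BoundedAtFilter (𝓟 W) (damping p ε) :=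
  boundedAtFilter_principal fun q hq =>
    (abs_of_pos (hW.damping_pos hq)).trans_le (damping_le_one hW.nonneg p q)

lemma boundedAtFilter_inv_damping (hW : IsAdmissible p ε R W) :
    BoundedAtFilter (𝓟 W) fun q => (damping p ε q)⁻¹ :=
  boundedAtFilter_principal fun q hq => by
    rw [abs_of_pos (inv_pos.2 (hW.damping_pos hq))]
    exact inv_anti₀ (by norm_num) (half_le_damping (hW.mul_rFun_le_half hq))

lemma boundedAtFilter_coord_sub (hW : IsAdmissible p ε R W) (i : Fin m ⊕ Fin n) :
    BoundedAtFilter (𝓟 W) fun q => coord (q - p) i :=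
  boundedAtFilter_principal fun q hq =>
    (abs_coord_le_rFun (hW.fFun_pos q hq).le i).trans (hW.rFun_le q hq)

lemma boundedAtFilter_coord_sub_mul_inv_rFun (hW : IsAdmissible p ε R W) (i : Fin m ⊕ Fin n) :
    BoundedAtFilter (𝓟 W) fun q => coord (q - p) i * (rFun p q)⁻¹ :=
  boundedAtFilter_principal fun q hq => by
    have hr := rFun_pos (hW.fFun_pos q hq)
    rw [abs_mul, abs_inv, abs_of_pos hr, ← div_eq_mul_inv, div_le_one hr]
    exact abs_coord_le_rFun (hW.fFun_pos q hq).le i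

lemma boundedAtFilter_fFun_mul_inv_rFun_sq (hW : IsAdmissible p ε R W) :
    BoundedAtFilter (𝓟 W) fun q => fFun p q * (rFun p q)⁻¹ ^ 2 :=
  boundedAtFilter_principal fun q hq => by
    have hf := hW.fFun_pos q hq
    have hr := rFun_pos hf
    rw [abs_of_pos (by positivity), inv_pow, ← div_eq_mul_inv, div_le_one (by positivity)]
    linarith [four_fFun_le p q]

lemma boundedAtFilter_fFun_mul_inv_rFun (hW : IsAdmissible p ε R W) :
    BoundedAtFilter (𝓟 W) fun q => fFun p q * (rFun p q)⁻¹ :=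
  (hW.boundedAtFilter_fFun_mul_inv_rFun_sq.mul hW.boundedAtFilter_rFun).congr'
    (eventually_principal.2 fun q hq => by
      have := rFun_pos (hW.fFun_pos q hq)
      simp only [Pi.mul_apply]
      field_simp) EventuallyEq.rfl

lemma boundedAtFilter_fFun (hW : IsAdmissible p ε R W) : BoundedAtFilter (𝓟 W) (fFun p) :=
  (hW.boundedAtFilter_fFun_mul_inv_rFun.mul hW.boundedAtFilter_rFun).congr'
    (eventually_principal.2 fun q hq => by
      have := rFun_pos (hW.fFun_pos q hq)
      simp only [Pi.mul_apply]
      field_simp) EventuallyEq.rfl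

lemma boundedAtFilter_radialCoeff (hW : IsAdmissible p ε R W) :
    BoundedAtFilter (𝓟 W) (radialCoeff p ε) :=
  boundedAtFilter_const_mul ε hW.boundedAtFilter_fFun_mul_inv_rFun

lemma boundedAtFilter_multiplier (hW : IsAdmissible p ε R W) (i : Fin m ⊕ Fin n) :
    BoundedAtFilter (𝓟 W) (multiplier p ε i) :=
  ((boundedAtFilter_const_mul _ hW.boundedAtFilter_damping).add
    (boundedAtFilter_const_mul _ hW.boundedAtFilter_radialCoeff)).mul
      (hW.boundedAtFilter_coord_sub i)

lemma boundedAtFilter_zerothCoeff (hW : IsAdmissible p ε R W) :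
    BoundedAtFilter (𝓟 W) (zerothCoeff p ε) :=
  (boundedAtFilter_const_mul _ hW.boundedAtFilter_damping).add
    (boundedAtFilter_const_mul _ hW.boundedAtFilter_radialCoeff)

lemma boundedAtFilter_pderiv_zerothCoeff (hW : IsAdmissible p ε R W) (i : Fin m ⊕ Fin n) :
    BoundedAtFilter (𝓟 W) (pderiv i (zerothCoeff p ε)) := by
  have hcr := hW.boundedAtFilter_coord_sub_mul_inv_rFun i
  have hfr := hW.boundedAtFilter_fFun_mul_inv_rFun_sq.mul hcr
  refine ((boundedAtFilter_const_mul
    (-(((m : ℝ) + n - 2) / 2 * ε * spaceInd i) + ((n : ℝ) - 2) * ε * gSign i / 2) hcr).add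
      (boundedAtFilter_const_mul (-(((n : ℝ) - 2) * ε * spaceInd i)) hfr)).congr'
        (eventually_principal.2 fun q hq => ?_) EventuallyEq.rfl
  rw [(hasPartials_zerothCoeff (rFun_pos (hW.fFun_pos q hq))).2]
  simp only [Pi.add_apply, Pi.mul_apply]
  ring

lemma boundedAtFilter_fFun_mul_potential (hW : IsAdmissible p ε R W) (a : ℝ) :
    BoundedAtFilter (𝓟 W) fun q => fFun p q * potential p ε a q := by
  have he := hW.boundedAtFilter_inv_damping
  refine ((boundedAtFilter_const_mul (a ^ 2) he).add
    ((boundedAtFilter_const_mul ((a ^ 2 - a) * ε ^ 2) (hW.boundedAtFilter_fFun.mul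
      (he.mul he))).add (boundedAtFilter_const_mul (-(a * ε))
        (hW.boundedAtFilter_fFun_mul_inv_rFun.mul he)))).congr'
          (eventually_principal.2 fun q hq => ?_) EventuallyEq.rfl
  have := (hW.fFun_pos q hq).ne'
  simp only [Pi.add_apply, Pi.mul_apply, potential, mul_inv]
  field_simp
  ring

lemma isBigO_weight_pow (hW : IsAdmissible p ε R W) {a k : ℕ} (hk : k ≤ a) :
    (fun q => weight p ε q ^ a) =O[𝓟 W] fun q => fFun p q ^ k := by
  obtain ⟨b, rfl⟩ := Nat.exists_eq_add_of_le hk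
  refine (isBigO_mul_of_boundedAtFilter
    ((boundedAtFilter_of_isBigO_pow hW.boundedAtFilter_fFun (isBigO_refl _ _)).mul
      (boundedAtFilter_of_isBigO_pow hW.boundedAtFilter_inv_damping (isBigO_refl _ _)))
    (isBigO_refl (fun q => fFun p q ^ k) _)
    (u := (fun q => fFun p q ^ b) * fun q => (damping p ε q)⁻¹ ^ (k + b))).congr_left fun q => ?_
  simp only [Pi.mul_apply, weight]
  ring

lemma isBigO_weightPowDeriv (hW : IsAdmissible p ε R W) {a : ℕ} (ha : 3 ≤ a)
    (i : Fin m ⊕ Fin n) : weightPowDeriv p ε a i =O[𝓟 W] fun q => fFun p q ^ 2 := by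
  obtain ⟨b, rfl⟩ := Nat.exists_eq_add_of_le' (show 1 ≤ a by lia)
  have he := hW.boundedAtFilter_inv_damping
  refine (isBigO_mul_of_boundedAtFilter (boundedAtFilter_const_mul (gSign i * (b + 1 : ℕ))
    ((he.mul he).mul (hW.boundedAtFilter_multiplier i)))
      (hW.isBigO_weight_pow (show 2 ≤ b by lia))).congr'
        (eventually_principal.2 fun q hq => ?_) EventuallyEq.rfl
  have := (hW.fFun_pos q hq).ne'
  simp only [Pi.mul_apply, weightPowDeriv, weightRate, mul_inv, pow_succ]
  rw [weight]
  field_simp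

end IsAdmissible

end BoundedCoefficients

section CarlemanFlux

variable {m n : ℕ} {p q : Spacetime m n} {ε : ℝ} {a : ℕ} {z : Spacetime m n → ℝ}
  {z' : Fin m ⊕ Fin n → Spacetime m n → ℝ}

/-- The partial derivatives of `z` from within the set `S`. -/
def pderivWithin (S : Set (Spacetime m n)) (z : Spacetime m n → ℝ) (i : Fin m ⊕ Fin n)
    (q : Spacetime m n) : ℝ := fderivWithin ℝ z S q (coordVec i)

/-- The current `carlemanCurrent` of a function `z` with the partial derivatives `z'`. At boundary
points, `z'` stands for the derivatives from within the domain. -/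
def carlemanFlux (p : Spacetime m n) (ε : ℝ) (a : ℕ) (z : Spacetime m n → ℝ)
    (z' : Fin m ⊕ Fin n → Spacetime m n → ℝ) (i : Fin m ⊕ Fin n) (q : Spacetime m n) : ℝ :=
  current (fun j => multiplier p ε j q) (zerothCoeff p ε q)
    (fun j => pderiv j (zerothCoeff p ε) q) (potential p ε a q) (conj p ε a z q)
    (fun j => conjDeriv p ε a (z q) (fun k => z' k q) j q) i

lemma carlemanFlux_eq_carlemanCurrent (hz : DifferentiableAt ℝ z q) (hf : 0 < fFun p q)
    (he : 0 < damping p ε q) (ha : a ≠ 0) (hz' : ∀ j, z' j q = pderiv j z q)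
    (i : Fin m ⊕ Fin n) : carlemanFlux p ε a z z' i q = carlemanCurrent p ε a z i q := by
  simp only [carlemanFlux, carlemanCurrent, currentField, hz', (hasPartials_conj hz hf he ha).2]

lemma contDiffWithinAt_carlemanFlux {k : WithTop ℕ∞} {s : Set (Spacetime m n)}
    (hf : 0 < fFun p q) (he : 0 < damping p ε q) (hz : ContDiffWithinAt ℝ k z s q)
    (hz' : ∀ j, ContDiffWithinAt ℝ k (z' j) s q) (i : Fin m ⊕ Fin n) :
    ContDiffWithinAt ℝ k (carlemanFlux p ε a z z' i) s q := by
  have hr := rFun_pos hf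
  have hY (j) : ContDiffWithinAt ℝ k (multiplier p ε j) s q :=
    (contDiffAt_multiplier hr j).contDiffWithinAt
  have hγ : ContDiffWithinAt ℝ k (zerothCoeff p ε) s q :=
    (contDiffAt_zerothCoeff hr).contDiffWithinAt
  have hγ' : ContDiffWithinAt ℝ k (pderiv i (zerothCoeff p ε)) s q :=
    ((contDiffAt_zerothCoeff (k := k + 1) hr).fderiv_right le_rfl).clm_apply
      contDiffAt_const |>.contDiffWithinAt
  have hA : ContDiffWithinAt ℝ k (potential p ε a) s q :=
    (contDiffAt_potential hf he a).contDiffWithinAt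
  have hW : ContDiffWithinAt ℝ k (fun y => weight p ε y ^ a) s q :=
    (contDiffAt_weight_pow hf he a).contDiffWithinAt
  have hw : ContDiffWithinAt ℝ k (conj p ε a z) s q := hW.mul hz
  have hζ (j) : ContDiffWithinAt ℝ k
      (fun y => conjDeriv p ε a (z y) (fun k => z' k y) j y) s q :=
    ((contDiffAt_weightPowDeriv hf he a j).contDiffWithinAt.mul hz).add (hW.mul (hz' j))
  have hYζ := ContDiffWithinAt.sum fun j (_ : j ∈ Finset.univ) => (hY j).mul (hζ j)
  have hζζ := ContDiffWithinAt.sum fun j (_ : j ∈ Finset.univ) =>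
    contDiffWithinAt_const (c := gSign j).mul ((hζ j).mul (hζ j))
  exact (((contDiffWithinAt_const.mul (hYζ.mul (hζ i))).sub
    (contDiffWithinAt_const.mul (hζζ.mul (hY i)))).add
    (contDiffWithinAt_const.mul ((contDiffWithinAt_const.mul (hγ.mul (hw.mul (hζ i)))).sub
      (contDiffWithinAt_const.mul ((hw.mul hw).mul hγ'))))).add
    (contDiffWithinAt_const.mul ((hA.mul (hw.mul hw)).mul (hY i)))

lemma IsAdmissible.isBigO_derivAlong_carlemanFlux {R : ℝ} {W : Set (Spacetime m n)}
    (hW : IsAdmissible p ε R W) (ha : 3 ≤ a) (hz : BoundedAtFilter (𝓟 W) z)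
    (hz' : ∀ j, BoundedAtFilter (𝓟 W) (z' j)) :
    derivAlong coordVec (fFun p) (carlemanFlux p ε a z z') =O[𝓟 W] fun q => fFun p q ^ 2 := by
  have hw : conj p ε a z =O[𝓟 W] fun q => fFun p q ^ 2 :=
    (isBigO_mul_of_boundedAtFilter hz (hW.isBigO_weight_pow (by lia))).congr_left
      fun q => mul_comm _ _
  have hζ (j) : (fun q => conjDeriv p ε a (z q) (fun k => z' k q) j q)
      =O[𝓟 W] fun q => fFun p q ^ 2 :=
    ((isBigO_mul_of_boundedAtFilter hz (hW.isBigO_weightPowDeriv ha j)).add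
      (isBigO_mul_of_boundedAtFilter (hz' j) (hW.isBigO_weight_pow (a := a) (by lia)))).congr_left
        fun q => by rw [conjDeriv]; ring
  refine IsBigO.fun_sum fun i _ => isBigO_mul_of_boundedAtFilter ?_
    (isBigO_current hW.boundedAtFilter_fFun hW.boundedAtFilter_multiplier
      hW.boundedAtFilter_zerothCoeff hW.boundedAtFilter_pderiv_zerothCoeff
      (hW.boundedAtFilter_fFun_mul_potential a) hw hζ i)
  refine (boundedAtFilter_const_mul (gSign i / 2) (hW.boundedAtFilter_coord_sub i)).congr_left
    fun q => ?_
  rw [← pderiv, (hasPartials_fFun p q).2]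
  ring

/- On a boundary where `z` vanishes its differential is a multiple `k • dφ` of the conormal, so the
flux is a multiple of the product of `g(∇φ, ∇φ)` and the derivative of `φ` along the multiplier. -/
lemma derivAlong_carlemanFlux_eq {φ : Spacetime m n → ℝ} {k : ℝ} (hz : z q = 0)
    (hz' : ∀ j, z' j q = k * pderiv j φ q) :
    derivAlong coordVec φ (carlemanFlux p ε a z z') q =
      1 / 2 * (weight p ε q ^ a * k) ^ 2 * gradInner φ φ q * fieldDeriv (multiplier p ε) φ q := by
  set K := weight p ε q ^ a * k
  set A := fieldDeriv (multiplier p ε) φ q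
  set G := gradInner φ φ q
  have hζ (j) : conjDeriv p ε a 0 (fun k => z' k q) j q = K * pderiv j φ q := by
    rw [conjDeriv, hz', mul_zero, zero_add, mul_assoc]
  have hA : ∑ j, multiplier p ε j q * (K * pderiv j φ q) = K * A := by
    simp only [A, fieldDeriv, Finset.mul_sum]
    exact Finset.sum_congr rfl fun i _ => by ring
  have hG : ∑ j, gSign j * (K * pderiv j φ q * (K * pderiv j φ q)) = K ^ 2 * G := by
    simp only [G, gradInner, Finset.mul_sum]
    exact Finset.sum_congr rfl fun i _ => by ring
  have hterm (i) : pderiv i φ q * carlemanFlux p ε a z z' i q =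
      K ^ 2 * A * (gSign i * (pderiv i φ q * pderiv i φ q))
        - 1 / 2 * K ^ 2 * G * (multiplier p ε i q * pderiv i φ q) := by
    simp only [carlemanFlux, current, conj, hz, hζ, hA, hG]
    ring
  calc derivAlong coordVec φ (carlemanFlux p ε a z z') q
      = ∑ i, (K ^ 2 * A * (gSign i * (pderiv i φ q * pderiv i φ q))
          - 1 / 2 * K ^ 2 * G * (multiplier p ε i q * pderiv i φ q)) :=
        Finset.sum_congr rfl fun i _ => hterm i
    _ = K ^ 2 * A * G - 1 / 2 * K ^ 2 * G * A := by
        rw [Finset.sum_sub_distrib, ← Finset.mul_sum, ← Finset.mul_sum]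
        rfl
    _ = 1 / 2 * K ^ 2 * G * A := by ring

end CarlemanFlux

section VanishingTrace

variable {E : Type*} [NormedAddCommGroup E] [NormedSpace ℝ E]

lemma exists_eq_mul_of_eq_zero_on_ker {L M : E →L[ℝ] ℝ} (hM : M ≠ 0)
    (h : ∀ w, M w = 0 → L w = 0) : ∃ k : ℝ, ∀ w, L w = k * M w := by
  obtain ⟨v, hv⟩ := exists_map_neg hM
  refine ⟨L v / M v, fun w => ?_⟩
  have hw := h (w - (M w / M v) • v) (by simp [hv.ne])
  rw [map_sub, map_smul, sub_eq_zero, smul_eq_mul] at hw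
  rw [hw]
  ring

/- The zero set of `φ` is parametrized by the kernel of `φ'`, and `z` vanishes along the
parametrization. -/
lemma exists_eq_mul_of_eq_zero_on_zeros [FiniteDimensional ℝ E] {φ z : E → ℝ} {q : E} {S : Set E}
    {φ' L : E →L[ℝ] ℝ}
    (hφ : HasStrictFDerivAt φ φ' q) (hφ0 : φ q = 0) (hφ' : φ' ≠ 0)
    (hz : HasFDerivWithinAt z L S q) (hS : ∀ᶠ y in 𝓝 q, φ y = 0 → y ∈ S ∧ z y = 0) :
    ∃ k : ℝ, ∀ w, L w = k * φ' w := by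
  have hrange : φ'.range = ⊤ :=
    LinearMap.range_eq_top.2 (φ'.toLinearMap.surjective fun h => hφ'
      (ContinuousLinearMap.coe_injective h))
  set g := hφ.implicitFunction φ φ' hrange (φ q)
  have hg : HasFDerivAt g φ'.ker.subtypeL 0 := (hφ.to_implicitFunction hrange).hasFDerivAt
  have hgq : g 0 = q := hφ.implicitFunction_apply_image hrange
  have hgφ : ∀ᶠ y in 𝓝 (0 : φ'.ker), φ (g y) = 0 :=
    (((Continuous.prodMk_right (φ q)).tendsto 0).eventually
      (hφ.map_implicitFunction_eq hrange)).mono fun _ hy => hy.trans hφ0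
  have hgS : ∀ᶠ y in 𝓝 (0 : φ'.ker), g y ∈ S ∧ z (g y) = 0 := by
    filter_upwards [hgφ, hg.continuousAt.eventually (by rwa [hgq])] with y hy hyS using hyS hy
  have hzg : HasFDerivAt (z ∘ g) (L.comp φ'.ker.subtypeL) 0 :=
    hz.comp_hasFDerivAt_of_eq 0 hg (hgS.mono fun _ h => h.1) hgq.symm
  have hzg0 : HasFDerivAt (z ∘ g) (0 : φ'.ker →L[ℝ] ℝ) 0 :=
    (hasFDerivAt_const 0 0).congr_of_eventuallyEq (hgS.mono fun _ h => h.2)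
  exact exists_eq_mul_of_eq_zero_on_ker hφ' fun w hw =>
    DFunLike.congr_fun (hzg.unique hzg0) ⟨w, hw⟩

end VanishingTrace

section BoundaryFlux

variable {m n : ℕ} {T : ℝ} {U : Set (Spacetime m n)} {p q N : Spacetime m n} {ε : ℝ} {a : ℕ}
  {φ z : Spacetime m n → ℝ}

lemma metric_smul_left (c : ℝ) (v w : Spacetime m n) : metric (c • v) w = c * metric v w := by
  change inner ℝ (c • v.2) w.2 - inner ℝ (c • v.1) w.1 = _
  rw [real_inner_smul_left, real_inner_smul_left, metric, mul_sub]

lemma metric_smul_right (c : ℝ) (v w : Spacetime m n) : metric v (c • w) = c * metric v w := by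
  change inner ℝ v.2 (c • w.2) - inner ℝ v.1 (c • w.1) = _
  rw [real_inner_smul_right, real_inner_smul_right, metric, mul_sub]

lemma coord_gradient (hN : ∀ w, fderiv ℝ φ q w = metric N w) (i : Fin m ⊕ Fin n) :
    coord N i = gSign i * pderiv i φ q := by
  rw [pderiv, hN, metric_coordVec, ← mul_assoc, gSign_mul_self, one_mul]

lemma metric_gradient_self (hN : ∀ w, fderiv ℝ φ q w = metric N w) :
    metric N N = gradInner φ φ q := by
  rw [← hN, map_eq_sum_coord]
  refine Finset.sum_congr rfl fun i _ => ?_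
  rw [coord_gradient hN, smul_eq_mul, mul_assoc]
  rfl

lemma fderiv_fFun_rFun_gradient (hr : 0 < rFun p q) (hN : ∀ w, fderiv ℝ φ q w = metric N w) :
    (1 - ε * rFun p q) * fderiv ℝ (fFun p) q N + ε * fFun p q * fderiv ℝ (rFun p) q N =
      fieldDeriv (multiplier p ε) φ q := by
  rw [map_eq_sum_coord (fderiv ℝ (fFun p) q), map_eq_sum_coord (fderiv ℝ (rFun p) q),
    Finset.mul_sum, Finset.mul_sum, ← Finset.sum_add_distrib]
  refine Finset.sum_congr rfl fun i _ => ?_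
  rw [← pderiv, ← pderiv, (hasPartials_fFun p q).2, (hasPartials_rFun hr).2, coord_gradient hN,
    multiplier, damping, radialCoeff, smul_eq_mul, smul_eq_mul]
  rcases i with i | i
  · simp only [gSign_inl, spaceInd_inl]; ring
  · simp only [gSign_inr, spaceInd_inr]; ring

lemma IsDefiningFunctionAt.isOuterUnitNormal (hφ : IsDefiningFunctionAt U q φ)
    (hN : ∀ w, fderiv ℝ φ q w = metric N w) (hpos : 0 < metric N N) :
    IsOuterUnitNormal U q ((√(metric N N))⁻¹ • N) := by
  have hs : 0 < √(metric N N) := Real.sqrt_pos.2 hpos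
  refine ⟨⟨_, hφ.const_mul (inv_pos.2 hs), fun w => ?_⟩, ?_⟩
  · rw [fderiv_const_mul hφ.differentiableAt, metric_smul_left, ← hN w]
    rfl
  · rw [metric_smul_left, metric_smul_right, ← mul_assoc, ← mul_inv, Real.mul_self_sqrt hpos.le,
      inv_mul_cancel₀ hpos.ne']

lemma mem_Gam_of_fieldDeriv_pos (hq : q ∈ lateralBoundary T U) (hf : 0 < fFun p q)
    (hφ : IsDefiningFunctionAt U q φ) (hN : ∀ w, fderiv ℝ φ q w = metric N w)
    (hpos : 0 < metric N N) (hY : 0 < fieldDeriv (multiplier p ε) φ q) : q ∈ Gam T U p ε := by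
  refine ⟨hq, hf, _, hφ.isOuterUnitNormal hN hpos, ?_⟩
  rw [map_smul, map_smul, mul_smul_comm, mul_smul_comm, ← smul_add,
    fderiv_fFun_rFun_gradient (rFun_pos hf) hN]
  exact mul_pos (inv_pos.2 (Real.sqrt_pos.2 hpos)) hY

lemma IsDefiningFunctionAt.derivAlong_carlemanFlux_nonpos (hφ : IsDefiningFunctionAt U q φ)
    (hq : q ∈ lateralBoundary T U) (hpos : 0 < gradInner φ φ q) (hf : 0 < fFun p q)
    (hz : DifferentiableWithinAt ℝ z (U ∪ lateralBoundary T U) q)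
    (hz0 : ∀ y ∈ lateralBoundary T U, z y = 0)
    (hΓ : q ∈ Gam T U p ε → ∀ N, IsOuterUnitNormal U q N → boundaryDeriv T U z q N = 0) :
    derivAlong coordVec φ
      (carlemanFlux p ε a z (pderivWithin (U ∪ lateralBoundary T U) z)) q ≤ 0 := by
  obtain ⟨k, hk⟩ := exists_eq_mul_of_eq_zero_on_zeros hφ.hasStrictFDerivAt hφ.2.1 hφ.2.2.1
    hz.hasFDerivWithinAt ((hφ.eventually_mem_lateralBoundary hq).mono
      fun y hy h0 => ⟨Or.inr (hy h0), hz0 y (hy h0)⟩)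
  rw [derivAlong_carlemanFlux_eq (hz0 q hq) fun j => hk (coordVec j)]
  rcases le_or_gt (fieldDeriv (multiplier p ε) φ q) 0 with hY | hY
  · exact mul_nonpos_of_nonneg_of_nonpos (by positivity) hY
  suffices hk0 : k = 0 by simp [hk0]
  obtain ⟨N, hN⟩ := exists_forall_eq_metric (fderiv ℝ φ q)
  have hNN : 0 < metric N N := by rwa [metric_gradient_self hN]
  have hzN := hΓ (mem_Gam_of_fieldDeriv_pos hq hf hφ hN hNN hY) _ (hφ.isOuterUnitNormal hN hNN)
  rw [boundaryDeriv, map_smul, hk, hN, smul_eq_mul] at hzN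
  simpa [hNN.ne', (Real.sqrt_pos.2 hNN).ne'] using hzN

lemma continuous_gradInner_self (hφ : ContDiff ℝ 1 φ) : Continuous (gradInner φ φ) := by
  have hd (i : Fin m ⊕ Fin n) : Continuous (pderiv i φ) :=
    (hφ.continuous_fderiv one_ne_zero).clm_apply continuous_const
  exact continuous_finsetSum _ fun i _ => continuous_const.mul ((hd i).mul (hd i))

lemma continuousOn_pderivWithin {S : Set (Spacetime m n)} (hz : ContDiffOn ℝ 1 z S)
    (hS : UniqueDiffOn ℝ S) (i : Fin m ⊕ Fin n) : ContinuousOn (pderivWithin S z i) S :=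
  (hz.continuousOn_fderivWithin hS le_rfl).clm_apply continuousOn_const

lemma exists_pderiv_ne_zero (h : fderiv ℝ φ q ≠ 0) : ∃ i, pderiv i φ q ≠ 0 := by
  contrapose! h
  ext w <;> simp [fderiv_eq_sum_pderiv, h]

lemma IsTimelikeDomain.hasNonposFluxAt_carlemanFlux (hU : IsTimelikeDomain T U)
    (hq : q ∈ lateralBoundary T U) (hf : 0 < fFun p q) (he : 0 < damping p ε q)
    (hz : ContDiffOn ℝ 1 z (U ∪ lateralBoundary T U)) (hz0 : ∀ y ∈ lateralBoundary T U, z y = 0)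
    (hΓ : ∀ y ∈ Gam T U p ε, ∀ N, IsOuterUnitNormal U y N → boundaryDeriv T U z y N = 0) :
    HasNonposFluxAt coordVec (U ∩ nullExterior p)
      (carlemanFlux p ε a z (pderivWithin (U ∪ lateralBoundary T U) z)) q := by
  obtain ⟨N, ⟨φ, hφ, hN⟩, hNN⟩ := hU.normal q hq
  have hφ1 : ContDiff ℝ 1 φ := hφ.1.of_le (by norm_cast)
  have hS : ∀ᶠ y in 𝓝 q, φ y ≤ 0 → y ∈ U ∪ lateralBoundary T U := by
    filter_upwards [hφ.2.2.2, hφ.eventually_mem_lateralBoundary hq] with y hyU hyl hy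
    exact hy.lt_or_eq.imp hyU.2 hyl
  rw [metric_gradient_self hN] at hNN
  refine ⟨φ, hφ1, exists_pderiv_ne_zero hφ.2.2.1, ?_⟩
  filter_upwards [hφ.2.2.2, hφ.eventually, hφ.eventually_mem_lateralBoundary hq,
    eventually_pos hf he, hS.eventually_nhds,
    (continuous_gradInner_self hφ1).continuousAt.eventually_const_lt hNN]
    with y hyU hyφ hyl ⟨hyf, hye⟩ hyS hyG
  refine ⟨⟨fun h => hyU.1 h.1, fun h => ⟨hyU.2 h, hyf⟩⟩, fun hy i => ?_, fun hy =>
    (hyφ hy).derivAlong_carlemanFlux_nonpos (hyl hy) hyG hyf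
      (hz.differentiableOn one_ne_zero y (Or.inr (hyl hy))) hz0 (hΓ y)⟩
  have hy' := hyS.self_of_nhds hy
  have hP := contDiffWithinAt_carlemanFlux (a := a) (k := 0) hyf hye
    (contDiffOn_zero.2 hz.continuousOn y hy') (fun j => contDiffOn_zero.2
      (continuousOn_pderivWithin hz hU.uniqueDiffOn j) y hy') i
  exact hP.continuousWithinAt.mono_of_mem_nhdsWithin (mem_nhdsWithin_iff_eventually.2 hyS)

end BoundaryFlux

/-! ### Uniqueness -/

section Uniqueness

variable {m n : ℕ} {T R : ℝ} {U W S : Set (Spacetime m n)} {p q : Spacetime m n} {ε : ℝ} {a : ℕ}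
  {X : Spacetime m n → Spacetime m n} {V F₁ F₂ H₁ H₂ z z₁ z₂ : Spacetime m n → ℝ}

lemma IsSolution.sub (hU : IsTimelikeDomain T U) (h₁ : IsSolution T U X V F₁ H₁ z₁)
    (h₂ : IsSolution T U X V F₂ H₂ z₂) :
    IsSolution T U X V (F₁ - F₂) (H₁ - H₂) fun y => z₁ y - z₂ y where
  contDiffOn_two := h₁.contDiffOn_two.sub h₂.contDiffOn_two
  contDiffOn_one := h₁.contDiffOn_one.sub h₂.contDiffOn_one
  equation q hq := by
    have hc₁ := h₁.contDiffOn_two.contDiffAt (hU.isOpen.mem_nhds hq)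
    have hc₂ := h₂.contDiffOn_two.contDiffAt (hU.isOpen.mem_nhds hq)
    rw [box_sub hc₁ hc₂, fderiv_fun_sub (hc₁.differentiableAt two_ne_zero)
      (hc₂.differentiableAt two_ne_zero), sub_apply, Pi.sub_apply]
    linear_combination h₁.equation q hq - h₂.equation q hq
  dirichlet q hq := by rw [h₁.dirichlet q hq, h₂.dirichlet q hq, Pi.sub_apply]

lemma IsTimelikeDomain.boundaryDeriv_sub (hU : IsTimelikeDomain T U)
    (hz₁ : ContDiffOn ℝ 1 z₁ (U ∪ lateralBoundary T U))
    (hz₂ : ContDiffOn ℝ 1 z₂ (U ∪ lateralBoundary T U)) (hq : q ∈ lateralBoundary T U)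
    (N : Spacetime m n) : boundaryDeriv T U (fun y => z₁ y - z₂ y) q N =
      boundaryDeriv T U z₁ q N - boundaryDeriv T U z₂ q N := by
  have hqS : q ∈ U ∪ lateralBoundary T U := Or.inr hq
  rw [boundaryDeriv, fderivWithin_fun_sub (hU.uniqueDiffOn q hqS)
    (hz₁.differentiableOn one_ne_zero q hqS) (hz₂.differentiableOn one_ne_zero q hqS), sub_apply]
  rfl

lemma pderivWithin_eventuallyEq (hU : IsOpen U) (hUS : U ⊆ S) (hq : q ∈ U) (i : Fin m ⊕ Fin n) :
    pderivWithin S z i =ᶠ[𝓝 q] pderiv i z := by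
  filter_upwards [hU.mem_nhds hq] with y hy
  rw [pderivWithin, fderivWithin_of_mem_nhds (mem_of_superset (hU.mem_nhds hy) hUS), pderiv]

lemma divergence_carlemanFlux (hz : ContDiffAt ℝ 1 z q) (hf : 0 < fFun p q)
    (he : 0 < damping p ε q) (ha : a ≠ 0) {z' : Fin m ⊕ Fin n → Spacetime m n → ℝ}
    (hz' : ∀ j, z' j =ᶠ[𝓝 q] pderiv j z) :
    divergence coordVec (carlemanFlux p ε a z z') q = fieldDiv (carlemanCurrent p ε a z) q := by
  refine Finset.sum_congr rfl fun i _ => DFunLike.congr_fun (EventuallyEq.fderiv_eq ?_) _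
  filter_upwards [eventually_all.2 hz', eventually_pos hf he, hz.eventually (by simp)]
    with y hy' hy hyz
  exact carlemanFlux_eq_carlemanCurrent (hyz.differentiableAt one_ne_zero) hy.1 hy.2 ha hy' i

lemma boundedAtFilter_of_continuousOn_closure {u : Spacetime m n → ℝ}
    (hW : IsCompact (closure W)) (hu : ContinuousOn u (closure W)) :
    BoundedAtFilter (𝓟 W) u := by
  obtain ⟨C, hC⟩ := hW.exists_bound_of_continuousOn hu
  exact boundedAtFilter_principal fun q hq => hC q (subset_closure hq)

lemma IsTimelikeDomain.contDiffOn_carlemanFlux (hU : IsTimelikeDomain T U)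
    (hW : IsAdmissible p ε R (U ∩ nullExterior p)) (hz : ContDiffOn ℝ 2 z U)
    (i : Fin m ⊕ Fin n) :
    ContDiffOn ℝ 1 (carlemanFlux p ε a z (pderivWithin (U ∪ lateralBoundary T U) z) i)
      (U ∩ nullExterior p) := fun q hq => by
  have hzq : ContDiffAt ℝ 2 z q := hz.contDiffAt (hU.isOpen.mem_nhds hq.1)
  refine contDiffWithinAt_carlemanFlux hq.2 (hW.damping_pos hq)
    (hzq.of_le one_le_two).contDiffWithinAt (fun j => ?_) i
  exact (((hzq.fderiv_right (m := 1) le_rfl).clm_apply contDiffAt_const).congr_of_eventuallyEq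
    (pderivWithin_eventuallyEq hU.isOpen subset_union_left hq.1 j)).contDiffWithinAt

lemma IsTimelikeDomain.hasNonposFluxAt_of_mem_frontier (hU : IsTimelikeDomain T U)
    (hW : IsAdmissible p ε R (U ∩ nullExterior p)) (hε : 0 < ε)
    (hS : closure (U ∩ nullExterior p) ⊆ U ∪ lateralBoundary T U)
    (hz : IsSolution T U X V 0 0 z)
    (hΓ : ∀ q ∈ Gam T U p ε, ∀ N, IsOuterUnitNormal U q N → boundaryDeriv T U z q N = 0)
    (hq : q ∈ frontier (U ∩ nullExterior p)) (hf : 0 < fFun p q) :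
    HasNonposFluxAt coordVec (U ∩ nullExterior p)
      (carlemanFlux p ε a z (pderivWithin (U ∪ lateralBoundary T U) z)) q := by
  have hql : q ∈ lateralBoundary T U := (hS hq.1).resolve_left fun hqU =>
    (hU.isOpen.inter (isOpen_nullExterior p)).inter_frontier_eq.subset ⟨⟨hqU, hf⟩, hq⟩
  have hqε : ε * rFun p q ≤ 1 / 2 := (mul_le_mul_of_nonneg_left
    (rFun_le_of_mem_closure hW.rFun_le hq.1) hε.le).trans hW.mul_le_half
  exact hU.hasNonposFluxAt_carlemanFlux hql hf (by linarith [half_le_damping hqε])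
    hz.contDiffOn_one hz.dirichlet hΓ

lemma IsTimelikeDomain.conj_eq_zero (hU : IsTimelikeDomain T U)
    (hW : IsAdmissible p ε R (U ∩ nullExterior p)) (hε : 0 < ε)
    (hS : closure (U ∩ nullExterior p) ⊆ U ∪ lateralBoundary T U)
    (hz : IsSolution T U X V 0 0 z)
    (hΓ : ∀ q ∈ Gam T U p ε, ∀ N, IsOuterUnitNormal U q N → boundaryDeriv T U z q N = 0)
    {C Vb : ℝ} (hC : 0 ≤ C)
    (hX : ∀ q ∈ U ∩ nullExterior p, ∑ i, coord (X q) i ^ 2 ≤ C * fFun p q)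
    (hV : ∀ q ∈ U ∩ nullExterior p, |V q| ≤ Vb) (ha : Absorbing m n ε R C Vb a) (ha3 : 3 ≤ a)
    (hq : q ∈ U ∩ nullExterior p) : conj p ε a z q = 0 := by
  set D := U ∩ nullExterior p
  set P := carlemanFlux p ε a z (pderivWithin (U ∪ lateralBoundary T U) z)
  have hDo : IsOpen D := hU.isOpen.inter (isOpen_nullExterior p)
  have hDb : Bornology.IsBounded D := isBounded_region hW.rFun_le
  have hzAt {y} (hy : y ∈ D) : ContDiffAt ℝ 2 z y :=
    hz.contDiffOn_two.contDiffAt (hU.isOpen.mem_nhds hy.1)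
  have hbdd {u : Spacetime m n → ℝ} (hu : ContinuousOn u (U ∪ lateralBoundary T U)) :
      BoundedAtFilter (𝓟 D) u :=
    boundedAtFilter_of_continuousOn_closure hDb.isCompact_closure (hu.mono hS)
  have hdiv : ∀ y ∈ D, (a : ℝ) ^ 2 * (ε / rFun p y) / 16 * conj p ε a z y ^ 2 ≤
      divergence coordVec P y := fun y hy => by
    rw [divergence_carlemanFlux ((hzAt hy).of_le one_le_two) hy.2 (hW.damping_pos hy) (by lia)
      (pderivWithin_eventuallyEq hU.isOpen subset_union_left hy.1)]
    exact ha.carleman_pointwise (hzAt hy) hy.2 hε.le (hW.mul_rFun_le_half hy) (hW.rFun_le y hy) hC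
      (hX y hy) (hV y hy) (hz.equation y hy.1)
  have hcont : ContinuousOn
      (fun y => (a : ℝ) ^ 2 * (ε / rFun p y) / 16 * conj p ε a z y ^ 2) D := fun y hy =>
    (((continuousAt_const.mul (continuousAt_const.div (continuous_rFun p).continuousAt
      (rFun_pos hy.2).ne')).div_const _).mul
      ((contDiffAt_conj (hzAt hy) hy.2 (hW.damping_pos hy) a).continuousAt.pow
        2)).continuousWithinAt
  have hzero := eq_zero_of_le_divergence hDo hDb ((contDiff_fFun p).of_le le_top)
    (fun y hy => hy.2) (hU.contDiffOn_carlemanFlux hW hz.contDiffOn_two)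
    (hW.isBigO_derivAlong_carlemanFlux ha3 (hbdd hz.contDiffOn_one.continuousOn)
      fun j => hbdd (continuousOn_pderivWithin hz.contDiffOn_one hU.uniqueDiffOn j))
    (fun y => hU.hasNonposFluxAt_of_mem_frontier hW hε hS hz hΓ) hcont
    (fun y hy => by have := rFun_pos hy.2; positivity) hdiv hq
  have hr := rFun_pos hq.2
  have ha0 : a ≠ 0 := by lia
  simpa [hε.ne', hr.ne', ha0] using hzero

theorem IsTimelikeDomain.eq_zero (hm : 0 < m) (hU : IsTimelikeDomain T U)
    (hR : ∀ q ∈ U ∩ nullExterior p, rFun p q ≤ R) (hT : ∀ i, R + |p.1 i| < T) (hε : 0 < ε)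
    (hεR : ε * R ≤ 1 / 2) (hX : ContDiffOn ℝ 1 X (closure U)) (hV : ContinuousOn V (closure U))
    (hX0 : ∀ q ∈ U, fFun p q = 0 → X q = 0) (hz : IsSolution T U X V 0 0 z)
    (hΓ : ∀ q ∈ Gam T U p ε, ∀ N, IsOuterUnitNormal U q N → boundaryDeriv T U z q N = 0)
    (hq : q ∈ U ∩ nullExterior p) : z q = 0 := by
  have hK : IsCompact (closure (U ∩ nullExterior p)) := (isBounded_region hR).isCompact_closure
  have hS := hU.closure_region_subset hR hT
  have hW : IsAdmissible p ε R (U ∩ nullExterior p) := ⟨hε.le, fun q hq => hq.2, hR, hεR⟩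
  obtain ⟨C, hC, hXC⟩ := hU.exists_sum_coord_sq_le hm hK hS
    (hX.mono union_lateralBoundary_subset_closure) hX0
  obtain ⟨Vb, hVb⟩ := hK.exists_bound_of_continuousOn (hV.mono (closure_mono inter_subset_left))
  obtain ⟨a, ha, ha3⟩ :=
    ((eventually_absorbing m n hε R C Vb).and (eventually_ge_atTop 3)).exists
  have hconj := hU.conj_eq_zero hW hε hS hz hΓ hC hXC (fun y hy => hVb y (subset_closure hy)) ha
    ha3 hq
  have hweight : 0 < weight p ε q := mul_pos hq.2 (inv_pos.2 (hW.damping_pos hq))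
  exact (mul_eq_zero.1 hconj).resolve_left (pow_pos hweight a).ne'

end Uniqueness

end Ultrahyperbolic

end

open Ultrahyperbolic in
theorem theorem4p1_general {m n : ℕ} (hm : 0 < m) {T : ℝ} {U : Set (Spacetime m n)}
    (hU : IsTimelikeDomain T U) {p : Spacetime m n} {R ε : ℝ}
    (hR : ∀ q ∈ U ∩ nullExterior p, rFun p q ≤ R) (hT : ∀ i, R + |p.1 i| < T) (hε : 0 < ε)
    (hεR : ε * R ≤ 1 / 2) {X : Spacetime m n → Spacetime m n} {V F H z₁ z₂ : Spacetime m n → ℝ}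
    (hX : ContDiffOn ℝ 1 X (closure U)) (hV : ContinuousOn V (closure U))
    (hX0 : ∀ q ∈ U, fFun p q = 0 → X q = 0) (h₁ : IsSolution T U X V F H z₁)
    (h₂ : IsSolution T U X V F H z₂)
    (hΓ : ∀ q ∈ Gam T U p ε, ∀ N, IsOuterUnitNormal U q N →
      boundaryDeriv T U z₁ q N = boundaryDeriv T U z₂ q N) :
    ∀ q ∈ U ∩ nullExterior p, z₁ q = z₂ q := by
  have hz : IsSolution T U X V 0 0 fun y => z₁ y - z₂ y := by simpa using h₁.sub hU h₂
  refine fun q hq => sub_eq_zero.1 <|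
    hU.eq_zero hm hR hT hε hεR hX hV hX0 hz (fun y hy N hN => ?_) hq
  rw [hU.boundaryDeriv_sub h₁.contDiffOn_one h₂.contDiffOn_one hy.1, hΓ y hy N hN, sub_self]

theorem theorem4p1 (m n : ℕ) (hm : 0 < m) (hn : 0 < n) :
    ∃ c : ℝ, 0 < c ∧
      ∀ (T : ℝ) (U : Set (Spacetime m n)) (p : Spacetime m n) (R ε : ℝ),
        (Ultrahyperbolic.IsStaticDomain T U ∨ Ultrahyperbolic.IsMovingDomain T U) →
        IsLUB (Ultrahyperbolic.rFun p '' (U ∩ Ultrahyperbolic.nullExterior p)) R →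
        (∀ i, R + |p.1 i| < T) →
        0 < ε → ε * R ≤ c →
        ∀ (X : Spacetime m n → Spacetime m n) (V F H z₁ z₂ : Spacetime m n → ℝ),
          ContDiffOn ℝ ∞ X (closure U) →
          ContDiffOn ℝ ∞ V (closure U) →
          ContDiffOn ℝ ∞ F (closure U) →
          (∀ q ∈ U, Ultrahyperbolic.fFun p q = 0 → X q = 0) →
          Ultrahyperbolic.IsSolution T U X V F H z₁ →
          Ultrahyperbolic.IsSolution T U X V F H z₂ →
          (∀ q ∈ Ultrahyperbolic.Gam T U p ε, ∀ N, Ultrahyperbolic.IsOuterUnitNormal U q N →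
            Ultrahyperbolic.boundaryDeriv T U z₁ q N = Ultrahyperbolic.boundaryDeriv T U z₂ q N) →
          ∀ q ∈ U ∩ Ultrahyperbolic.nullExterior p, z₁ q = z₂ q :=
  ⟨1 / 2, one_half_pos, fun _ _ _ _ _ hU hR hT hε hεR _ _ _ _ _ _ hX hV _ =>
    theorem4p1_general hm (hU.elim (·.isTimelikeDomain) (·.isTimelikeDomain))
      (fun q hq => hR.1 ⟨q, hq, rfl⟩) hT hε hεR (hX.of_le (by norm_cast)) hV.continuousOn⟩
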